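/- **Conventions.** All vector spaces are over $\mathbb{Q}$ and all gradings are cohomological (differentials have degree $+1$). A *cdga* is a non-negatively graded, graded-commutative differential graded algebra; it is *simply connected* if $A^0=\mathbb{Q}\cdot 1\neq 0$ and $A^1=0$. An *$A$-module* is a $\mathbb{Z}$-graded differential graded $A$-module. For $A$-modules $N,M$ let $[N,M]_A$ be the complex with $[N,M]_A^k$ the space of $A$-linear maps $\lambda$ of degree $k$ (with $\lambda(an)=(-1)^{k|a|}a\lambda(n)$) and $d\lambda=d_M\lambda-(-1)^k\lambda d_N$. An $A$-module $P$ is *cofibrant* if $0\to P$ has the left lifting property against surjective quasi-isomorphisms; a *cofibrant replacement* of $N$ is a quasi-isomorphism $N^c\to N$ with $N^c$ cofibrant, and $$\mathrm{Ext}^n_A(N,M)=H^n[N^c,M]_A .$$ For graded modules $V,W$ over a graded-commutative algebra $H$, $\mathrm{Ext}^{p,q}_H(V,W)$ is the $p$-th cohomology of the complex of degree-$q$ $H$-linear maps from a projective resolution of $V$ (by graded $H$-modules, with degree-$0$ differentials) to $W$. The *bar construction* $B=B(A;A;N)\to N$ is the totalisation of the normalised simplicial bar construction, with underlying graded $A$-module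 $\bigoplus_{k\ge 0}A\otimes (A/\mathbb{Q})^{\otimes k}\otimes N$, where the $k$-th summand is shifted so that degree equals internal degree minus $k$. Its *skeletal filtration* is $\mathcal F_{p}=\bigoplus_{k\le p}A\otimes (A/\mathbb{Q})^{\otimes k}\otimes N$ (so $\mathcal F_p=0$ for $p<0$), and it induces on $C=[B,M]_A$ the decreasing filtration $F^pC=\ker([B,M]_A\to[\mathcal F_{p-1},M]_A)$. **Proposition (hyper-Ext spectral sequence).** Let $A$ be a simply connected cdga and let $M,N$ be $A$-modules such that $H^i(M)=0$ for all sufficiently large $i$ and $H^i(N)=0$ for all sufficiently small $i$. Then: 1. $B(A;A;N)\to N$ is a cofibrant replacement of $N$, and the normalised bar complex $\cdots\to H(A)\otimes (H(A)/\mathbb{Q})\otimes H(N)\to H(A)\otimes H(N)\to H(N)$ is a projective resolution of the graded $H(A)$-module $H(N)$. 2. The spectral sequence $(E_r^{p,q},d_r)_{r\ge 1}$ of the filtered complex $(C,F^\bullet)$, with $d_r$ of bidegree $(r,1-r)$, satisfies $E_2^{p,q}=0$ for $p<0$ and, for $p\ge 0$, $$E_2^{p,q}\;\cong\;\mathrm{Ext}^{p,q}_{H(A)}(H(N),H(M)),$$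 where the isomorphism is the canonical one: a class represented by $f\in F^pC^{p+q}$ with $df\in F^{p+2}C$ is sent to the class of the map that $f$ induces, up to the customary sign, on cohomology in the normalised bar complex of $H(N)$, pulled back along a comparison map if $\mathrm{Ext}$ is computed from another projective resolution. 3. The spectral sequence converges strongly to $\mathrm{Ext}_A^{*}(N,M)$: for every cofibrant replacement $N^c\to N$ there is a map $N^c\to B$ over $N$ which induces isomorphisms $H^n(C)\cong H^n[N^c,M]_A=\mathrm{Ext}^n_A(N,M)$, and for every $n$ the filtration of $\mathrm{Ext}_A^n(N,M)$ by $F^p\mathrm{Ext}^n_A(N,M)=\mathrm{im}\,(H^n(F^pC)\to H^n(C)\cong \mathrm{Ext}^n_A(N,M))$ is exhaustive, Hausdorff and complete, with $F^p\mathrm{Ext}^n_A(N,M)/F^{p+1}\mathrm{Ext}^n_A(N,M)\cong E_\infty^{p,n-p}$ canonically. In short, there is a strongly convergent spectral sequence $$E_2^{p,q}=\mathrm{Ext}^{p,q}_{H(A)}(H(N),H(M))\Longrightarrow \mathrm{Ext}_A^{p+q}(N,M)$$ arising from the skeletal filtration of the bar resolution. -/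

import Mathlib

universe u

namespace HyperExt

open scoped TensorProduct DirectSum

/-! ### Internally graded rational vector spaces -/

/-- The sign `(-1)^n`. -/
def sgn (n : ℤ) : ℚ := (-1) ^ n

theorem sgn_zero : sgn 0 = 1 := by simp [sgn]

theorem sgn_one : sgn 1 = -1 := by simp [sgn]

theorem sgn_add (m n : ℤ) : sgn (m + n) = sgn m * sgn n := by
  simp [sgn, zpow_add₀]

theorem sgn_sq (n : ℤ) : sgn n * sgn n = 1 := by
  unfold sgn
  rw [← mul_zpow]
  simp

section Graded

variable {V W : Type*} [AddCommMonoid V] [Module ℚ V] [AddCommMonoid W] [Module ℚ W]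
  {gr : ℤ → Submodule ℚ V}

/-- The linear map out of a graded vector space that is given by `φ i` on the degree `i` part. -/
noncomputable def glift (h : DirectSum.IsInternal gr) (φ : ∀ i, gr i →ₗ[ℚ] W) : V →ₗ[ℚ] W :=
  (DirectSum.toModule ℚ ℤ W φ).comp
    (LinearEquiv.ofBijective (DirectSum.coeLinearMap gr) h).symm.toLinearMap

theorem glift_of_mem (h : DirectSum.IsInternal gr) (φ : ∀ i, gr i →ₗ[ℚ] W) {i : ℤ} {x : V}
    (hx : x ∈ gr i) : glift h φ x = φ i ⟨x, hx⟩ := by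
  have : (LinearEquiv.ofBijective (DirectSum.coeLinearMap gr) h).symm x
      = DirectSum.lof ℚ ℤ (fun i => gr i) i ⟨x, hx⟩ := by
    rw [LinearEquiv.symm_apply_eq]
    exact (DirectSum.coeLinearMap_lof gr i ⟨x, hx⟩).symm
  simp [glift, this]

theorem graded_induction (h : DirectSum.IsInternal gr) {P : V → Prop} (h0 : P 0)
    (hadd : ∀ x y, P x → P y → P (x + y)) (hgr : ∀ i, ∀ x ∈ gr i, P x) (x : V) : P x := by
  have hx : x ∈ ⨆ i, gr i := by rw [h.submodule_iSup_eq_top]; trivial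
  exact Submodule.iSup_induction gr (motive := P) hx hgr h0 hadd

/-- The projection of a graded vector space to its degree `n` part. -/
noncomputable def proj (h : DirectSum.IsInternal gr) (n : ℤ) : V →ₗ[ℚ] V :=
  glift h fun i => if i = n then (gr i).subtype else 0

theorem proj_same (h : DirectSum.IsInternal gr) {n : ℤ} {x : V} (hx : x ∈ gr n) :
    proj h n x = x := by
  simp [proj, glift_of_mem h _ hx]

theorem proj_ne (h : DirectSum.IsInternal gr) {m n : ℤ} {x : V} (hx : x ∈ gr m) (hmn : m ≠ n) :
    proj h n x = 0 := by
  simp [proj, glift_of_mem h _ hx, hmn]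

theorem proj_mem (h : DirectSum.IsInternal gr) (n : ℤ) (x : V) : proj h n x ∈ gr n := by
  induction x using graded_induction h with
  | h0 => simp
  | hadd x y hx hy => rw [map_add]; exact add_mem hx hy
  | hgr i x hx =>
    by_cases hin : i = n
    · subst hin; rwa [proj_same h hx]
    · rw [proj_ne h hx hin]; exact zero_mem _

/-- The parity involution `x ↦ (-1)^{|x|} x`. -/
noncomputable def parity (h : DirectSum.IsInternal gr) : V →ₗ[ℚ] V :=
  glift h fun i => sgn i • (gr i).subtype

theorem parity_of_mem (h : DirectSum.IsInternal gr) {n : ℤ} {x : V} (hx : x ∈ gr n) :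
    parity h x = sgn n • x := by
  simp [parity, glift_of_mem h _ hx]

theorem isInternal_of_proj (p : ℤ → V →ₗ[ℚ] V) (h1 : ∀ n, ∀ x ∈ gr n, p n x = x)
    (h2 : ∀ m n, ∀ x ∈ gr m, m ≠ n → p n x = 0) (h3 : ∀ x, x ∈ ⨆ i, gr i) :
    DirectSum.IsInternal gr := by
  have key : ∀ (x : ⨁ i, gr i) (n : ℤ), p n (DirectSum.coeLinearMap gr x) = x n := by
    intro x n
    induction x using DirectSum.induction_on with
    | zero => simp
    | add x y hx hy => simp [map_add, hx, hy]
    | of i x =>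
      have e : DirectSum.coeLinearMap gr (DirectSum.of (fun i => gr i) i x) = x :=
        DirectSum.coeLinearMap_lof gr i x
      rw [e]
      by_cases hin : i = n
      · subst hin
        rw [h1 _ _ x.2, DirectSum.of_eq_same]
      · rw [h2 _ _ _ x.2 hin, DirectSum.of_eq_of_ne _ _ _ (Ne.symm hin)]
        rfl
  constructor
  · intro x y hxy
    have hxy' : DirectSum.coeLinearMap gr x = DirectSum.coeLinearMap gr y := hxy
    refine DFinsupp.ext fun n => Subtype.ext ?_
    have := key x n
    rw [hxy', key y n] at this
    exact this.symm
  · intro x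
    have := h3 x
    rw [← DirectSum.range_coeLinearMap] at this
    exact this

/-- The action map `R ⊗ V → V`, `a ⊗ x ↦ a x`, of a module over a `ℚ`-algebra. -/
noncomputable def actMap (R V : Type*) [Ring R] [Algebra ℚ R] [AddCommMonoid V] [Module ℚ V]
    [Module R V] [IsScalarTower ℚ R V] : R ⊗[ℚ] V →ₗ[R] V where
  toFun := TensorProduct.lift (Algebra.lsmul ℚ ℚ V).toLinearMap
  map_add' := map_add _
  map_smul' := by
    intro a t
    induction t using TensorProduct.induction_on with
    | zero => simp
    | add x y hx hy => simp only [smul_add, map_add, hx, hy]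
    | tmul b x => simp [TensorProduct.smul_tmul']

end Graded

/-! ### Graded-commutative algebras and graded modules -/

/-- A graded-commutative `ℚ`-algebra. -/
structure GAlg where
  carrier : Type u
  [ring : Ring carrier]
  [algebra : Algebra ℚ carrier]
  gr : ℤ → Submodule ℚ carrier
  internal : DirectSum.IsInternal gr
  one_mem : (1 : carrier) ∈ gr 0
  mul_mem : ∀ {i j : ℤ} {a b : carrier}, a ∈ gr i → b ∈ gr j → a * b ∈ gr (i + j)
  mul_comm : ∀ {i j : ℤ} {a b : carrier}, a ∈ gr i → b ∈ gr j → a * b = sgn (i * j) • (b * a)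

attribute [instance] GAlg.ring GAlg.algebra

instance : CoeSort GAlg.{u} (Type u) := ⟨GAlg.carrier⟩

/-- A `ℤ`-graded (left) module over a graded-commutative `ℚ`-algebra. -/
structure GMod (R : GAlg.{u}) where
  carrier : Type u
  [addCommGroup : AddCommGroup carrier]
  [module : Module R carrier]
  [moduleRat : Module ℚ carrier]
  [tower : IsScalarTower ℚ R carrier]
  gr : ℤ → Submodule ℚ carrier
  internal : DirectSum.IsInternal gr
  smul_mem : ∀ {i j : ℤ} {a : R} {x : carrier}, a ∈ R.gr i → x ∈ gr j → a • x ∈ gr (i + j)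

attribute [instance] GMod.addCommGroup GMod.module GMod.moduleRat GMod.tower

instance (R : GAlg.{u}) : CoeSort (GMod.{u} R) (Type u) := ⟨GMod.carrier⟩

/-- The space of `R`-linear maps of degree `k` from `N` to `M`, that is, the space of
morphisms of graded `R`-modules from `N` to the shift `M[k]` (on which `a ∈ R` of degree `i` acts
by `(-1)^{k i} a`). -/
def GMod.homDeg {R : GAlg.{u}} (N M : GMod.{u} R) (k : ℤ) : Submodule ℚ (N →ₗ[ℚ] M) where
  carrier := {f | (∀ i, ∀ x ∈ N.gr i, f x ∈ M.gr (i + k)) ∧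
    ∀ i, ∀ a ∈ R.gr i, ∀ x, f (a • x) = sgn (k * i) • a • f x}
  add_mem' := by
    rintro f g ⟨hf, hf'⟩ ⟨hg, hg'⟩
    refine ⟨fun i x hx => add_mem (hf i x hx) (hg i x hx), fun i a ha x => ?_⟩
    simp [hf' i a ha x, hg' i a ha x]
  zero_mem' := ⟨fun i x _ => zero_mem _, fun i a _ x => by simp⟩
  smul_mem' := by
    rintro c f ⟨hf, hf'⟩
    refine ⟨fun i x hx => Submodule.smul_mem _ c (hf i x hx), fun i a ha x => ?_⟩
    simp only [LinearMap.smul_apply, hf' i a ha x]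
    rw [smul_comm c, smul_comm c a]

namespace GMod

variable {R : GAlg.{u}}

theorem ext_graded {V : Type*} [AddCommGroup V] [Module ℚ V] (M : GMod.{u} R) {f g : M →ₗ[ℚ] V}
    (h : ∀ i, ∀ x ∈ M.gr i, f x = g x) : f = g := by
  ext x
  induction x using graded_induction M.internal with
  | h0 => simp
  | hadd x y hx hy => simp [hx, hy]
  | hgr i x hx => exact h i x hx

theorem proj_map {M M' : GMod.{u} R} (f : M →ₗ[ℚ] M') (k : ℤ)
    (hf : ∀ i, ∀ x ∈ M.gr i, f x ∈ M'.gr (i + k)) (n : ℤ) (x : M) :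
    proj M'.internal (n + k) (f x) = f (proj M.internal n x) := by
  induction x using graded_induction M.internal with
  | h0 => simp
  | hadd x y hx hy => simp [hx, hy]
  | hgr i x hx =>
    by_cases hin : i = n
    · subst hin; rw [proj_same _ hx, proj_same _ (hf _ _ hx)]
    · rw [proj_ne _ hx hin, proj_ne _ (hf _ _ hx) (by omega), map_zero]

/-- The quotient of a graded module by a homogeneous submodule. -/
def quot (M : GMod.{u} R) (L : Submodule R M)
    (hL : ∀ x ∈ L, ∀ n, proj M.internal n x ∈ L) : GMod.{u} R where
  carrier := M ⧸ L
  gr n := (M.gr n).map (L.mkQ.restrictScalars ℚ)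
  internal := by
    refine isInternal_of_proj
      (fun n => ((L.restrictScalars ℚ).mapQ (L.restrictScalars ℚ) (proj M.internal n)
        (fun x hx => hL x hx n) : _ →ₗ[ℚ] _)) ?_ ?_ ?_
    · rintro n _ ⟨x, hx, rfl⟩
      change Submodule.Quotient.mk (proj M.internal n x) = _
      rw [proj_same _ hx]; rfl
    · rintro m n _ ⟨x, hx, rfl⟩ hmn
      change Submodule.Quotient.mk (proj M.internal n x) = _
      rw [proj_ne _ hx hmn]; rfl
    · intro x
      obtain ⟨x, rfl⟩ := L.mkQ_surjective x
      induction x using graded_induction M.internal with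
      | h0 => simp
      | hadd x y hx hy => rw [map_add]; exact add_mem hx hy
      | hgr i x hx => exact Submodule.mem_iSup_of_mem i ⟨x, hx, rfl⟩
  smul_mem := by
    rintro i j a _ ha ⟨x, hx, rfl⟩
    exact ⟨a • x, M.smul_mem ha hx, rfl⟩

/-- The free graded `R`-module `R ⊗ M` on the graded vector space underlying `M`. -/
def tens (M : GMod.{u} R) : GMod.{u} R where
  carrier := R ⊗[ℚ] M
  gr n := Submodule.span ℚ {t | ∃ i j a x, i + j = n ∧ a ∈ R.gr i ∧ x ∈ M.gr j ∧ t = a ⊗ₜ[ℚ] x}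
  internal := by
    refine isInternal_of_proj (fun n => TensorProduct.lift (glift R.internal fun i =>
      ((TensorProduct.mk ℚ R M).compl₂ (proj M.internal (n - i))).comp (R.gr i).subtype))
      ?_ ?_ ?_
    · intro n t ht
      induction ht using Submodule.span_induction with
      | zero => simp
      | add x y _ _ hx hy => rw [map_add, hx, hy]
      | smul c x _ hx => rw [map_smul, hx]
      | mem t ht =>
        obtain ⟨i, j, a, x, hij, ha, hx, rfl⟩ := ht
        have : j = n - i := by omega
        subst this
        simp [glift_of_mem _ _ ha, proj_same _ hx]
    · intro m n t ht hmn
      induction ht using Submodule.span_induction with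
      | zero => simp
      | add x y _ _ hx hy => rw [map_add, hx, hy, add_zero]
      | smul c x _ hx => rw [map_smul, hx, smul_zero]
      | mem t ht =>
        obtain ⟨i, j, a, x, hij, ha, hx, rfl⟩ := ht
        have : j ≠ n - i := by omega
        simp [glift_of_mem _ _ ha, proj_ne _ hx this]
    · intro t
      induction t using TensorProduct.induction_on with
      | zero => exact zero_mem _
      | add x y hx hy => exact add_mem hx hy
      | tmul a x =>
        induction a using graded_induction R.internal with
        | h0 => rw [TensorProduct.zero_tmul]; exact zero_mem _
        | hadd a b ha hb => rw [TensorProduct.add_tmul]; exact add_mem ha hb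
        | hgr i a ha =>
          induction x using graded_induction M.internal with
          | h0 => rw [TensorProduct.tmul_zero]; exact zero_mem _
          | hadd x y hx hy => rw [TensorProduct.tmul_add]; exact add_mem hx hy
          | hgr j x hx =>
            exact Submodule.mem_iSup_of_mem (i + j)
              (Submodule.subset_span ⟨i, j, a, x, rfl, ha, hx, rfl⟩)
  smul_mem := by
    intro i j a t ha ht
    induction ht using Submodule.span_induction with
    | zero => simp
    | add x y _ _ hx hy => rw [smul_add]; exact add_mem hx hy
    | smul c x _ hx => rw [smul_comm]; exact Submodule.smul_mem _ _ hx
    | mem t ht =>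
      obtain ⟨i', j', b, x, hij, hb, hx, rfl⟩ := ht
      exact Submodule.subset_span ⟨i + i', j', a * b, x, by omega, R.mul_mem ha hb, hx, rfl⟩

/-- The `R`-linear action map `R ⊗ M → M`, `a ⊗ x ↦ a x`. -/
noncomputable def act (M : GMod.{u} R) : M.tens →ₗ[R] M :=
  actMap R M

/-- The map `id ⊗ f`. -/
noncomputable def tensMap {M M' : GMod.{u} R} (f : M →ₗ[ℚ] M') : M.tens →ₗ[R] M'.tens :=
  LinearMap.baseChange R f

/-- The map `x ↦ 1 ⊗ x`. -/
def unitMap (M : GMod.{u} R) : M →ₗ[ℚ] M.tens := TensorProduct.mk ℚ R M 1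

/-- The pure tensor `a ⊗ x`. -/
def tmul (M : GMod.{u} R) (a : R) (x : M) : M.tens := a ⊗ₜ[ℚ] x

theorem tens_induction {M : GMod.{u} R} {P : M.tens → Prop} (h0 : P 0)
    (hadd : ∀ x y, P x → P y → P (x + y)) (hmk : ∀ a x, P (M.tmul a x)) (t : M.tens) : P t :=
  TensorProduct.induction_on (motive := P) t h0 hmk hadd

theorem tens_induction' {M : GMod.{u} R} {P : M.tens → Prop} (h0 : P 0)
    (hadd : ∀ x y, P x → P y → P (x + y))
    (hmk : ∀ i, ∀ a ∈ R.gr i, ∀ x, P (M.tmul a x)) (t : M.tens) : P t := by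
  refine tens_induction h0 hadd (fun a x => ?_) t
  refine graded_induction R.internal (P := fun a => P (M.tmul a x)) ?_ (fun a b ha hb => ?_)
    (fun i a ha => hmk i a ha x) a
  · have e : M.tmul 0 x = 0 := TensorProduct.zero_tmul _ x
    rw [e]; exact h0
  · have e : M.tmul (a + b) x = M.tmul a x + M.tmul b x := TensorProduct.add_tmul a b x
    rw [e]; exact hadd _ _ ha hb

theorem tmul_mem {M : GMod.{u} R} {i j : ℤ} {a : R} {x : M} (ha : a ∈ R.gr i)
    (hx : x ∈ M.gr j) : M.tmul a x ∈ M.tens.gr (i + j) :=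
  Submodule.subset_span (R := ℚ) (M := R ⊗[ℚ] M) ⟨i, j, a, x, rfl, ha, hx, rfl⟩

theorem tens_gr_le {M : GMod.{u} R} {n : ℤ} {S : Submodule ℚ M.tens}
    (h : ∀ i j, i + j = n → ∀ a ∈ R.gr i, ∀ x ∈ M.gr j, M.tmul a x ∈ S) : M.tens.gr n ≤ S := by
  intro t ht
  refine Submodule.span_induction (R := ℚ) (M := M.tens) (p := fun t _ => t ∈ S) ?_ (zero_mem S)
    (fun x y _ _ => add_mem) (fun c x _ => S.smul_mem c) (show t ∈ Submodule.span ℚ _ from ht)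
  rintro _ ⟨i, j, a, x, hij, ha, hx, rfl⟩
  exact h i j hij a ha x hx

/-- A degree preserving map. -/
def DegPres {M M' : GMod.{u} R} (f : M →ₗ[ℚ] M') : Prop := ∀ i, ∀ x ∈ M.gr i, f x ∈ M'.gr i

theorem DegPres.proj {M M' : GMod.{u} R} {f : M →ₗ[ℚ] M'} (hf : DegPres f) (n : ℤ) (x : M) :
    HyperExt.proj M'.internal n (f x) = f (HyperExt.proj M.internal n x) := by
  have := proj_map f 0 (fun i x hx => by simpa using hf i x hx) n x
  simpa using this

theorem act_degPres (M : GMod.{u} R) : DegPres (M.act.restrictScalars ℚ) := fun n =>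
  tens_gr_le (S := (M.gr n).comap (M.act.restrictScalars ℚ)) (by
    rintro i j rfl a ha x hx
    exact M.smul_mem ha hx)

theorem tensMap_degPres {M M' : GMod.{u} R} {f : M →ₗ[ℚ] M'} (hf : DegPres f) :
    DegPres ((tensMap f).restrictScalars ℚ) := fun n =>
  tens_gr_le (S := (M'.tens.gr n).comap ((tensMap f).restrictScalars ℚ)) (by
    rintro i j rfl a ha x hx
    exact tmul_mem ha (hf j x hx))

theorem unitMap_degPres (M : GMod.{u} R) : DegPres M.unitMap := by
  intro n x hx
  have := tmul_mem (M := M) R.one_mem hx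
  rwa [zero_add] at this

/-! ### The simplicial bar construction and its normalisation -/

/-- The graded `R`-module `R ⊗ ⋯ ⊗ R ⊗ N` with `k` factors `R`. The simplicial bar construction
`B_k(R; R; N) = R ⊗ R^{⊗ k} ⊗ N` is `barT N (k + 1)`. -/
def barT (N : GMod.{u} R) : ℕ → GMod.{u} R
  | 0 => N
  | k + 1 => (barT N k).tens

section Bar

variable (N : GMod.{u} R)

/-- The element `a ⊗ x` of `R ⊗ R^{⊗ k} ⊗ N`. -/
def btmul {k : ℕ} (a : R) (x : barT N k) : barT N (k + 1) := (barT N k).tmul a x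

/-- The action map `a ⊗ x ↦ a x`. -/
noncomputable def bact (k : ℕ) : barT N (k + 1) →ₗ[R] barT N k := (barT N k).act

/-- The map `x ↦ 1 ⊗ x`. -/
def bunit (k : ℕ) : barT N k →ₗ[ℚ] barT N (k + 1) := (barT N k).unitMap

/-- The map `id ⊗ f`. -/
noncomputable def bmap {k l : ℕ} (f : barT N k →ₗ[ℚ] barT N l) :
    barT N (k + 1) →ₗ[R] barT N (l + 1) := tensMap f

theorem bar_induction {k : ℕ} {P : barT N (k + 1) → Prop} (h0 : P 0)
    (hadd : ∀ x y, P x → P y → P (x + y)) (hmk : ∀ a x, P (btmul N a x))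
    (t : barT N (k + 1)) : P t :=
  tens_induction (M := barT N k) (P := P) h0 hadd hmk t

theorem bar_induction' {k : ℕ} {P : barT N (k + 1) → Prop} (h0 : P 0)
    (hadd : ∀ x y, P x → P y → P (x + y)) (hmk : ∀ i, ∀ a ∈ R.gr i, ∀ x, P (btmul N a x))
    (t : barT N (k + 1)) : P t :=
  tens_induction' (M := barT N k) (P := P) h0 hadd hmk t

theorem btmul_mem {k : ℕ} {i j : ℤ} {a : R} {x : barT N k} (ha : a ∈ R.gr i)
    (hx : x ∈ (barT N k).gr j) : btmul N a x ∈ (barT N (k + 1)).gr (i + j) :=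
  tmul_mem (M := barT N k) ha hx

theorem bar_gr_le {k : ℕ} {n : ℤ} {S : Submodule ℚ (barT N (k + 1))}
    (h : ∀ i j, i + j = n → ∀ a ∈ R.gr i, ∀ x ∈ (barT N k).gr j, btmul N a x ∈ S) :
    (barT N (k + 1)).gr n ≤ S :=
  tens_gr_le (M := barT N k) (S := S) h

theorem smul_btmul {k : ℕ} (a b : R) (x : barT N k) : a • btmul N b x = btmul N (a * b) x := rfl

theorem bact_btmul {k : ℕ} (a : R) (x : barT N k) : bact N k (btmul N a x) = a • x := rfl

theorem bmap_btmul {k l : ℕ} (f : barT N k →ₗ[ℚ] barT N l) (a : R) (x : barT N k) :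
    bmap N f (btmul N a x) = btmul N a (f x) := rfl

theorem bunit_apply {k : ℕ} (x : barT N k) : bunit N k x = btmul N 1 x := rfl

theorem btmul_add {k : ℕ} (a : R) (x y : barT N k) :
    btmul N a (x + y) = btmul N a x + btmul N a y := TensorProduct.tmul_add a x y

theorem btmul_sub {k : ℕ} (a : R) (x y : barT N k) :
    btmul N a (x - y) = btmul N a x - btmul N a y := TensorProduct.tmul_sub a x y

theorem btmul_zero {k : ℕ} (a : R) : btmul N a (0 : barT N k) = 0 :=
  TensorProduct.tmul_zero _ a

theorem zero_btmul {k : ℕ} (x : barT N k) : btmul N 0 x = 0 := TensorProduct.zero_tmul _ x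

theorem add_btmul {k : ℕ} (a b : R) (x : barT N k) :
    btmul N (a + b) x = btmul N a x + btmul N b x := TensorProduct.add_tmul a b x

theorem btmul_smul {k : ℕ} (c : ℚ) (a : R) (x : barT N k) :
    btmul N a (c • x) = c • btmul N a x := TensorProduct.tmul_smul c a x

theorem smul_btmul' {k : ℕ} (c : ℚ) (a : R) (x : barT N k) :
    btmul N (c • a) x = c • btmul N a x := (TensorProduct.smul_tmul' c a x).symm

theorem btmul_sum {k : ℕ} {ι : Type*} (s : Finset ι) (a : R) (x : ι → barT N k) :
    btmul N a (∑ i ∈ s, x i) = ∑ i ∈ s, btmul N a (x i) := by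
  classical
  induction s using Finset.induction_on with
  | empty => simp [btmul_zero]
  | insert i s hi ih => rw [Finset.sum_insert hi, Finset.sum_insert hi, btmul_add, ih]

theorem btmul_neg {k : ℕ} (a : R) (x : barT N k) :
    btmul N a (-x) = -btmul N a x := TensorProduct.tmul_neg a x

theorem bact_degPres (k : ℕ) : DegPres ((bact N k).restrictScalars ℚ) := act_degPres _

theorem bunit_degPres (k : ℕ) : DegPres (bunit N k) := unitMap_degPres _

theorem bmap_degPres {k l : ℕ} {f : barT N k →ₗ[ℚ] barT N l} (hf : DegPres f) :
    DegPres ((bmap N f).restrictScalars ℚ) := tensMap_degPres hf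

/-- For `i ≤ k`, the `i`-th face map `B_k → B_{k-1}`, which multiplies the `i`-th factor with the
next one (with `B_{-1} = N`). -/
noncomputable def face : (k i : ℕ) → (barT N (k + 1) →ₗ[R] barT N k)
  | k, 0 => bact N k
  | 0, _ + 1 => 0
  | k + 1, i + 1 => bmap N ((face k i).restrictScalars ℚ)

/-- For `i ≤ k`, the map `R^{⊗ k} ⊗ N → R^{⊗ (k + 1)} ⊗ N` that inserts `1` in front of the
`i`-th factor. -/
noncomputable def ins : (k i : ℕ) → (barT N k →ₗ[ℚ] barT N (k + 1))
  | k, 0 => bunit N k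
  | 0, _ + 1 => 0
  | k + 1, i + 1 => (bmap N (ins k i)).restrictScalars ℚ

/-- For `i ≤ k`, the `i`-th degeneracy map `B_k → B_{k+1}`, which inserts `1` after the `i`-th
factor. -/
noncomputable def degen (k i : ℕ) : barT N (k + 1) →ₗ[R] barT N (k + 2) := bmap N (ins N k i)

/-- The submodule of `B_k` generated by the degenerate elements. -/
noncomputable def degenerate : (k : ℕ) → Submodule R (barT N (k + 1))
  | 0 => ⊥
  | k + 1 => ⨆ i : Fin (k + 1), LinearMap.range (degen N k i)

/-- The alternating sum of the face maps `B_k → B_{k-1}`. -/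
noncomputable def bd (k : ℕ) : barT N (k + 1) →ₗ[R] barT N k :=
  ∑ i ∈ Finset.range (k + 1), (-1 : ℤ) ^ i • face N k i

theorem ins_zero (k : ℕ) : ins N k 0 = bunit N k := by cases k <;> rfl

theorem face_zero (k : ℕ) : face N k 0 = bact N k := by cases k <;> rfl

theorem bd_zero : bd N 0 = bact N 0 := by
  simp only [bd, zero_add, Finset.range_one, Finset.sum_singleton, pow_zero, one_smul, face_zero]

theorem bd_succ (k : ℕ) (a : R) (x : barT N (k + 1)) :
    bd N (k + 1) (btmul N a x) = a • x - btmul N a (bd N k x) := by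
  rw [bd, Finset.sum_range_succ']
  have h1 : ∀ i, face N (k + 1) (i + 1) (btmul N a x) = btmul N a (face N k i x) := fun i => rfl
  have h2 : face N (k + 1) 0 (btmul N a x) = a • x := rfl
  have h4 : ∀ (i : ℕ) (y : barT N k), btmul N a ((-1 : ℤ) ^ i • y)
      = (-1 : ℤ) ^ i • btmul N a y := by
    intro i y
    rcases neg_one_pow_eq_or ℤ i with h | h <;> simp [h, btmul_neg]
  have h3 : btmul N a (bd N k x)
      = ∑ i ∈ Finset.range (k + 1), (-1 : ℤ) ^ i • btmul N a (face N k i x) := by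
    simp only [bd, LinearMap.sum_apply, LinearMap.smul_apply, btmul_sum, h4]
  have h5 : ∀ i : ℕ, ((-1 : ℤ) ^ (i + 1) • face N (k + 1) (i + 1)) (btmul N a x)
      = -((-1 : ℤ) ^ i • btmul N a (face N k i x)) := by
    intro i
    rw [LinearMap.smul_apply, h1, pow_succ, mul_neg, mul_one, neg_smul]
  rw [LinearMap.add_apply, LinearMap.sum_apply, h3, Finset.sum_congr rfl fun i _ => h5 i,
    Finset.sum_neg_distrib, pow_zero, one_smul, h2]
  abel

theorem ins_degPres : ∀ k i, DegPres (ins N k i)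
  | 0, 0 => bunit_degPres N 0
  | k + 1, 0 => bunit_degPres N (k + 1)
  | 0, _ + 1 => fun _ _ _ => zero_mem _
  | k + 1, i + 1 => bmap_degPres N (ins_degPres k i)

theorem bd_degPres : ∀ k, DegPres ((bd N k).restrictScalars ℚ)
  | 0 => by rw [bd_zero]; exact bact_degPres N 0
  | k + 1 => fun n =>
    bar_gr_le N (S := ((barT N (k + 1)).gr n).comap ((bd N (k + 1)).restrictScalars ℚ)) (by
      rintro i j rfl a ha x hx
      have : bd N (k + 1) (btmul N a x) ∈ (barT N (k + 1)).gr (i + j) := by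
        rw [bd_succ]
        exact sub_mem ((barT N (k + 1)).smul_mem ha hx) (btmul_mem N ha (bd_degPres k j x hx))
      exact this)

theorem mem_degenerate_zero {x : barT N 1} (hx : x ∈ degenerate N 0) : x = 0 := hx

theorem mem_degenerate_succ {k : ℕ} {x : barT N (k + 2)} :
    x ∈ degenerate N (k + 1) ↔ x ∈ ⨆ i : Fin (k + 1), LinearMap.range (degen N k i) := Iff.rfl

theorem degenerate_homogeneous : ∀ k, ∀ x ∈ degenerate N k, ∀ n,
    proj (barT N (k + 1)).internal n x ∈ degenerate N k
  | 0 => by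
    intro x hx n
    rw [mem_degenerate_zero N hx, map_zero]
    exact zero_mem _
  | k + 1 => by
    intro x hx n
    refine Submodule.iSup_induction _
      (motive := fun x => proj (barT N (k + 2)).internal n x ∈ degenerate N (k + 1)) hx ?_ ?_ ?_
    · rintro i _ ⟨y, rfl⟩
      rw [mem_degenerate_succ]
      refine Submodule.mem_iSup_of_mem i ⟨proj (barT N (k + 1)).internal n y, ?_⟩
      exact ((bmap_degPres N (ins_degPres N k i)).proj n y).symm
    · rw [map_zero]; exact zero_mem _
    · intro x y hx hy; rw [map_add]; exact add_mem hx hy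

/-- The normalised bar construction `R ⊗ (R/ℚ)^{⊗ k} ⊗ N`, the quotient of `B_k(R; R; N)` by the
degenerate elements. -/
noncomputable def normBar (k : ℕ) : GMod.{u} R :=
  (barT N (k + 1)).quot (degenerate N k) (degenerate_homogeneous N k)

/-- The projection from `B_k` to its normalisation. -/
noncomputable def normMk (k : ℕ) : barT N (k + 1) →ₗ[R] normBar N k :=
  (degenerate N k).mkQ

theorem normMk_surjective (k : ℕ) : Function.Surjective (normMk N k) :=
  (degenerate N k).mkQ_surjective

theorem normMk_eq_zero (k : ℕ) {x : barT N (k + 1)} : normMk N k x = 0 ↔ x ∈ degenerate N k :=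
  Submodule.Quotient.mk_eq_zero _

theorem normMk_degPres (k : ℕ) : DegPres ((normMk N k).restrictScalars ℚ) :=
  fun _ x hx => ⟨x, hx, rfl⟩

theorem exists_of_mem_normBar_gr {k : ℕ} {n : ℤ} {y : normBar N k} (hy : y ∈ (normBar N k).gr n) :
    ∃ x ∈ (barT N (k + 1)).gr n, normMk N k x = y := hy

/-- The span of all elements with some factor `1`, including the zeroth one. -/
noncomputable def insSpan : (k : ℕ) → Submodule ℚ (barT N k)
  | 0 => ⊥
  | k + 1 => ⨆ i : Fin (k + 1), LinearMap.range (ins N k i)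

theorem ins_mem_insSpan {k i : ℕ} (hi : i < k + 1) (x : barT N k) :
    ins N k i x ∈ insSpan N (k + 1) :=
  Submodule.mem_iSup_of_mem (p := fun i : Fin (k + 1) => LinearMap.range (ins N k i)) ⟨i, hi⟩
    ⟨x, rfl⟩

theorem mem_insSpan_zero {x : barT N 0} (hx : x ∈ insSpan N 0) : x = 0 := hx

theorem insSpan_succ_induction {k : ℕ} {P : barT N (k + 1) → Prop} (h0 : P 0)
    (hadd : ∀ x y, P x → P y → P (x + y)) (h : ∀ i < k + 1, ∀ x, P (ins N k i x)) :
    ∀ x ∈ insSpan N (k + 1), P x := by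
  intro y hy
  refine Submodule.iSup_induction (fun i : Fin (k + 1) => LinearMap.range (ins N k i))
    (motive := P) hy ?_ h0 hadd
  rintro ⟨i, hi⟩ _ ⟨x, rfl⟩
  exact h i hi x

theorem insSpan_succ_induction' {k : ℕ} {P : barT N (k + 1) → Prop} (h0 : P 0)
    (hadd : ∀ x y, P x → P y → P (x + y)) (h1 : ∀ x, P (btmul N 1 x))
    (h2 : ∀ a, ∀ w ∈ insSpan N k, P (btmul N a w)) :
    ∀ x ∈ insSpan N (k + 1), P x := by
  refine insSpan_succ_induction N h0 hadd fun i hi x => ?_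
  match k, i with
  | k, 0 => rw [ins_zero]; exact h1 x
  | 0, i + 1 => omega
  | k + 1, i + 1 =>
    refine bar_induction N (P := fun t => P (ins N (k + 1) (i + 1) t)) ?_ ?_ ?_ x
    · rw [map_zero]; exact h0
    · intro x y hx hy; rw [map_add]; exact hadd _ _ hx hy
    · intro a x
      exact h2 a _ (ins_mem_insSpan N (by omega) x)

theorem btmul_mem_degenerate : ∀ k (a : R), ∀ y ∈ insSpan N k, btmul N a y ∈ degenerate N k
  | 0 => by
    intro a y hy
    rw [mem_insSpan_zero N hy, btmul_zero]
    exact zero_mem _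
  | k + 1 => by
    intro a y hy
    refine insSpan_succ_induction N (P := fun y => btmul N a y ∈ degenerate N (k + 1))
      ?_ ?_ ?_ y hy
    · rw [btmul_zero]; exact zero_mem _
    · intro x y hx hy; rw [btmul_add]; exact add_mem hx hy
    · intro i hi x
      rw [mem_degenerate_succ]
      exact Submodule.mem_iSup_of_mem (p := fun i : Fin (k + 1) => LinearMap.range (degen N k i))
        ⟨i, hi⟩ ⟨btmul N a x, rfl⟩

theorem degenerate_induction {k : ℕ} {P : barT N (k + 1) → Prop} (h0 : P 0)
    (hadd : ∀ x y, P x → P y → P (x + y))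
    (h : ∀ a, ∀ y ∈ insSpan N k, P (btmul N a y)) : ∀ x ∈ degenerate N k, P x := by
  intro x hx
  match k with
  | 0 => rw [mem_degenerate_zero N hx]; exact h0
  | k + 1 =>
    refine Submodule.iSup_induction _ (motive := P) hx ?_ h0 hadd
    rintro ⟨i, hi⟩ _ ⟨t, rfl⟩
    refine bar_induction N (P := fun t => P (degen N k i t)) ?_ ?_ ?_ t
    · rw [map_zero]; exact h0
    · intro x y hx hy; rw [map_add]; exact hadd _ _ hx hy
    · intro a x
      exact h a _ (ins_mem_insSpan N hi x)

theorem degenerate_le_insSpan (k : ℕ) : ∀ x ∈ degenerate N k, x ∈ insSpan N (k + 1) := by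
  refine degenerate_induction N (zero_mem _) (fun _ _ => add_mem) ?_
  intro a y hy
  match k with
  | 0 => rw [mem_insSpan_zero N hy, btmul_zero]; exact zero_mem _
  | k + 1 =>
    refine insSpan_succ_induction N (P := fun y => btmul N a y ∈ insSpan N (k + 2)) ?_ ?_ ?_ y hy
    · rw [btmul_zero]; exact zero_mem _
    · intro x y hx hy; rw [btmul_add]; exact add_mem hx hy
    · intro i hi x
      exact ins_mem_insSpan N (i := i + 1) (by omega) (btmul N a x)

theorem smul_one_btmul {k : ℕ} (a : R) (x : barT N k) : a • btmul N 1 x = btmul N a x := by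
  rw [smul_btmul, mul_one]

theorem bd_degenerate : ∀ k, ∀ x ∈ degenerate N (k + 1), bd N (k + 1) x ∈ degenerate N k := by
  intro k
  induction k with
  | zero =>
    refine degenerate_induction N (by simp) (fun x y hx hy => by
      rw [map_add]; exact add_mem hx hy) fun a y hy => ?_
    refine insSpan_succ_induction' N (P := fun y => bd N 1 (btmul N a y) ∈ degenerate N 0)
      ?_ ?_ ?_ ?_ y hy
    · rw [btmul_zero, map_zero]; exact zero_mem _
    · intro x y hx hy; rw [btmul_add, map_add]; exact add_mem hx hy
    · intro x
      rw [bd_succ, bd_zero, smul_one_btmul, bact_btmul, one_smul, sub_self]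
      exact zero_mem _
    · intro b w hw
      rw [mem_insSpan_zero N hw, btmul_zero, btmul_zero, map_zero]
      exact zero_mem _
  | succ k ih =>
    refine degenerate_induction N (by simp) (fun x y hx hy => by
      rw [map_add]; exact add_mem hx hy) fun a y hy => ?_
    refine insSpan_succ_induction' N
      (P := fun y => bd N (k + 2) (btmul N a y) ∈ degenerate N (k + 1)) ?_ ?_ ?_ ?_ y hy
    · rw [btmul_zero, map_zero]; exact zero_mem _
    · intro x y hx hy; rw [btmul_add, map_add]; exact add_mem hx hy
    · intro x
      rw [bd_succ, bd_succ, smul_one_btmul, one_smul, btmul_sub, sub_sub_cancel]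
      refine btmul_mem_degenerate N (k + 1) a _ ?_
      rw [← bunit_apply, ← ins_zero]
      exact ins_mem_insSpan N (by omega) _
    · intro b w hw
      have hbw := btmul_mem_degenerate N (k + 1) b w hw
      rw [bd_succ]
      refine sub_mem (Submodule.smul_mem _ a hbw) (btmul_mem_degenerate N (k + 1) a _ ?_)
      exact degenerate_le_insSpan N k _ (ih _ hbw)

theorem bd_bd : ∀ k (x : barT N (k + 2)), bd N k (bd N (k + 1) x) = 0 := by
  intro k
  induction k with
  | zero =>
    refine bar_induction N (by simp) (fun x y hx hy => by simp only [map_add, hx, hy, add_zero])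
      fun a x => ?_
    rw [bd_succ, map_sub, map_smul, bd_zero, bact_btmul, sub_self]
  | succ k ih =>
    refine bar_induction N (by simp) (fun x y hx hy => by simp only [map_add, hx, hy, add_zero])
      fun a x => ?_
    rw [bd_succ, map_sub, map_smul, bd_succ, ih, btmul_zero, sub_zero, sub_self]

/-- The boundary `∑ (-1)^i d_i` of the normalised bar construction. -/
noncomputable def normBd (k : ℕ) : normBar N (k + 1) →ₗ[R] normBar N k :=
  Submodule.mapQ (degenerate N (k + 1)) (degenerate N k) (bd N (k + 1)) (bd_degenerate N k)

theorem normBd_mk (k : ℕ) (x : barT N (k + 2)) :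
    normBd N k (normMk N (k + 1) x) = normMk N k (bd N (k + 1) x) := rfl

theorem normBd_normBd (k : ℕ) (x : normBar N (k + 2)) :
    normBd N k (normBd N (k + 1) x) = 0 := by
  obtain ⟨x, rfl⟩ := normMk_surjective N _ x
  rw [normBd_mk, normBd_mk, bd_bd, map_zero]

theorem normBd_degPres (k : ℕ) : DegPres ((normBd N k).restrictScalars ℚ) := by
  rintro n _ ⟨x, hx, rfl⟩
  exact ⟨_, bd_degPres N (k + 1) n x hx, rfl⟩

/-- The augmentation `R ⊗ N → N`, `a ⊗ x ↦ a x`, of the normalised bar construction. -/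
noncomputable def normAug : normBar N 0 →ₗ[R] N :=
  Submodule.liftQ (degenerate N 0) (bact N 0) (fun x hx => by
    rw [mem_degenerate_zero N hx]; exact zero_mem _)

theorem normAug_mk (x : barT N 1) : normAug N (normMk N 0 x) = bact N 0 x := rfl

theorem normAug_normBd (x : normBar N 1) : normAug N (normBd N 0 x) = 0 := by
  obtain ⟨x, rfl⟩ := normMk_surjective N _ x
  rw [normBd_mk, normAug_mk, ← bd_zero]
  exact bd_bd N 0 x

theorem normAug_degPres : DegPres ((normAug N).restrictScalars ℚ) := by
  rintro n _ ⟨x, hx, rfl⟩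
  exact act_degPres N n x hx

end Bar

end GMod

/-! ### Differential graded algebras and modules -/

section Graded

variable {V W : Type*} [AddCommGroup V] [Module ℚ V] [AddCommGroup W] [Module ℚ W]
  {gr : ℤ → Submodule ℚ V}

theorem isInternal_map (h : DirectSum.IsInternal gr) (f : V →ₗ[ℚ] W) (hf : Function.Surjective f)
    (hk : ∀ x, f x = 0 → ∀ n, f (proj h n x) = 0) :
    DirectSum.IsInternal fun n => (gr n).map f := by
  have hp : ∀ n v, ((LinearMap.ker f).liftQ (f.comp (proj h n)) (fun x hx => hk x hx n)).comp
      (f.quotKerEquivOfSurjective hf).symm.toLinearMap (f v) = f (proj h n v) := by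
    intro n v
    have : (f.quotKerEquivOfSurjective hf).symm (f v) = Submodule.Quotient.mk v := by
      rw [LinearEquiv.symm_apply_eq]; rfl
    rw [LinearMap.comp_apply, LinearEquiv.coe_coe, this]
    rfl
  refine isInternal_of_proj (fun n => ((LinearMap.ker f).liftQ (f.comp (proj h n))
    (fun x hx => hk x hx n)).comp (f.quotKerEquivOfSurjective hf).symm.toLinearMap) ?_ ?_ ?_
  · rintro n _ ⟨x, hx, rfl⟩
    rw [hp, proj_same h hx]
  · rintro m n _ ⟨x, hx, rfl⟩ hmn
    rw [hp, proj_ne h hx hmn, map_zero]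
  · intro y
    obtain ⟨x, rfl⟩ := hf y
    induction x using graded_induction h with
    | h0 => rw [map_zero]; exact zero_mem _
    | hadd x y hx hy => rw [map_add]; exact add_mem hx hy
    | hgr i x hx => exact Submodule.mem_iSup_of_mem i ⟨x, hx, rfl⟩

theorem exists_proj_lift (h : DirectSum.IsInternal gr) (f : W →ₗ[ℚ] V)
    (hf : Function.Injective f) (hs : ∀ x n, ∃ y, f y = proj h n (f x)) (n : ℤ) :
    ∃ p : W →ₗ[ℚ] W, ∀ x, f (p x) = proj h n (f x) := by
  choose q hq using hs
  exact ⟨{ toFun := fun x => q x n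
           map_add' := fun x y => hf (by simp [hq])
           map_smul' := fun c x => hf (by simp [hq]) }, fun x => hq x n⟩

theorem isInternal_comap (h : DirectSum.IsInternal gr) (f : W →ₗ[ℚ] V)
    (hf : Function.Injective f) (hs : ∀ x n, ∃ y, f y = proj h n (f x)) :
    DirectSum.IsInternal fun n => (gr n).comap f := by
  choose p hp using exists_proj_lift h f hf hs
  refine isInternal_of_proj p ?_ ?_ ?_
  · intro n x hx
    exact hf (by rw [hp, proj_same h hx])
  · intro m n x hx hmn
    exact hf (by rw [hp, proj_ne h hx hmn, map_zero])
  · intro x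
    have key : ∀ v : V, ∃ s : Finset ℤ, v = ∑ n ∈ s, proj h n v ∧ ∀ n ∉ s, proj h n v = 0 := by
      classical
      intro v
      induction v using graded_induction h with
      | h0 => exact ⟨∅, by simp⟩
      | hadd v w hv hw =>
        obtain ⟨s, hs, hs'⟩ := hv
        obtain ⟨t, ht, ht'⟩ := hw
        refine ⟨s ∪ t, ?_, ?_⟩
        · simp only [map_add, Finset.sum_add_distrib]
          rw [← Finset.sum_subset (Finset.subset_union_left (s₂ := t)) (fun n _ hn => hs' n hn),
            ← Finset.sum_subset (Finset.subset_union_right (s₁ := s)) (fun n _ hn => ht' n hn),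
            ← hs, ← ht]
        · intro n hn
          rw [Finset.mem_union, not_or] at hn
          rw [map_add, hs' n hn.1, ht' n hn.2, add_zero]
      | hgr i v hv =>
        refine ⟨{i}, by rw [Finset.sum_singleton, proj_same h hv], fun n hn => ?_⟩
        exact proj_ne h hv (fun e => hn (by rw [e]; exact Finset.mem_singleton_self _))
    obtain ⟨s, hs, -⟩ := key (f x)
    have : x = ∑ n ∈ s, p n x := hf (by rw [map_sum]; simp only [hp]; exact hs)
    rw [this]
    refine sum_mem fun n _ => Submodule.mem_iSup_of_mem n ?_
    change f (p n x) ∈ gr n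
    rw [hp]
    exact proj_mem h n _

theorem proj_shift (h : DirectSum.IsInternal gr) {d : V →ₗ[ℚ] V}
    (hd : ∀ i, ∀ x ∈ gr i, d x ∈ gr (i + 1)) (n : ℤ) (x : V) :
    proj h (n + 1) (d x) = d (proj h n x) := by
  induction x using graded_induction h with
  | h0 => simp
  | hadd x y hx hy => simp [hx, hy]
  | hgr i x hx =>
    by_cases hin : i = n
    · subst hin; rw [proj_same _ hx, proj_same _ (hd _ _ hx)]
    · rw [proj_ne _ hx hin, proj_ne _ (hd _ _ hx) (by omega), map_zero]

theorem parity_parity (h : DirectSum.IsInternal gr) (x : V) : parity h (parity h x) = x := by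
  induction x using graded_induction h with
  | h0 => simp
  | hadd x y hx hy => simp [hx, hy]
  | hgr i x hx => rw [parity_of_mem h hx, map_smul, parity_of_mem h hx, smul_smul, sgn_sq, one_smul]

theorem parity_mem (h : DirectSum.IsInternal gr) {n : ℤ} {x : V} (hx : x ∈ gr n) :
    parity h x ∈ gr n := by
  rw [parity_of_mem h hx]; exact Submodule.smul_mem _ _ hx

theorem parity_shift (h : DirectSum.IsInternal gr) {d : V →ₗ[ℚ] V}
    (hd : ∀ i, ∀ x ∈ gr i, d x ∈ gr (i + 1)) (x : V) : d (parity h x) = -parity h (d x) := by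
  induction x using graded_induction h with
  | h0 => simp
  | hadd x y hx hy => simp only [map_add, hx, hy, neg_add]
  | hgr i x hx =>
    rw [parity_of_mem h hx, parity_of_mem h (hd i x hx), map_smul, sgn_add, sgn_one]
    simp

end Graded

/-- A commutative differential graded algebra over `ℚ`, with cohomological grading, concentrated in
non-negative degrees. -/
structure CDGA extends GAlg.{u} where
  d : carrier →ₗ[ℚ] carrier
  d_mem : ∀ i, ∀ a ∈ gr i, d a ∈ gr (i + 1)
  d_d : ∀ a, d (d a) = 0
  leibniz : ∀ i, ∀ a ∈ gr i, ∀ b, d (a * b) = d a * b + sgn i • (a * d b)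
  nonneg : ∀ n < 0, gr n = ⊥

instance : CoeSort CDGA.{u} (Type u) := ⟨fun A => A.carrier⟩

/-- A cdga is simply connected if `A⁰ = ℚ` and `A¹ = 0`. -/
def CDGA.IsSimplyConnected (A : CDGA.{u}) : Prop :=
  Nontrivial A ∧ A.gr 0 = Submodule.span ℚ {1} ∧ A.gr 1 = ⊥

/-- A differential graded module over a cdga; the grading is over `ℤ`. -/
structure DGMod (A : CDGA.{u}) extends GMod.{u} A.toGAlg where
  d : carrier →ₗ[ℚ] carrier
  d_mem : ∀ i, ∀ x ∈ gr i, d x ∈ gr (i + 1)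
  d_d : ∀ x, d (d x) = 0
  leibniz : ∀ i, ∀ a ∈ A.gr i, ∀ x, d (a • x) = A.d a • x + sgn i • a • d x

instance (A : CDGA.{u}) : CoeSort (DGMod.{u} A) (Type u) := ⟨fun M => M.carrier⟩

namespace CDGA

variable (A : CDGA.{u})

/-- The parity involution `a ↦ (-1)^{|a|} a`. -/
noncomputable abbrev σ : A →ₗ[ℚ] A := parity A.internal

theorem d_mul (a b : A) : A.d (a * b) = A.d a * b + A.σ a * A.d b := by
  induction a using graded_induction A.internal with
  | h0 => simp
  | hadd x y hx hy => simp only [add_mul, map_add, hx, hy]; abel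
  | hgr i a ha => rw [A.leibniz i a ha, parity_of_mem _ ha, smul_mul_assoc]

theorem d_one : A.d 1 = 0 := by
  have := A.d_mul 1 1
  rw [parity_of_mem _ A.one_mem, sgn_zero, one_smul, mul_one, mul_one, one_mul] at this
  simpa using this

theorem σ_one : A.σ 1 = 1 := by rw [parity_of_mem _ A.one_mem, sgn_zero, one_smul]

theorem σ_mul {i : ℤ} {a : A} (ha : a ∈ A.gr i) (b : A) :
    A.σ (a * b) = sgn i • (a * A.σ b) := by
  induction b using graded_induction A.internal with
  | h0 => simp
  | hadd x y hx hy => simp only [mul_add, map_add, hx, hy, smul_add]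
  | hgr j b hb =>
    rw [parity_of_mem _ (A.mul_mem ha hb), parity_of_mem _ hb, sgn_add, mul_smul,
      mul_smul_comm]

/-- The subalgebra of cocycles. -/
def cocycles : Subalgebra ℚ A where
  carrier := {a | A.d a = 0}
  mul_mem' := by
    intro a b (ha : A.d a = 0) (hb : A.d b = 0)
    change A.d (a * b) = 0
    rw [d_mul, ha, hb, zero_mul, mul_zero, add_zero]
  add_mem' := by
    intro a b (ha : A.d a = 0) (hb : A.d b = 0)
    change A.d (a + b) = 0
    rw [map_add, ha, hb, add_zero]
  algebraMap_mem' := by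
    intro c
    change A.d (algebraMap ℚ A c) = 0
    rw [Algebra.algebraMap_eq_smul_one, map_smul, d_one, smul_zero]

theorem d_coe (z : A.cocycles) : A.d z = 0 := z.2

theorem d_σ_mul (z : A.cocycles) (y : A) : A.d (A.σ z * y) = z * A.d y := by
  rw [d_mul, parity_parity, parity_shift _ A.d_mem, A.d_coe z]
  simp

theorem d_mul_cocycle (z : A.cocycles) (y : A) : A.d (y * z) = A.d y * z := by
  rw [d_mul, A.d_coe z, mul_zero, add_zero]

/-- The two-sided ideal of coboundaries in the algebra of cocycles. -/
def coboundaries : Ideal A.cocycles where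
  carrier := {z | ∃ y, A.d y = z}
  add_mem' := by
    rintro _ _ ⟨y, hy⟩ ⟨y', hy'⟩
    exact ⟨y + y', by rw [map_add, hy, hy']; rfl⟩
  zero_mem' := ⟨0, by simp⟩
  smul_mem' := by
    rintro z w ⟨y, hy⟩
    exact ⟨A.σ z * y, by rw [d_σ_mul, hy]; rfl⟩

instance : A.coboundaries.IsTwoSided where
  mul_mem_of_left := by
    rintro w z ⟨y, hy⟩
    exact ⟨y * z, by rw [d_mul_cocycle, hy]; rfl⟩

/-- The projection from cocycles to cohomology. -/
def cls : A.cocycles →ₐ[ℚ] A.cocycles ⧸ A.coboundaries := Ideal.Quotient.mkₐ ℚ A.coboundaries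

theorem cls_surjective : Function.Surjective A.cls := Ideal.Quotient.mkₐ_surjective ℚ _

theorem cls_eq_zero (z : A.cocycles) : A.cls z = 0 ↔ ∃ y, A.d y = z :=
  Ideal.Quotient.eq_zero_iff_mem

theorem exists_proj_cocycle (x : A.cocycles) (n : ℤ) :
    ∃ y : A.cocycles, A.cocycles.val.toLinearMap y
      = proj A.internal n (A.cocycles.val.toLinearMap x) :=
  ⟨⟨proj A.internal n x, by
    change A.d _ = 0
    rw [← proj_shift _ A.d_mem, A.d_coe x, map_zero]⟩, rfl⟩

theorem cocycles_internal : DirectSum.IsInternal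
    fun n => (A.gr n).comap A.cocycles.val.toLinearMap :=
  isInternal_comap A.internal _ Subtype.val_injective A.exists_proj_cocycle

theorem coe_proj_cocycles (x : A.cocycles) (n : ℤ) :
    (proj A.cocycles_internal n x : A) = proj A.internal n x := by
  induction x using graded_induction A.cocycles_internal with
  | h0 => simp
  | hadd x y hx hy => simp [hx, hy]
  | hgr i x hx =>
    by_cases hin : i = n
    · subst hin
      rw [proj_same A.cocycles_internal hx]
      exact (proj_same A.internal hx).symm
    · rw [proj_ne A.cocycles_internal hx hin]
      exact (proj_ne A.internal hx hin).symm

/-- The cohomology algebra `H(A)`. -/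
def H : GAlg.{u} where
  carrier := A.cocycles ⧸ A.coboundaries
  gr n := ((A.gr n).comap A.cocycles.val.toLinearMap).map A.cls.toLinearMap
  internal := by
    refine isInternal_map A.cocycles_internal A.cls.toLinearMap A.cls_surjective ?_
    intro z hz n
    obtain ⟨y, hy⟩ := (A.cls_eq_zero z).1 hz
    refine (A.cls_eq_zero _).2 ⟨proj A.internal (n - 1) y, ?_⟩
    rw [← proj_shift _ A.d_mem, hy, coe_proj_cocycles, sub_add_cancel]
  one_mem := ⟨1, A.one_mem, rfl⟩
  mul_mem := by
    rintro i j _ _ ⟨a, ha, rfl⟩ ⟨b, hb, rfl⟩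
    exact ⟨a * b, A.mul_mem ha hb, rfl⟩
  mul_comm := by
    rintro i j _ _ ⟨a, ha, rfl⟩ ⟨b, hb, rfl⟩
    have : a * b = sgn (i * j) • (b * a) := Subtype.ext (A.mul_comm ha hb)
    change A.cls a * A.cls b = sgn (i * j) • (A.cls b * A.cls a)
    rw [← map_mul, this, map_smul, map_mul]

/-- The cohomology class of a cocycle. -/
def hmk (z : A.cocycles) : A.H := A.cls z

end CDGA

namespace DGMod

variable {A : CDGA.{u}} (M : DGMod.{u} A)

theorem d_smul (a : A) (x : M) : M.d (a • x) = A.d a • x + A.σ a • M.d x := by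
  induction a using graded_induction A.internal with
  | h0 => simp
  | hadd x y hx hy => simp only [add_smul, map_add, hx, hy]; abel
  | hgr i a ha => rw [M.leibniz i a ha, parity_of_mem _ ha, smul_assoc]

/-- The cohomology `ker d / im d`. -/
abbrev HCarrier : Type u := LinearMap.ker M.d ⧸ (LinearMap.range M.d).comap (LinearMap.ker M.d).subtype

/-- The action of a cocycle `z` of `A` on cohomology. -/
def cocycleAct : A.cocycles →+* Module.End ℚ M.HCarrier where
  toFun z := Submodule.mapQ _ _
    ((Algebra.lsmul ℚ ℚ M (z : A)).restrict (p := LinearMap.ker M.d) (q := LinearMap.ker M.d)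
      (fun x (hx : M.d x = 0) => by
        change M.d ((z : A) • x) = 0
        rw [d_smul, hx, A.d_coe z, zero_smul, smul_zero, add_zero]))
    (by
      rintro x ⟨y, hy⟩
      refine ⟨A.σ z • y, ?_⟩
      have hy : M.d y = x := hy
      have : M.d (A.σ z • y) = (z : A) • (x : M) := by
        rw [d_smul, parity_parity, parity_shift _ A.d_mem, A.d_coe z, hy]
        simp
      exact this)
  map_one' := by
    refine LinearMap.ext fun x => ?_
    obtain ⟨x, rfl⟩ := Submodule.Quotient.mk_surjective _ x
    exact congrArg Submodule.Quotient.mk (Subtype.ext (one_smul A (x : M)))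
  map_mul' z w := by
    refine LinearMap.ext fun x => ?_
    obtain ⟨x, rfl⟩ := Submodule.Quotient.mk_surjective _ x
    exact congrArg Submodule.Quotient.mk (Subtype.ext (mul_smul (z : A) (w : A) (x : M)))
  map_zero' := by
    refine LinearMap.ext fun x => ?_
    obtain ⟨x, rfl⟩ := Submodule.Quotient.mk_surjective _ x
    exact congrArg Submodule.Quotient.mk (Subtype.ext (zero_smul A (x : M)))
  map_add' z w := by
    refine LinearMap.ext fun x => ?_
    obtain ⟨x, rfl⟩ := Submodule.Quotient.mk_surjective _ x
    exact congrArg Submodule.Quotient.mk (Subtype.ext (add_smul (z : A) (w : A) (x : M)))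

/-- The action of `H(A)` on `H(M)`. -/
def hAct : (A.cocycles ⧸ A.coboundaries) →+* Module.End ℚ M.HCarrier :=
  Ideal.Quotient.lift A.coboundaries M.cocycleAct (by
    rintro z ⟨y, hy⟩
    refine LinearMap.ext fun x => ?_
    obtain ⟨x, rfl⟩ := Submodule.Quotient.mk_surjective _ x
    refine (Submodule.Quotient.mk_eq_zero _).2 ⟨y • (x : M), ?_⟩
    rw [d_smul, show M.d x = 0 from x.2, smul_zero, add_zero, hy]
    rfl)

/-- The projection from cocycles to cohomology. -/
def cls : LinearMap.ker M.d →ₗ[ℚ] M.HCarrier := Submodule.mkQ _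

theorem cls_surjective : Function.Surjective M.cls := Submodule.mkQ_surjective _

theorem cls_eq_zero (x : LinearMap.ker M.d) : M.cls x = 0 ↔ ∃ y, M.d y = x :=
  Submodule.Quotient.mk_eq_zero _

theorem d_coe (x : LinearMap.ker M.d) : M.d x = 0 := x.2

theorem exists_proj_cocycle (x : LinearMap.ker M.d) (n : ℤ) :
    ∃ y, (LinearMap.ker M.d).subtype y = proj M.internal n ((LinearMap.ker M.d).subtype x) :=
  ⟨⟨proj M.internal n x, by
    change M.d _ = 0
    rw [← proj_shift _ M.d_mem, M.d_coe x, map_zero]⟩, rfl⟩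

theorem cocycles_internal : DirectSum.IsInternal
    fun n => (M.gr n).comap (LinearMap.ker M.d).subtype :=
  isInternal_comap M.internal _ Subtype.val_injective M.exists_proj_cocycle

theorem coe_proj_cocycles (x : LinearMap.ker M.d) (n : ℤ) :
    (proj M.cocycles_internal n x : M) = proj M.internal n x := by
  induction x using graded_induction M.cocycles_internal with
  | h0 => simp
  | hadd x y hx hy => simp [hx, hy]
  | hgr i x hx =>
    by_cases hin : i = n
    · subst hin
      rw [proj_same M.cocycles_internal hx]
      exact (proj_same M.internal hx).symm
    · rw [proj_ne M.cocycles_internal hx hin]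
      exact (proj_ne M.internal hx hin).symm

/-- The cohomology `H(M)`, a graded module over `H(A)` with the action `[a] [x] = [a x]`. -/
def H : GMod.{u} A.H where
  carrier := M.HCarrier
  module := Module.compHom M.HCarrier M.hAct
  tower := by
    refine @IsScalarTower.mk ℚ A.H M.HCarrier _ (Module.compHom M.HCarrier M.hAct).toSMul _ ?_
    intro c r x
    obtain ⟨z, rfl⟩ := A.cls_surjective r
    obtain ⟨x, rfl⟩ := M.cls_surjective x
    exact congrArg M.cls (Subtype.ext (smul_assoc c (z : A) (x : M)))
  gr n := ((M.gr n).comap (LinearMap.ker M.d).subtype).map M.cls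
  internal := by
    refine isInternal_map M.cocycles_internal M.cls M.cls_surjective ?_
    intro z hz n
    obtain ⟨y, hy⟩ := (M.cls_eq_zero z).1 hz
    refine (M.cls_eq_zero _).2 ⟨proj M.internal (n - 1) y, ?_⟩
    rw [← proj_shift _ M.d_mem, hy, coe_proj_cocycles, sub_add_cancel]
  smul_mem := by
    rintro i j _ _ ⟨a, ha, rfl⟩ ⟨x, hx, rfl⟩
    refine ⟨⟨(a : A) • (x : M), ?_⟩, M.smul_mem ha hx, rfl⟩
    change M.d _ = 0
    rw [d_smul, A.d_coe, M.d_coe, zero_smul, smul_zero, add_zero]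

/-- The cohomology class of a cocycle. -/
def hmk (x : LinearMap.ker M.d) : M.H := M.cls x

end DGMod

/-! ### The bar construction of a differential graded module -/

namespace DGMod

open GMod

variable {A : CDGA.{u}} (N : DGMod.{u} A)

/-- The differential `a ⊗ x ↦ d a ⊗ x + (-1)^{|a|} a ⊗ δ x` on `A ⊗ M`. -/
noncomputable def tensDiff (M : GMod.{u} A.toGAlg) (δ : M →ₗ[ℚ] M) : M.tens →ₗ[ℚ] M.tens :=
  (TensorProduct.map A.d LinearMap.id + TensorProduct.map A.σ δ : A ⊗[ℚ] M →ₗ[ℚ] A ⊗[ℚ] M)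

/-- The differential of the tensor product `A ⊗ ⋯ ⊗ A ⊗ N`. -/
noncomputable def barDiff : (k : ℕ) → (barT N.toGMod k →ₗ[ℚ] barT N.toGMod k)
  | 0 => N.d
  | k + 1 => tensDiff (barT N.toGMod k) (barDiff k)

theorem barDiff_btmul {k : ℕ} (a : A) (x : barT N.toGMod k) :
    barDiff N (k + 1) (btmul N.toGMod a x)
      = btmul N.toGMod (A.d a) x + btmul N.toGMod (A.σ a) (barDiff N k x) := rfl

theorem barDiff_mem : ∀ k, ∀ i, ∀ x ∈ (barT N.toGMod k).gr i,
    barDiff N k x ∈ (barT N.toGMod k).gr (i + 1)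
  | 0 => N.d_mem
  | k + 1 => fun n =>
    bar_gr_le N.toGMod (S := ((barT N.toGMod (k + 1)).gr (n + 1)).comap (barDiff N (k + 1))) (by
      rintro i j rfl a ha x hx
      have : barDiff N (k + 1) (btmul N.toGMod a x) ∈ (barT N.toGMod (k + 1)).gr (i + j + 1) := by
        rw [barDiff_btmul]
        refine add_mem ?_ ?_
        · have := btmul_mem N.toGMod (A.d_mem i a ha) hx
          rwa [show i + 1 + j = i + j + 1 by ring] at this
        · have := btmul_mem N.toGMod (parity_mem A.internal ha) (barDiff_mem k j x hx)
          rwa [← add_assoc] at this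
      exact this)

theorem barDiff_barDiff : ∀ k (x : barT N.toGMod k), barDiff N k (barDiff N k x) = 0
  | 0 => N.d_d
  | k + 1 => by
    refine bar_induction N.toGMod (by simp)
      (fun x y hx hy => by simp only [map_add, hx, hy, add_zero]) fun a x => ?_
    rw [barDiff_btmul, map_add, barDiff_btmul, barDiff_btmul, A.d_d, barDiff_barDiff k,
      btmul_zero, add_zero, zero_btmul, zero_add, parity_shift _ A.d_mem, ← add_btmul,
      add_neg_cancel, zero_btmul]

theorem barDiff_smul (k : ℕ) (a : A) (x : barT N.toGMod k) :
    barDiff N k (a • x) = A.d a • x + A.σ a • barDiff N k x := by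
  match k with
  | 0 => exact N.d_smul a x
  | k + 1 =>
    refine bar_induction N.toGMod (P := fun x => barDiff N (k + 1) (a • x)
      = A.d a • x + A.σ a • barDiff N (k + 1) x) (by simp)
      (fun x y hx hy => by simp only [map_add, smul_add, hx, hy]; abel) (fun b x => ?_) x
    have h : A.σ (a * b) = A.σ a * A.σ b := by
      induction a using graded_induction A.internal with
      | h0 => simp
      | hadd x y hx hy => simp only [map_add, add_mul, hx, hy]
      | hgr i a ha => rw [A.σ_mul ha, parity_of_mem _ ha, smul_mul_assoc]
    rw [smul_btmul, barDiff_btmul, barDiff_btmul, A.d_mul, smul_add, smul_btmul, smul_btmul,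
      smul_btmul, add_btmul, h]
    abel

theorem bact_barDiff (k : ℕ) (x : barT N.toGMod (k + 1)) :
    bact N.toGMod k (barDiff N (k + 1) x) = barDiff N k (bact N.toGMod k x) := by
  refine bar_induction N.toGMod (P := fun x => bact N.toGMod k (barDiff N (k + 1) x)
    = barDiff N k (bact N.toGMod k x)) (by simp)
    (fun x y hx hy => by simp only [map_add, hx, hy]) (fun a x => ?_) x
  rw [barDiff_btmul, map_add, bact_btmul, bact_btmul, bact_btmul, barDiff_smul]

theorem bd_barDiff : ∀ (k : ℕ) (x : barT N.toGMod (k + 1)),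
    bd N.toGMod k (barDiff N (k + 1) x) = barDiff N k (bd N.toGMod k x)
  | 0 => by rw [bd_zero]; exact bact_barDiff N 0
  | k + 1 => by
    refine bar_induction N.toGMod (by simp)
      (fun x y hx hy => by simp only [map_add, hx, hy]) fun a x => ?_
    rw [barDiff_btmul, map_add, bd_succ, bd_succ, bd_succ, map_sub, barDiff_smul, barDiff_btmul,
      bd_barDiff k]
    abel

theorem ins_barDiff : ∀ (k i : ℕ) (x : barT N.toGMod k),
    ins N.toGMod k i (barDiff N k x) = barDiff N (k + 1) (ins N.toGMod k i x)
  | k, 0 => by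
    intro x
    rw [ins_zero, bunit_apply, bunit_apply, barDiff_btmul]
    erw [A.d_one, A.σ_one]
    rw [zero_btmul, zero_add]
  | 0, _ + 1 => fun _ => ((barDiff N 1).map_zero).symm
  | k + 1, i + 1 => by
    refine bar_induction N.toGMod (by simp)
      (fun x y hx hy => by simp only [map_add, hx, hy]) fun a x => ?_
    have h : ∀ b (y : barT N.toGMod k), ins N.toGMod (k + 1) (i + 1) (btmul N.toGMod b y)
      = btmul N.toGMod b (ins N.toGMod k i y) := fun _ _ => rfl
    rw [barDiff_btmul, map_add, h, h, h, barDiff_btmul, ins_barDiff k i]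

theorem barDiff_insSpan (k : ℕ) : ∀ x ∈ insSpan N.toGMod k, barDiff N k x ∈ insSpan N.toGMod k := by
  match k with
  | 0 =>
    intro x hx
    rw [mem_insSpan_zero _ hx, map_zero]; exact zero_mem _
  | k + 1 =>
    refine insSpan_succ_induction N.toGMod (by simp) (fun x y hx hy => ?_) fun i hi x => ?_
    · rw [map_add]; exact add_mem hx hy
    · rw [← ins_barDiff]; exact ins_mem_insSpan _ hi _

theorem barDiff_degenerate (k : ℕ) : ∀ x ∈ degenerate N.toGMod k,
    barDiff N (k + 1) x ∈ degenerate N.toGMod k := by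
  refine degenerate_induction N.toGMod (by simp) (fun x y hx hy => ?_) fun a y hy => ?_
  · rw [map_add]; exact add_mem hx hy
  · rw [barDiff_btmul]
    exact add_mem (btmul_mem_degenerate _ _ _ _ hy)
      (btmul_mem_degenerate _ _ _ _ (barDiff_insSpan N k y hy))

/-- The internal differential of the normalised bar construction. -/
noncomputable def normDiff (k : ℕ) : normBar N.toGMod k →ₗ[ℚ] normBar N.toGMod k :=
  (((degenerate N.toGMod k).restrictScalars ℚ).mapQ ((degenerate N.toGMod k).restrictScalars ℚ)
    (barDiff N (k + 1)) (barDiff_degenerate N k) :)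

theorem normDiff_mk (k : ℕ) (x : barT N.toGMod (k + 1)) :
    normDiff N k (normMk N.toGMod k x) = normMk N.toGMod k (barDiff N (k + 1) x) := rfl

theorem normDiff_mem (k : ℕ) : ∀ i, ∀ x ∈ (normBar N.toGMod k).gr i,
    normDiff N k x ∈ (normBar N.toGMod k).gr (i + 1) := by
  intro i x hx
  obtain ⟨y, hy, rfl⟩ := exists_of_mem_normBar_gr _ hx
  rw [normDiff_mk]
  exact normMk_degPres _ _ _ _ (barDiff_mem N _ _ _ hy)

theorem normDiff_normDiff (k : ℕ) (x : normBar N.toGMod k) : normDiff N k (normDiff N k x) = 0 := by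
  obtain ⟨x, rfl⟩ := normMk_surjective _ _ x
  rw [normDiff_mk, normDiff_mk, barDiff_barDiff, map_zero]

theorem normDiff_smul (k : ℕ) (a : A) (x : normBar N.toGMod k) :
    normDiff N k (a • x) = A.d a • x + A.σ a • normDiff N k x := by
  obtain ⟨x, rfl⟩ := normMk_surjective _ _ x
  rw [← map_smul, normDiff_mk, normDiff_mk, barDiff_smul, map_add, map_smul, map_smul]

theorem normBd_normDiff (k : ℕ) (x : normBar N.toGMod (k + 1)) :
    normBd N.toGMod k (normDiff N (k + 1) x) = normDiff N k (normBd N.toGMod k x) := by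
  obtain ⟨x, rfl⟩ := normMk_surjective _ _ x
  rw [normDiff_mk, normBd_mk, normBd_mk, normDiff_mk, bd_barDiff]

theorem normAug_normDiff (x : normBar N.toGMod 0) :
    normAug N.toGMod (normDiff N 0 x) = N.d (normAug N.toGMod x) := by
  obtain ⟨x, rfl⟩ := normMk_surjective _ _ x
  rw [normDiff_mk, normAug_mk, normAug_mk, bact_barDiff]
  rfl

/-- The underlying module of the bar construction. -/
abbrev BarCarrier : Type u := ⨁ k, (normBar N.toGMod k : Type u)

/-- The inclusion of the `k`-th summand of the bar construction. -/
noncomputable def inc (k : ℕ) : normBar N.toGMod k →ₗ[A] BarCarrier N :=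
  DirectSum.lof A ℕ (fun k => (normBar N.toGMod k : Type u)) k

variable {N} in
theorem barCarrier_induction {P : BarCarrier N → Prop} (h0 : P 0)
    (hadd : ∀ x y, P x → P y → P (x + y)) (hinc : ∀ k x, P (inc N k x)) (x : BarCarrier N) :
    P x := by
  induction x using DirectSum.induction_on with
  | zero => exact h0
  | add x y hx hy => exact hadd x y hx hy
  | of k x => exact hinc k x

variable {N} in
/-- The linear map out of the bar construction that is given by `φ k` on the `k`-th summand. -/
noncomputable def barLift {V : Type*} [AddCommGroup V] [Module ℚ V]
    (φ : ∀ k, normBar N.toGMod k →ₗ[ℚ] V) : BarCarrier N →ₗ[ℚ] V :=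
  DirectSum.toModule ℚ ℕ V φ

theorem barLift_inc {V : Type*} [AddCommGroup V] [Module ℚ V]
    (φ : ∀ k, normBar N.toGMod k →ₗ[ℚ] V) (k : ℕ) (x : normBar N.toGMod k) :
    barLift φ (inc N k x) = φ k x :=
  DirectSum.toModule_lof (M := fun k => (normBar N.toGMod k : Type u)) ℚ k x

/-- The degree `n` part of the total complex; an element of the `k`-th summand has its internal
degree lowered by `k`. -/
def barGr (n : ℤ) : Submodule ℚ (BarCarrier N) where
  carrier := {x | ∀ k : ℕ, x k ∈ (normBar N.toGMod k).gr (n + k)}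
  add_mem' hx hy k := add_mem (hx k) (hy k)
  zero_mem' _ := zero_mem _
  smul_mem' c _ hx k := Submodule.smul_mem _ c (hx k)

theorem inc_mem {k : ℕ} {n : ℤ} {x : normBar N.toGMod k}
    (hx : x ∈ (normBar N.toGMod k).gr (n + k)) : inc N k x ∈ barGr N n := by
  intro l
  by_cases h : k = l
  · subst h
    have : (inc N k x) k = x := DirectSum.lof_apply (M := fun k => (normBar N.toGMod k : Type u)) A k x
    rwa [this]
  · have : (inc N k x) l = 0 := DirectSum.of_eq_of_ne (β := fun k => (normBar N.toGMod k : Type u)) k l x (Ne.symm h)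
    rw [this]; exact zero_mem _

theorem barGr_induction {n : ℤ} {P : BarCarrier N → Prop} (h0 : P 0)
    (hadd : ∀ x y, P x → P y → P (x + y))
    (hinc : ∀ k : ℕ, ∀ x ∈ (normBar N.toGMod k).gr (n + k), P (inc N k x)) :
    ∀ x ∈ barGr N n, P x := by
  classical
  intro x hx
  rw [← DirectSum.sum_support_of x]
  refine Finset.sum_induction _ P hadd h0 fun k _ => hinc k _ (hx k)

theorem bar_internal : DirectSum.IsInternal (barGr N) := by
  have hp : ∀ (n : ℤ) (k : ℕ) (x : normBar N.toGMod k),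
      barLift (fun k => ((inc N k).restrictScalars ℚ).comp (proj (normBar N.toGMod k).internal (n + k)))
        (inc N k x) = inc N k (proj (normBar N.toGMod k).internal (n + k) x) := fun n k x =>
    barLift_inc N _ k x
  refine isInternal_of_proj (fun n => barLift fun k => ((inc N k).restrictScalars ℚ).comp
    (proj (normBar N.toGMod k).internal (n + k))) ?_ ?_ ?_
  · intro n
    refine barGr_induction N (by simp) (fun x y hx hy => by rw [map_add, hx, hy]) fun k x hx => ?_
    rw [hp, proj_same _ hx]
  · intro m n x hx hmn
    refine barGr_induction N (P := fun x => barLift (fun k => ((inc N k).restrictScalars ℚ).comp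
      (proj (normBar N.toGMod k).internal (n + k))) x = 0) (by simp)
      (fun x y hx hy => by rw [map_add, hx, hy, add_zero]) (fun k x hx => ?_) x hx
    rw [hp, proj_ne _ hx (by omega), map_zero]
  · refine barCarrier_induction (zero_mem _) (fun _ _ => add_mem) fun k x => ?_
    induction x using graded_induction (normBar N.toGMod k).internal with
    | h0 => rw [map_zero]; exact zero_mem _
    | hadd x y hx hy => rw [map_add]; exact add_mem hx hy
    | hgr i x hx =>
      refine Submodule.mem_iSup_of_mem (i - k) (inc_mem N ?_)
      rwa [sub_add_cancel]

/-- The total differential on the `k`-th summand: the sum of the internal differential and of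
`x ↦ (-1)^{|x|} ∂ x`, where `|x|` is the internal degree and `∂` is the alternating sum of the face
maps. -/
noncomputable def barTotal : (k : ℕ) → (normBar N.toGMod k →ₗ[ℚ] BarCarrier N)
  | 0 => ((inc N 0).restrictScalars ℚ).comp (normDiff N 0)
  | k + 1 => ((inc N (k + 1)).restrictScalars ℚ).comp (normDiff N (k + 1)) +
      ((inc N k).restrictScalars ℚ).comp
        (((normBd N.toGMod k).restrictScalars ℚ).comp (parity (normBar N.toGMod (k + 1)).internal))

/-- The differential of the bar construction. -/
noncomputable def barD : BarCarrier N →ₗ[ℚ] BarCarrier N := barLift (barTotal N)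

theorem barD_zero (x : normBar N.toGMod 0) : barD N (inc N 0 x) = inc N 0 (normDiff N 0 x) :=
  barLift_inc N _ _ _

theorem barD_succ (k : ℕ) (x : normBar N.toGMod (k + 1)) :
    barD N (inc N (k + 1) x) = inc N (k + 1) (normDiff N (k + 1) x) +
      inc N k (normBd N.toGMod k (parity (normBar N.toGMod (k + 1)).internal x)) :=
  barLift_inc N _ _ _

theorem parity_smul (M : GMod.{u} A.toGAlg) (a : A) (x : M) :
    parity M.internal (a • x) = A.σ a • parity M.internal x := by
  induction a using graded_induction A.internal with
  | h0 => simp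
  | hadd a b ha hb => simp only [add_smul, map_add, ha, hb]
  | hgr i a ha =>
    induction x using graded_induction M.internal with
    | h0 => simp
    | hadd x y hx hy => simp only [smul_add, map_add, hx, hy]
    | hgr j x hx =>
      rw [parity_of_mem _ (M.smul_mem ha hx), parity_of_mem _ hx, parity_of_mem _ ha, sgn_add,
        smul_assoc, mul_smul, smul_comm a]

theorem barD_smul (a : A) (x : BarCarrier N) :
    barD N (a • x) = A.d a • x + A.σ a • barD N x := by
  refine barCarrier_induction (P := fun x => barD N (a • x) = A.d a • x + A.σ a • barD N x)
    (by simp) (fun x y hx hy => by simp only [smul_add, map_add, hx, hy]; abel) (fun k x => ?_) x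
  rw [← map_smul]
  match k with
  | 0 => rw [barD_zero, barD_zero, normDiff_smul, map_add, map_smul, map_smul]
  | k + 1 =>
    rw [barD_succ, barD_succ, normDiff_smul, map_add, map_smul, map_smul, parity_smul, map_smul,
      map_smul, smul_add, add_assoc]

theorem barD_mem (n : ℤ) : ∀ x ∈ barGr N n, barD N x ∈ barGr N (n + 1) := by
  refine barGr_induction N (by simp) (fun x y hx hy => by rw [map_add]; exact add_mem hx hy)
    fun k x hx => ?_
  have h1 : inc N k (normDiff N k x) ∈ barGr N (n + 1) := by
    refine inc_mem N ?_
    have := normDiff_mem N k _ x hx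
    rwa [show n + k + 1 = n + 1 + k by ring] at this
  match k with
  | 0 => rw [barD_zero]; exact h1
  | k + 1 =>
    rw [barD_succ]
    refine add_mem h1 (inc_mem N ?_)
    have := normBd_degPres N.toGMod k _ _ (parity_mem (normBar N.toGMod (k + 1)).internal hx)
    rwa [show n + (k + 1 : ℕ) = n + 1 + k by push_cast; ring] at this

theorem parity_degPres {R : GAlg.{u}} {M M' : GMod.{u} R} {f : M →ₗ[ℚ] M'} (hf : DegPres f) (x : M) :
    parity M'.internal (f x) = f (parity M.internal x) := by
  induction x using graded_induction M.internal with
  | h0 => simp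
  | hadd x y hx hy => simp only [map_add, hx, hy]
  | hgr i x hx => rw [parity_of_mem _ hx, parity_of_mem _ (hf i x hx), map_smul]

theorem barD_barD (x : BarCarrier N) : barD N (barD N x) = 0 := by
  refine barCarrier_induction (P := fun x => barD N (barD N x) = 0) (by simp)
    (fun x y hx hy => by simp only [map_add, hx, hy, add_zero]) (fun k x => ?_) x
  match k with
  | 0 => rw [barD_zero, barD_zero, normDiff_normDiff, map_zero]
  | 1 =>
    rw [barD_succ, map_add, barD_succ, barD_zero, normDiff_normDiff, ← normBd_normDiff,
      parity_shift _ (normDiff_mem N 1)]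
    simp
  | k + 2 =>
    have h := parity_degPres (normBd_degPres N.toGMod (k + 1))
      (parity (normBar N.toGMod (k + 2)).internal x)
    rw [parity_parity] at h
    have h : parity (normBar N.toGMod (k + 1)).internal (normBd N.toGMod (k + 1)
      (parity (normBar N.toGMod (k + 2)).internal x)) = normBd N.toGMod (k + 1) x := h
    rw [barD_succ, map_add, barD_succ, barD_succ, normDiff_normDiff, ← normBd_normDiff,
      parity_shift _ (normDiff_mem N (k + 2)), h, normBd_normBd]
    simp

/-- The bar construction `B(A; A; N)`. -/
noncomputable def bar : DGMod.{u} A where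
  carrier := BarCarrier N
  gr := barGr N
  internal := bar_internal N
  smul_mem := by
    intro i j a x ha hx
    refine barGr_induction N (P := fun x => a • x ∈ barGr N (i + j)) (by simp)
      (fun x y hx hy => by rw [smul_add]; exact add_mem hx hy) (fun k x hx => ?_) x hx
    rw [← map_smul]
    refine inc_mem N ?_
    have := (normBar N.toGMod k).smul_mem ha hx
    rwa [← add_assoc] at this
  d := barD N
  d_mem := barD_mem N
  d_d := barD_barD N
  leibniz := by
    intro i a ha x
    have : A.σ a = sgn i • a := parity_of_mem _ ha
    rw [barD_smul, this, smul_assoc]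

/-- The inclusion of the normalised `k`-simplices `A ⊗ (A/ℚ)^{⊗ k} ⊗ N` into `B(A; A; N)`. -/
noncomputable def barInc (k : ℕ) : normBar N.toGMod k →ₗ[A] bar N := inc N k

end DGMod

/-! ### Morphisms and cofibrant replacements of differential graded modules -/

namespace DGMod

variable {A : CDGA.{u}}

/-- A morphism of differential graded modules. -/
structure Hom (M N : DGMod.{u} A) where
  f : M →ₗ[A] N
  mem : ∀ i, ∀ x ∈ M.gr i, f x ∈ N.gr i
  comm : ∀ x, f (M.d x) = N.d (f x)

/-- The map induced on cohomology. -/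
def Hom.hMap {M N : DGMod.{u} A} (φ : Hom M N) : M.H →ₗ[ℚ] N.H :=
  (Submodule.mapQ _ _
    ((φ.f.restrictScalars ℚ).restrict (p := LinearMap.ker M.d) (q := LinearMap.ker N.d)
      (fun x (hx : M.d x = 0) => by
        change N.d (φ.f x) = 0
        rw [← φ.comm, hx, map_zero]))
    (by
      rintro x ⟨y, hy⟩
      have hy : M.d y = x := hy
      have : N.d (φ.f y) = φ.f x := by rw [← φ.comm, hy]
      exact ⟨φ.f y, this⟩) : M.HCarrier →ₗ[ℚ] N.HCarrier)

/-- A quasi-isomorphism. -/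
def Hom.QuasiIso {M N : DGMod.{u} A} (φ : Hom M N) : Prop := Function.Bijective φ.hMap

/-- A differential graded module is cofibrant if it has the left lifting property with respect to
surjective quasi-isomorphisms. -/
def IsCofibrant (P : DGMod.{u} A) : Prop :=
  ∀ (X Y : DGMod.{u} A) (g : Hom X Y), Function.Surjective g.f → g.QuasiIso →
    ∀ f : Hom P Y, ∃ h : Hom P X, ∀ x, g.f (h.f x) = f.f x

/-- `π : P → N` is a cofibrant replacement of `N`. -/
def Hom.IsCofibrantReplacement {P N : DGMod.{u} A} (π : Hom P N) : Prop :=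
  P.IsCofibrant ∧ π.QuasiIso

/-- The augmentation of the bar construction, given by `a ⊗ n ↦ a n` on `A ⊗ N` and by zero on the
other summands. -/
noncomputable def augMap (N : DGMod.{u} A) : BarCarrier N →ₗ[A] N :=
  DirectSum.toModule A ℕ N fun k => match k with
    | 0 => GMod.normAug N.toGMod
    | _ + 1 => 0

theorem augMap_zero (N : DGMod.{u} A) (x : GMod.normBar N.toGMod 0) :
    augMap N (inc N 0 x) = GMod.normAug N.toGMod x :=
  DirectSum.toModule_lof (M := fun k => (GMod.normBar N.toGMod k : Type u)) A 0 x

theorem augMap_succ (N : DGMod.{u} A) (k : ℕ) (x : GMod.normBar N.toGMod (k + 1)) :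
    augMap N (inc N (k + 1) x) = 0 :=
  DirectSum.toModule_lof (M := fun k => (GMod.normBar N.toGMod k : Type u)) A (k + 1) x

theorem augMap_mem (N : DGMod.{u} A) (i : ℤ) : ∀ x ∈ barGr N i, augMap N x ∈ N.gr i := by
  refine barGr_induction N (by rw [map_zero]; exact zero_mem _)
    (fun x y hx hy => by rw [map_add]; exact add_mem hx hy) fun k x hx => ?_
  match k with
  | 0 =>
    rw [augMap_zero]
    have := GMod.normAug_degPres N.toGMod _ x hx
    simpa using this
  | k + 1 => rw [augMap_succ]; exact zero_mem _

theorem augMap_barD (N : DGMod.{u} A) (x : BarCarrier N) :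
    augMap N (barD N x) = N.d (augMap N x) := by
  refine barCarrier_induction (P := fun x => augMap N (barD N x) = N.d (augMap N x)) (by simp)
    (fun x y hx hy => by simp only [map_add, hx, hy]) (fun k x => ?_) x
  match k with
  | 0 => rw [barD_zero, augMap_zero, augMap_zero, normAug_normDiff]
  | 1 =>
    rw [barD_succ, map_add, augMap_zero, augMap_succ, augMap_succ, GMod.normAug_normBd, map_zero,
      add_zero]
  | k + 2 =>
    rw [barD_succ, map_add, augMap_succ, augMap_succ, augMap_succ, map_zero, add_zero]

/-- The augmentation `B(A; A; N) → N`. -/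
noncomputable def barAug (N : DGMod.{u} A) : Hom (bar N) N where
  f := augMap N
  mem := augMap_mem N
  comm := augMap_barD N

end DGMod

/-! ### Filtered complexes and their spectral sequences -/

/-- A cochain complex of rational vector spaces, whose terms `C n` are given as subspaces of an
ambient space `W`. -/
structure Cx where
  W : Type u
  [addCommGroup : AddCommGroup W]
  [module : Module ℚ W]
  C : ℤ → Submodule ℚ W
  d : ℤ → W →ₗ[ℚ] W
  d_mem : ∀ n, ∀ x ∈ C n, d n x ∈ C (n + 1)
  d_d : ∀ n, ∀ x ∈ C n, d (n + 1) (d n x) = 0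

attribute [instance] Cx.addCommGroup Cx.module

namespace Cx

variable (K : Cx.{u})

/-- The `n`-cocycles. -/
def cocycles (n : ℤ) : Submodule ℚ K.W := K.C n ⊓ LinearMap.ker (K.d n)

/-- The `n`-coboundaries. -/
def coboundaries (n : ℤ) : Submodule ℚ K.W := (K.C (n - 1)).map (K.d (n - 1))

/-- The cohomology in degree `n`. -/
abbrev H (n : ℤ) : Type u := K.cocycles n ⧸ (K.coboundaries n).comap (K.cocycles n).subtype

/-- The class of a cocycle. -/
def cls (n : ℤ) : K.cocycles n →ₗ[ℚ] K.H n := Submodule.mkQ _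

end Cx

/-- A cochain complex with a decreasing filtration `F p` by subcomplexes. -/
structure FiltCx extends Cx.{u} where
  F : ℤ → ℤ → Submodule ℚ W
  F_le : ∀ p n, F p n ≤ C n
  F_anti : ∀ p n, F (p + 1) n ≤ F p n
  d_F : ∀ p n, ∀ x ∈ F p n, d n x ∈ F p (n + 1)

namespace FiltCx

variable (K : FiltCx.{u})

/-- `Z_r^p = {x ∈ F^p C^n | d x ∈ F^{p+r} C^{n+1}}`. -/
def Z (r p n : ℤ) : Submodule ℚ K.W := K.F p n ⊓ (K.F (p + r) (n + 1)).comap (K.d n)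

/-- `d Z_{r-1}^{p-r+1}`. -/
def B (r p n : ℤ) : Submodule ℚ K.W := (K.Z (r - 1) (p - r + 1) (n - 1)).map (K.d (n - 1))

/-- The term `E_r^p = Z_r^p / (Z_{r-1}^{p+1} + d Z_{r-1}^{p-r+1})` of total degree `n` of the
spectral sequence of a filtered complex. -/
abbrev E (r p n : ℤ) : Type u :=
  K.Z r p n ⧸ (K.Z (r - 1) (p + 1) n ⊔ K.B r p n).comap (K.Z r p n).subtype

/-- The class of an element of `Z_r^p`. -/
def mkE (r p n : ℤ) : K.Z r p n →ₗ[ℚ] K.E r p n := Submodule.mkQ _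

/-- The infinite cycles `⋂ r, Z_r^p + F^{p+1}`. -/
def ZInf (p n : ℤ) : Submodule ℚ K.W := ⨅ r : ℕ, (K.Z r p n ⊔ K.F (p + 1) n)

/-- The infinite boundaries `⋃ r, d Z_{r-1}^{p-r+1} + F^{p+1}`. -/
def BInf (p n : ℤ) : Submodule ℚ K.W := ⨆ r : ℕ, (K.B r p n ⊔ K.F (p + 1) n)

/-- The `E_∞`-term in filtration degree `p` and total degree `n`. -/
abbrev EInf (p n : ℤ) : Type u := K.ZInf p n ⧸ (K.BInf p n).comap (K.ZInf p n).subtype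

/-- The class of an infinite cycle in `E_∞`. -/
def mkEInf (p n : ℤ) : K.ZInf p n →ₗ[ℚ] K.EInf p n := Submodule.mkQ _

/-- The induced filtration on cohomology: `F^p H^n` consists of the classes of the cocycles in
`F^p`. -/
def filH (p n : ℤ) : Submodule ℚ (K.H n) :=
  ((K.F p n).comap (K.cocycles n).subtype).map (K.toCx.cls n)

/-- The identification of a cohomological spectral sequence (with differentials `d_r` of bidegree
`(r, 1 - r)`) with the spectral sequence of a filtered complex, where `E_r^{p,q}` is the term in
filtration degree `p` and total degree `p + q`. The differentials and the isomorphisms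
`H(E_r) ≅ E_{r+1}` are required to be the usual ones. -/
structure Identification
    (S : CategoryTheory.CohomologicalSpectralSequence (ModuleCat.{u} ℚ) 1) where
  e : ∀ (r : ℤ) (hr : 1 ≤ r) (p q : ℤ), (S.page r hr).X (p, q) ≃ₗ[ℚ] K.E r p (p + q)
  d_comm : ∀ (r : ℤ) (hr : 1 ≤ r) (p q : ℤ) (x : (S.page r hr).X (p, q)) (f : K.Z r p (p + q))
    (g : K.Z r (p + r) (p + r + (q + (1 - r)))),
    e r hr p q x = K.mkE _ _ _ f → (g : K.W) = K.d (p + q) f →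
      e r hr (p + r) (q + (1 - r))
        ((S.page r hr).d (p, q) (p + r, q + (1 - r)) x) = K.mkE _ _ _ g
  iso_comm : ∀ (r : ℤ) (hr : 1 ≤ r) (p q : ℤ) (z : (S.page r hr).cycles (p, q))
    (f : K.Z r p (p + q)) (f' : K.Z (r + 1) p (p + q)),
    e r hr p q ((S.page r hr).iCycles (p, q) z) = K.mkE _ _ _ f → (f : K.W) = f' →
      e (r + 1) (by lia) p q ((S.iso r (r + 1) (p, q)).hom
        ((S.page r hr).homologyπ (p, q) z)) = K.mkE _ _ _ f'

/-- The filtration of `V ≅ H^n` that corresponds to the filtration of `H^n`. -/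
def fil (n : ℤ) {V : Type u} [AddCommGroup V] [Module ℚ V] (α : K.H n ≃ₗ[ℚ] V) (p : ℤ) :
    Submodule ℚ V :=
  (K.filH p n).map α.toLinearMap

/-- Strong convergence, in total degree `n`, of the spectral sequence of a filtered complex to a
vector space `V` that is identified with `H^n` by `α`: the filtration `F^p` of `V` that corresponds
to the filtration of `H^n` is exhaustive, Hausdorff and complete, and its graded pieces
`F^p / F^{p+1}` are identified with the `E_∞`-terms in the usual way. -/
structure ConvergesStrongly (n : ℤ) {V : Type u} [AddCommGroup V] [Module ℚ V]
    (α : K.H n ≃ₗ[ℚ] V) : Prop where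
  exhaustive : ⨆ p, K.fil n α p = ⊤
  hausdorff : ⨅ p, K.fil n α p = ⊥
  complete : ∀ x : ℤ → V, (∀ p, x (p + 1) - x p ∈ K.fil n α p) →
    ∃ y, ∀ p, y - x p ∈ K.fil n α p
  gr : ∀ p, ∃ κ : (K.fil n α p ⧸ (K.fil n α (p + 1)).comap (K.fil n α p).subtype) ≃ₗ[ℚ] K.EInf p n,
    ∀ (z : K.cocycles n) (v : K.fil n α p) (w : K.ZInf p n), (z : K.W) ∈ K.F p n →
      (v : V) = α (K.toCx.cls n z) → (w : K.W) = z →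
        κ (Submodule.Quotient.mk v) = K.mkEInf p n w

end FiltCx

/-! ### Hom complexes -/

namespace DGMod

variable {A : CDGA.{u}}

/-- The differential `f ↦ d_M ∘ f - (-1)^n f ∘ d_N` on maps of degree `n`. -/
def homD (N M : DGMod.{u} A) (n : ℤ) : (N →ₗ[ℚ] M) →ₗ[ℚ] (N →ₗ[ℚ] M) where
  toFun f := M.d.comp f - sgn n • f.comp N.d
  map_add' f g := by ext x; simp; abel
  map_smul' c f := by ext x; simp [smul_sub, smul_comm c]

theorem homD_apply (N M : DGMod.{u} A) (n : ℤ) (f : N →ₗ[ℚ] M) (x : N) :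
    homD N M n f x = M.d (f x) - sgn n • f (N.d x) := rfl

theorem homD_mem (N M : DGMod.{u} A) (n : ℤ) :
    ∀ f ∈ GMod.homDeg N.toGMod M.toGMod n, homD N M n f ∈ GMod.homDeg N.toGMod M.toGMod (n + 1) := by
  rintro f ⟨h1, h2⟩
  refine ⟨fun i x hx => ?_, fun i a ha x => ?_⟩
  · rw [homD_apply]
    refine sub_mem ?_ (Submodule.smul_mem _ _ ?_)
    · rw [← add_assoc]; exact M.d_mem _ _ (h1 i x hx)
    · have := h1 _ _ (N.d_mem i x hx)
      rwa [show i + 1 + n = i + (n + 1) by ring] at this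
  · rw [homD_apply, homD_apply, h2 i a ha, M.d.map_smul, M.leibniz i a ha, N.leibniz i a ha,
      f.map_add, f.map_smul, h2 i a ha, h2 _ _ (A.d_mem i a ha)]
    have e1 : sgn (n * (i + 1)) = sgn (n * i) * sgn n := by rw [mul_add, sgn_add, mul_one]
    have e2 : sgn ((n + 1) * i) = sgn (n * i) * sgn i := by rw [add_mul, sgn_add, one_mul]
    rw [e1, e2]
    simp only [smul_add, smul_sub, smul_smul]
    rw [show sgn n * (sgn (n * i) * sgn n) = sgn (n * i) * (sgn n * sgn n) by ring, sgn_sq, mul_one,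
      smul_comm a (sgn n) (f (N.d x)), smul_smul,
      show sgn (n * i) * sgn i * sgn n = sgn n * (sgn i * sgn (n * i)) by ring]
    abel

theorem homD_homD (N M : DGMod.{u} A) (n : ℤ) (f : N →ₗ[ℚ] M) :
    homD N M (n + 1) (homD N M n f) = 0 := by
  ext x
  rw [homD_apply, homD_apply, homD_apply, N.d_d, map_sub, M.d_d, map_smul, sgn_add, sgn_one,
    map_zero]
  simp

/-- The complex `[N, M]_A` of `A`-linear maps. -/
def homCx (N M : DGMod.{u} A) : Cx.{u} where
  W := N →ₗ[ℚ] M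
  C := GMod.homDeg N.toGMod M.toGMod
  d := homD N M
  d_mem := homD_mem N M
  d_d n f _ := homD_homD N M n f

/-- Precomposition with a morphism of differential graded modules, on cocycles. -/
def Hom.precompCocycles {P N : DGMod.{u} A} (φ : Hom P N) (M : DGMod.{u} A) (n : ℤ) :
    (homCx N M).cocycles n →ₗ[ℚ] (homCx P M).cocycles n :=
  (LinearMap.lcomp ℚ M (φ.f.restrictScalars ℚ)).restrict (by
    rintro f ⟨⟨h1, h2⟩, h3⟩
    have h3 : homD N M n f = 0 := h3
    refine ⟨⟨fun i x hx => h1 i _ (φ.mem i x hx), fun i a ha x => ?_⟩, ?_⟩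
    · change f (φ.f (a • x)) = sgn (n * i) • a • f (φ.f x)
      rw [map_smul, h2 i a ha]
    · refine LinearMap.ext fun x => ?_
      change M.d (f (φ.f x)) - sgn n • f (φ.f (P.d x)) = 0
      rw [φ.comm]
      exact LinearMap.congr_fun h3 (φ.f x))

theorem Hom.precomp_coboundary {P N : DGMod.{u} A} (φ : Hom P N) (M : DGMod.{u} A) (n : ℤ)
    (f : N →ₗ[ℚ] M) (hf : f ∈ (homCx N M).coboundaries n) :
    f.comp (φ.f.restrictScalars ℚ) ∈ (homCx P M).coboundaries n := by
  obtain ⟨g, ⟨h1, h2⟩, hg⟩ := hf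
  change N →ₗ[ℚ] M at g
  replace hg : homD N M (n - 1) g = f := hg
  refine ⟨g.comp (φ.f.restrictScalars ℚ), ⟨fun i x hx => h1 i _ (φ.mem i x hx),
    fun i a ha x => ?_⟩, ?_⟩
  · change g (φ.f (a • x)) = sgn ((n - 1) * i) • a • g (φ.f x)
    rw [map_smul, h2 i a ha]
  · refine LinearMap.ext fun x => ?_
    change M.d (g (φ.f x)) - sgn (n - 1) • g (φ.f (P.d x)) = f (φ.f x)
    rw [φ.comm, ← hg]
    rfl

/-- The map `H^n[N, M]_A → H^n[P, M]_A` induced by a morphism `P → N`. -/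
def Hom.precomp {P N : DGMod.{u} A} (φ : Hom P N) (M : DGMod.{u} A) (n : ℤ) :
    (homCx N M).H n →ₗ[ℚ] (homCx P M).H n :=
  Submodule.mapQ _ _ (φ.precompCocycles M n) (fun f hf => φ.precomp_coboundary M n f.1 hf)

/-- The filtration of `[B(A; A; N), M]_A` induced by the skeletal filtration of the bar
construction: the maps of degree `n` that vanish on the `(p-1)`-skeleton, which is the sum of the
summands `A ⊗ (A/ℚ)^{⊗ k} ⊗ N` with `k < p`. -/
noncomputable def skelFil (N M : DGMod.{u} A) (p n : ℤ) : Submodule ℚ (bar N →ₗ[ℚ] M) where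
  carrier := {f | f ∈ GMod.homDeg (bar N).toGMod M.toGMod n ∧
    ∀ k : ℕ, (k : ℤ) < p → ∀ x, f (barInc N k x) = 0}
  add_mem' := by
    rintro f g ⟨hf, hf'⟩ ⟨hg, hg'⟩
    refine ⟨add_mem hf hg, fun k hk x => ?_⟩
    rw [LinearMap.add_apply, hf' k hk, hg' k hk, add_zero]
  zero_mem' := ⟨zero_mem _, fun k hk x => rfl⟩
  smul_mem' := by
    rintro c f ⟨hf, hf'⟩
    refine ⟨Submodule.smul_mem _ c hf, fun k hk x => ?_⟩
    rw [LinearMap.smul_apply, hf' k hk, smul_zero]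

theorem skelFil_d (N M : DGMod.{u} A) (p n : ℤ) :
    ∀ f ∈ skelFil N M p n, homD (bar N) M n f ∈ skelFil N M p (n + 1) := by
  rintro f ⟨hf, hf'⟩
  refine ⟨homD_mem _ _ n f hf, fun k hk x => ?_⟩
  have h : f ((bar N).d (barInc N k x)) = 0 := by
    match k with
    | 0 =>
      have e : (bar N).d (barInc N 0 x) = barInc N 0 (normDiff N 0 x) := barD_zero N x
      rw [e, hf' 0 hk]
    | k + 1 =>
      have e : (bar N).d (barInc N (k + 1) x) = barInc N (k + 1) (normDiff N (k + 1) x) +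
        barInc N k (GMod.normBd N.toGMod k
          (parity (GMod.normBar N.toGMod (k + 1)).internal x)) := barD_succ N k x
      rw [e, map_add, hf' (k + 1) hk, hf' k (by push_cast at hk; omega), add_zero]
  rw [homD_apply, h, hf' k hk, map_zero, smul_zero, sub_zero]

/-- The complex `[B(A; A; N), M]_A` with the filtration induced by the skeletal filtration. -/
noncomputable def barFilt (N M : DGMod.{u} A) : FiltCx.{u} where
  toCx := homCx (bar N) M
  F := skelFil N M
  F_le p n f hf := hf.1
  F_anti p n f hf := ⟨hf.1, fun k hk x => hf.2 k (by omega) x⟩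
  d_F := skelFil_d N M

end DGMod

/-! ### Graded Ext -/

namespace GMod

variable {R : GAlg.{u}}

/-- A graded module is projective if it has the lifting property with respect to surjective
morphisms of graded modules. -/
def IsProjective (P : GMod.{u} R) : Prop :=
  ∀ (X Y : GMod.{u} R) (g : X →ₗ[R] Y), DegPres (g.restrictScalars ℚ) → Function.Surjective g →
    ∀ f : P →ₗ[R] Y, DegPres (f.restrictScalars ℚ) →
      ∃ h : P →ₗ[R] X, DegPres (h.restrictScalars ℚ) ∧ ∀ x, g (h x) = f x

/-- A complex `⋯ → X 1 → X 0 → N` of graded modules. -/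
structure ComplexOver (N : GMod.{u} R) where
  X : ℕ → GMod.{u} R
  d : ∀ s, X (s + 1) →ₗ[R] X s
  d_deg : ∀ s, DegPres ((d s).restrictScalars ℚ)
  d_d : ∀ s x, d s (d (s + 1) x) = 0
  ε : X 0 →ₗ[R] N
  ε_deg : DegPres (ε.restrictScalars ℚ)
  ε_d : ∀ x, ε (d 0 x) = 0

namespace ComplexOver

variable {N : GMod.{u} R}

/-- The complex is a resolution of `N` by projective graded modules. -/
def IsProjectiveResolution (Q : ComplexOver N) : Prop :=
  (∀ s, (Q.X s).IsProjective) ∧ Function.Surjective Q.ε ∧ (∀ x, Q.ε x = 0 → ∃ y, Q.d 0 y = x) ∧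
    ∀ s x, Q.d s x = 0 → ∃ y, Q.d (s + 1) y = x

/-- A chain map of complexes over `N`. -/
structure Hom (Q Q' : ComplexOver N) where
  f : ∀ s, Q.X s →ₗ[R] Q'.X s
  deg : ∀ s, DegPres ((f s).restrictScalars ℚ)
  comm : ∀ s x, f s (Q.d s x) = Q'.d s (f (s + 1) x)
  ε_comm : ∀ x, Q'.ε (f 0 x) = Q.ε x

variable (Q : ComplexOver N) (M : GMod.{u} R)

/-- The map `f ↦ f ∘ d`. -/
def δ (s : ℕ) : (Q.X s →ₗ[ℚ] M) →ₗ[ℚ] (Q.X (s + 1) →ₗ[ℚ] M) :=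
  LinearMap.lcomp ℚ M ((Q.d s).restrictScalars ℚ)

/-- The `s`-cocycles of the complex of `R`-linear maps `Q.X s → M` of degree `t`. -/
def cocycles (s : ℕ) (t : ℤ) : Submodule ℚ (Q.X s →ₗ[ℚ] M) :=
  homDeg (Q.X s) M t ⊓ LinearMap.ker (Q.δ M s)

/-- The `s`-coboundaries of the complex of `R`-linear maps `Q.X s → M` of degree `t`. -/
def coboundaries : (s : ℕ) → (t : ℤ) → Submodule ℚ (Q.X s →ₗ[ℚ] M)
  | 0, _ => ⊥
  | s + 1, t => (homDeg (Q.X s) M t).map (Q.δ M s)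

/-- The cohomology of the complex of `R`-linear maps of degree `t` from `Q` to `M`. If `Q` is a
projective resolution of `N`, this is `Ext^{s,t}_R(N, M)`. -/
abbrev Ext (s : ℕ) (t : ℤ) : Type u :=
  Q.cocycles M s t ⧸ (Q.coboundaries M s t).comap (Q.cocycles M s t).subtype

/-- The class of a cocycle in `Ext`. -/
def mkExt (s : ℕ) (t : ℤ) : Q.cocycles M s t →ₗ[ℚ] Q.Ext M s t := Submodule.mkQ _

end ComplexOver

/-- The normalised simplicial bar construction, as a complex over `N`. -/
noncomputable def barComplex (N : GMod.{u} R) : ComplexOver N where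
  X := normBar N
  d := normBd N
  d_deg := normBd_degPres N
  d_d := normBd_normBd N
  ε := normAug N
  ε_deg := normAug_degPres N
  ε_d := normAug_normBd N

end GMod

namespace DGMod

open GMod

variable {A : CDGA.{u}}

/-- `IsClassOf N k j x y` means that `x = a_1 ⊗ ⋯ ⊗ a_k ⊗ n` and `y = [a_1] ⊗ ⋯ ⊗ [a_k] ⊗ [n]` for
homogeneous cocycles `a_1, …, a_k` of `A` and `n` of `N` whose degrees add up to `j`. -/
def IsClassOf (N : DGMod.{u} A) : (k : ℕ) → ℤ → barT N.toGMod k → barT N.H k → Prop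
  | 0, j, x, y => ∃ z : LinearMap.ker N.d, (z : N) ∈ N.gr j ∧ x = (z : N) ∧ y = N.hmk z
  | k + 1, j, x, y => ∃ (i : ℤ) (a : A.cocycles) (x' : barT N.toGMod k) (y' : barT N.H k),
      (a : A) ∈ A.gr i ∧ IsClassOf N k (j - i) x' y' ∧
        x = btmul N.toGMod (a : A) x' ∧ y = btmul N.H (A.hmk a) y'

/-- `g : H(A) ⊗ (H(A)/ℚ)^{⊗ p} ⊗ H(N) → H(M)` is the map that `f` induces on cohomology, that is,
`g([a_0] ⊗ ⋯ ⊗ [a_p] ⊗ [n]) = ± [f(a_0 ⊗ ⋯ ⊗ a_p ⊗ n)]`. -/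
def Induces (N M : DGMod.{u} A) (p : ℕ) (f : bar N →ₗ[ℚ] M) (g : normBar N.H p →ₗ[ℚ] M.H) : Prop :=
  ∀ (j : ℤ) (x : barT N.toGMod (p + 1)) (y : barT N.H (p + 1)), IsClassOf N (p + 1) j x y →
    ∃ m : LinearMap.ker M.d, (m : M) = sgn (p * j) • f (barInc N p (normMk N.toGMod p x)) ∧
      g (normMk N.H p y) = M.hmk m

end DGMod

end HyperExt

/-!
The proof works with explicit complexes of rational vector spaces, where every complex contracts
onto its cohomology.

*The bar construction.* Each `B_k = A ⊗ (A/ℚ)^{⊗ k} ⊗ N` is free over `A` on a graded vector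
space, so a lift of a map from `B` along a surjective quasi-isomorphism can be built one summand
at a time, and the error in the differential can be removed because the kernel of the
quasi-isomorphism is contractible over `ℚ` (`exists_lift_normBar`, `bar_isCofibrant`). The map `x
↦ 1 ⊗ x` is a contraction to `N`, so `B → N` is a quasi-isomorphism and the normalised bar
construction over `H(A)` is a resolution by free modules (`barAug_quasiIso`,
`barComplex_isProjectiveResolution`).

*The second page.* The contractions of `A` and `N` onto their cohomology tensor together to a
contraction of `A^{⊗ k} ⊗ N` onto `H(A)^{⊗ k} ⊗ H(N)` that is compatible with normalisation
(`barContraction`). A cochain `f` in `Z_1^p` thus has a symbol, the map that it induces on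
cohomology in the `p`-th summand. It does not depend on the choice of representatives
(`symbol_normMk`), so that it is linear over `H(A)` (`symbol_mem_homDeg`), and the symbol of `d
f` is the symbol of `f` composed with the bar differential, up to sign (`symbol_homD`). Every
linear map is a symbol (`exists_symbol_eq`), and a cochain with vanishing symbol is a coboundary
modulo `F^{p+1}` (`exists_sub_homD_mem`). Hence `E_1` is the complex of maps from the normalised
bar construction of `H(N)` to `H(M)`, and `E_2` is its cohomology (`exists_E_two_equiv`). The
comparison theorem for projective resolutions gives the version for other resolutions
(`ComplexOver.Hom.exists_ext_equiv`).

*Convergence.* Let `H(N)` vanish below degree `k` and `H(M)` above degree `l`. Since `H(A)/ℚ`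
starts in degree two, the `p`-th summand of the bar construction of `H(N)` starts in degree `2 p
+ k`. So there are no maps of degree `n - p` from it to `H(M)` if `p + k + n > l`
(`homDeg_normBar_eq_bot`): in each total degree, symbols vanish in high filtration. As the
filtration of `[B, M]` is complete, successive approximation shows that every cocycle of high
filtration is the coboundary of a cochain of the same filtration (`exists_homD_eq`). The
filtration of the cohomology is therefore finite in each degree, and strong convergence follows
(`FiltCx.convergesStrongly_of_acyclic`). Finally, a cofibrant replacement of `N` lifts to `B`,
and the lift is a quasi-isomorphism between cofibrant modules, hence a homotopy equivalence
(`Hom.IsCofibrantReplacement.exists_hom_bar`).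
-/

namespace HyperExt

open scoped TensorProduct DirectSum

/-! ### Graded linear algebra over `ℚ` -/

theorem exists_factor_of_ker_le {Z X Y : Type*} [AddCommGroup Z] [Module ℚ Z]
    [AddCommGroup X] [Module ℚ X] [AddCommGroup Y] [Module ℚ Y] (a : Z →ₗ[ℚ] X) (b : Z →ₗ[ℚ] Y)
    (ha : Function.Surjective a) (h : ∀ z, a z = 0 → b z = 0) :
    ∃ f : X →ₗ[ℚ] Y, ∀ z, f (a z) = b z := by
  refine ⟨((LinearMap.ker a).liftQ b h).comp
    (a.quotKerEquivOfSurjective ha).symm.toLinearMap, fun z => ?_⟩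
  have : (a.quotKerEquivOfSurjective ha).symm (a z) = Submodule.Quotient.mk z := by
    rw [LinearEquiv.symm_apply_eq]; rfl
  rw [LinearMap.comp_apply, LinearEquiv.coe_coe, this]
  rfl

/-- Two quotients of `Z` by the same subspace are isomorphic under `Z`. All canonical isomorphisms of
the main theorem are obtained in this way, which makes their values on representatives available. -/
theorem exists_linearEquiv_of_ker_eq {Z X Y : Type*} [AddCommGroup Z] [Module ℚ Z]
    [AddCommGroup X] [Module ℚ X] [AddCommGroup Y] [Module ℚ Y] (a : Z →ₗ[ℚ] X) (b : Z →ₗ[ℚ] Y)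
    (ha : Function.Surjective a) (hb : Function.Surjective b) (h : ∀ z, a z = 0 ↔ b z = 0) :
    ∃ e : X ≃ₗ[ℚ] Y, ∀ z, e (a z) = b z := by
  have hk : LinearMap.ker a = LinearMap.ker b := Submodule.ext h
  refine ⟨(a.quotKerEquivOfSurjective ha).symm.trans ((Submodule.quotEquivOfEq _ _ hk).trans
    (b.quotKerEquivOfSurjective hb)), fun z => ?_⟩
  have : (a.quotKerEquivOfSurjective ha).symm (a z) = Submodule.Quotient.mk z := by
    rw [LinearEquiv.symm_apply_eq]; rfl
  rw [LinearEquiv.trans_apply, this]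
  rfl

section Graded

variable {V W : Type*} [AddCommGroup V] [Module ℚ V] [AddCommGroup W] [Module ℚ W]
  {gr : ℤ → Submodule ℚ V} {gr' : ℤ → Submodule ℚ W}

theorem proj_apply_map (h : DirectSum.IsInternal gr) (h' : DirectSum.IsInternal gr')
    (f : V →ₗ[ℚ] W) (k : ℤ) (hf : ∀ i, ∀ x ∈ gr i, f x ∈ gr' (i + k)) (n : ℤ) (x : V) :
    proj h' (n + k) (f x) = f (proj h n x) := by
  induction x using graded_induction h with
  | h0 => simp
  | hadd x y hx hy => simp [hx, hy]
  | hgr i x hx =>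
    by_cases hin : i = n
    · subst hin; rw [proj_same _ hx, proj_same _ (hf _ _ hx)]
    · rw [proj_ne _ hx hin, proj_ne _ (hf _ _ hx) (by omega), map_zero]

/-- A surjection of graded vector spaces has a graded section: the homogeneous part of degree zero of
any section. -/
theorem exists_graded_rightInverse (h : DirectSum.IsInternal gr) (h' : DirectSum.IsInternal gr')
    (g : V →ₗ[ℚ] W) (hg : ∀ i, ∀ x ∈ gr i, g x ∈ gr' i) (hs : Function.Surjective g) :
    ∃ s : W →ₗ[ℚ] V, (∀ i, ∀ y ∈ gr' i, s y ∈ gr i) ∧ ∀ y, g (s y) = y := by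
  obtain ⟨s, hs⟩ := g.exists_rightInverse_of_surjective (LinearMap.range_eq_top.2 hs)
  have hs : ∀ y, g (s y) = y := fun y => LinearMap.congr_fun hs y
  refine ⟨glift h' fun i => ((proj h i).comp s).comp (gr' i).subtype, fun i y hy => ?_, ?_⟩
  · rw [glift_of_mem h' _ hy]; exact proj_mem h i _
  · intro y
    induction y using graded_induction h' with
    | h0 => simp
    | hadd x y hx hy => simp [hx, hy]
    | hgr i y hy =>
      rw [glift_of_mem h' _ hy]
      change g (proj h i (s y)) = y
      have := proj_apply_map h h' g 0 (by simpa using hg) i (s y)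
      rw [← this, hs, add_zero, proj_same h' hy]

/-- A differential on a graded vector space has a graded pseudo-inverse. This is where it matters
that the ground ring is a field. -/
theorem exists_graded_pseudoInverse (h : DirectSum.IsInternal gr) (d : V →ₗ[ℚ] V)
    (hd : ∀ i, ∀ x ∈ gr i, d x ∈ gr (i + 1)) :
    ∃ s : V →ₗ[ℚ] V, (∀ i, ∀ x ∈ gr i, s x ∈ gr (i - 1)) ∧ ∀ x, d (s (d x)) = d x := by
  obtain ⟨t, ht⟩ := d.rangeRestrict.exists_rightInverse_of_surjective
    (LinearMap.range_eq_top.2 d.surjective_rangeRestrict)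
  obtain ⟨s, hs⟩ := LinearMap.exists_extend t
  have hs : ∀ x, d (s (d x)) = d x := fun x => by
    have h1 : s (d x) = t (d.rangeRestrict x) := LinearMap.congr_fun hs (d.rangeRestrict x)
    have h2 : d.rangeRestrict (t (d.rangeRestrict x)) = d.rangeRestrict x :=
      LinearMap.congr_fun ht _
    rw [h1]
    exact congrArg Subtype.val h2
  refine ⟨glift h fun i => ((proj h (i - 1)).comp s).comp (gr i).subtype, fun i y hy => ?_, ?_⟩
  · rw [glift_of_mem h _ hy]; exact proj_mem h _ _
  · intro x
    induction x using graded_induction h with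
    | h0 => simp
    | hadd x y hx hy => simp only [map_add, hx, hy]
    | hgr i x hx =>
      rw [glift_of_mem h _ (hd i x hx)]
      change d (proj h (i + 1 - 1) (s (d x))) = d x
      rw [← proj_shift h hd, hs, sub_add_cancel, proj_same h (hd i x hx)]

/-- An acyclic complex of vector spaces is contractible. -/
theorem exists_contraction_of_acyclic (h : DirectSum.IsInternal gr) (d : V →ₗ[ℚ] V)
    (hd : ∀ i, ∀ x ∈ gr i, d x ∈ gr (i + 1)) (hdd : ∀ x, d (d x) = 0)
    (hex : ∀ x, d x = 0 → ∃ y, d y = x) :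
    ∃ s : V →ₗ[ℚ] V, (∀ i, ∀ x ∈ gr i, s x ∈ gr (i - 1)) ∧ ∀ x, d (s x) + s (d x) = x := by
  obtain ⟨s, hs, hds⟩ := exists_graded_pseudoInverse h d hd
  have he : ∀ x, d (s (x - d (s x) - s (d x))) = x - d (s x) - s (d x) := by
    intro x
    obtain ⟨y, hy⟩ := hex (x - d (s x) - s (d x)) (by
      rw [map_sub, map_sub, hdd, hds]; abel)
    rw [← hy, hds]
  -- `x - d (s x) - s (d x)` is a cocycle, on which `s` inverts `d`
  refine ⟨s + s.comp (LinearMap.id - d.comp s - s.comp d), fun i x hx => ?_, fun x => ?_⟩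
  · have h1 := hs _ _ (hd i x hx)
    have h2 := hd _ _ (hs i x hx)
    rw [add_sub_cancel_right] at h1
    rw [sub_add_cancel] at h2
    exact add_mem (hs i x hx) (hs i _ (sub_mem (sub_mem hx h2) h1))
  · have h1 := he x
    simp only [LinearMap.add_apply, LinearMap.comp_apply, LinearMap.sub_apply, LinearMap.id_apply,
      map_add, hdd, hds, map_zero] at h1 ⊢
    rw [h1, sub_self, sub_zero, map_zero]
    abel

/-- A contraction of a complex `(V, d)` of vector spaces onto a graded vector space `W` with zero
differential: chain maps `ι : W → V` and `π : V → W` with `π ι = 1` and a homotopy `η` from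
`1` to `ι π`. -/
structure Contraction (gr : ℤ → Submodule ℚ V) (d : V →ₗ[ℚ] V) (gr' : ℤ → Submodule ℚ W) where
  ι : W →ₗ[ℚ] V
  π : V →ₗ[ℚ] W
  η : V →ₗ[ℚ] V
  ι_mem : ∀ i, ∀ y ∈ gr' i, ι y ∈ gr i
  π_mem : ∀ i, ∀ x ∈ gr i, π x ∈ gr' i
  η_mem : ∀ i, ∀ x ∈ gr i, η x ∈ gr (i - 1)
  d_ι : ∀ y, d (ι y) = 0
  π_d : ∀ x, π (d x) = 0
  π_ι : ∀ y, π (ι y) = y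
  homotopy : ∀ x, d (η x) + η (d x) = x - ι (π x)

/-- A complex of vector spaces contracts onto its cohomology. The cocycles are given as the image
of an injective map `c`, and the cohomology as a quotient `cls` of its source. -/
theorem exists_contraction_cohomology {C : Type*} [AddCommGroup C] [Module ℚ C]
    (h : DirectSum.IsInternal gr) (d : V →ₗ[ℚ] V)
    (hd : ∀ i, ∀ x ∈ gr i, d x ∈ gr (i + 1)) (hdd : ∀ x, d (d x) = 0)
    (c : C →ₗ[ℚ] V) (hc : Function.Injective c) (hc' : ∀ v, d v = 0 ↔ ∃ z, c z = v)
    (cls : C →ₗ[ℚ] W) (hcls : Function.Surjective cls)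
    (hcls' : ∀ z, cls z = 0 ↔ ∃ y, d y = c z) :
    ∃ r : Contraction gr d (fun i => ((gr i).comap c).map cls), ∀ z, r.π (c z) = cls z := by
  obtain ⟨s, hs, hds⟩ := exists_graded_pseudoInverse h d hd
  -- `e` kills coboundaries and maps to cocycles, and it is homotopic to the identity by `s`
  let e : V →ₗ[ℚ] V := LinearMap.id - d.comp s - s.comp d
  have e_def : ∀ x, e x = x - d (s x) - s (d x) := fun x => rfl
  have d_e : ∀ x, d (e x) = 0 := fun x => by
    rw [e_def, map_sub, map_sub, hdd, hds]; abel
  have e_d : ∀ x, e (d x) = 0 := fun x => by rw [e_def, hdd, hds, map_zero]; abel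
  have e_mem : ∀ i, ∀ x ∈ gr i, e x ∈ gr i := fun i x hx => by
    have h1 := hs _ _ (hd i x hx)
    have h2 := hd _ _ (hs i x hx)
    rw [add_sub_cancel_right] at h1
    rw [sub_add_cancel] at h2
    exact sub_mem (sub_mem hx h2) h1
  let ec : V →ₗ[ℚ] C := (LinearEquiv.ofInjective c hc).symm.toLinearMap.comp
    (e.codRestrict (LinearMap.range c) fun x => (hc' _).1 (d_e x))
  have c_ec : ∀ x, c (ec x) = e x := fun x => by
    have := (LinearEquiv.ofInjective c hc).apply_symm_apply
      ((e.codRestrict (LinearMap.range c) fun x => (hc' _).1 (d_e x)) x)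
    exact congrArg Subtype.val this
  obtain ⟨ι, ι_cls⟩ : ∃ ι : W →ₗ[ℚ] V, ∀ z, ι (cls z) = e (c z) :=
    exists_factor_of_ker_le cls (e.comp c) hcls fun z hz => by
      obtain ⟨y, hy⟩ := (hcls' z).1 hz
      rw [LinearMap.comp_apply, ← hy, e_d]
  have dc : ∀ z, d (c z) = 0 := fun z => (hc' _).2 ⟨z, rfl⟩
  have π_c : ∀ z, cls (ec (c z)) = cls z := fun z => by
    rw [← sub_eq_zero, ← map_sub, hcls']
    refine ⟨-s (c z), ?_⟩
    rw [map_sub, c_ec, e_def, dc, map_zero, map_neg, sub_zero, sub_sub_cancel_left]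
  -- `ι π = e ∘ e`, and `1 - e ∘ e = (1 - e) + (1 - e) ∘ e` is the boundary of `s + s ∘ e`
  refine ⟨⟨ι, cls.comp ec, s + s.comp e, ?_, ?_, ?_, ?_, ?_, ?_, ?_⟩, π_c⟩
  · rintro i _ ⟨z, hz, rfl⟩
    rw [ι_cls]
    exact e_mem i _ hz
  · intro i x hx
    refine ⟨ec x, ?_, rfl⟩
    change c (ec x) ∈ gr i
    rw [c_ec]
    exact e_mem i x hx
  · intro i x hx
    exact add_mem (hs i x hx) (hs i _ (e_mem i x hx))
  · intro y
    obtain ⟨z, rfl⟩ := hcls y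
    rw [ι_cls, d_e]
  · intro x
    have : ec (d x) = 0 := hc (by rw [c_ec, e_d, map_zero])
    rw [LinearMap.comp_apply, this, map_zero]
  · intro y
    obtain ⟨z, rfl⟩ := hcls y
    have : cls (ec (e (c z))) = cls z := by rw [← c_ec, π_c, π_c]
    rw [ι_cls]
    exact this
  · intro x
    have h1 : ι (cls (ec x)) = e (e x) := by rw [ι_cls, c_ec]
    rw [LinearMap.comp_apply, h1, LinearMap.add_apply, LinearMap.add_apply, LinearMap.comp_apply,
      LinearMap.comp_apply, e_d, map_zero, add_zero, map_add, e_def (e x), d_e, map_zero, e_def x]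
    abel

/-- The map `x ↦ (-1)^{n |x|} x`. -/
noncomputable def twist (h : DirectSum.IsInternal gr) (n : ℤ) : V →ₗ[ℚ] V :=
  glift h fun i => sgn (n * i) • (gr i).subtype

theorem twist_of_mem (h : DirectSum.IsInternal gr) (n : ℤ) {i : ℤ} {x : V} (hx : x ∈ gr i) :
    twist h n x = sgn (n * i) • x := by
  simp [twist, glift_of_mem h _ hx]

end Graded

/-! ### The spectral sequence of a filtered complex -/

namespace FiltCx

open CategoryTheory

variable (K : FiltCx.{u})

theorem F_le_of_le {p p' : ℤ} (h : p ≤ p') (n : ℤ) : K.F p' n ≤ K.F p n := by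
  obtain ⟨k, rfl⟩ := Int.le.dest h
  induction k with
  | zero => simp
  | succ k ih =>
    refine le_trans ?_ (ih (by omega))
    have := K.F_anti (p + k) n
    rwa [show p + (k : ℤ) + 1 = p + (k + 1 : ℕ) by push_cast; ring] at this

theorem mem_Z {r p n : ℤ} {x : K.W} : x ∈ K.Z r p n ↔ x ∈ K.F p n ∧ K.d n x ∈ K.F (p + r) (n + 1) :=
  Iff.rfl

theorem d_mem_Z {r p m n : ℤ} (hmn : m + 1 = n) {x : K.W} (hx : x ∈ K.C m)
    (h : K.d m x ∈ K.F p n) : K.d m x ∈ K.Z r p n := by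
  subst hmn
  refine K.mem_Z.2 ⟨h, ?_⟩
  rw [K.d_d m x hx]
  exact zero_mem _

theorem mkE_eq_zero {r p n : ℤ} (x : K.Z r p n) :
    K.mkE r p n x = 0 ↔
      ∃ u ∈ K.Z (r - 1) (p + 1) n, ∃ v ∈ K.Z (r - 1) (p - r + 1) (n - 1),
        u + K.d (n - 1) v = x := by
  refine (Submodule.Quotient.mk_eq_zero _).trans ?_
  change (x : K.W) ∈ _ ⊔ K.B r p n ↔ _
  rw [Submodule.mem_sup]
  constructor
  · rintro ⟨u, hu, _, ⟨v, hv, rfl⟩, h⟩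
    exact ⟨u, hu, v, hv, h⟩
  · rintro ⟨u, hu, v, hv, h⟩
    exact ⟨u, hu, _, ⟨v, hv, rfl⟩, h⟩

theorem mkE_surjective (r p n : ℤ) : Function.Surjective (K.mkE r p n) :=
  Submodule.mkQ_surjective _

theorem mkE_eq_of_sub {r p n : ℤ} {x y : K.Z r p n}
    (h : (x : K.W) - y ∈ K.Z (r - 1) (p + 1) n) : K.mkE r p n x = K.mkE r p n y := by
  rw [← sub_eq_zero, ← map_sub, mkE_eq_zero]
  exact ⟨_, h, 0, zero_mem _, by simp⟩

section

variable {κ : Type*} {c : ComplexShape κ} (P : HomologicalComplex (ModuleCat.{u} ℚ) c)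

theorem exists_cycle_of_d_eq_zero {i j : κ} (hj : c.next i = j) (x : P.X i)
    (hx : P.d i j x = 0) : ∃ z : P.cycles i, P.iCycles i z = x := by
  subst hj
  let S := P.sc i
  refine ⟨S.moduleCatCyclesIso.inv ⟨x, hx⟩, ?_⟩
  exact ConcreteCategory.congr_hom S.moduleCatCyclesIso_inv_iCycles ⟨x, hx⟩

theorem homologyπ_eq_zero_iff {i j : κ} (hi : c.prev j = i) (z : P.cycles j) :
    P.homologyπ j z = 0 ↔ ∃ y, P.d i j y = P.iCycles j z := by
  subst hi
  let S := P.sc j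
  have h1 : S.moduleCatHomologyIso.hom (S.homologyπ z)
      = Submodule.Quotient.mk (S.moduleCatCyclesIso.hom z) :=
    ConcreteCategory.congr_hom S.π_moduleCatCyclesIso_hom z
  have h2 : (S.moduleCatCyclesIso.hom z).1 = S.iCycles z :=
    ConcreteCategory.congr_hom S.moduleCatCyclesIso_hom_i z
  have h3 : S.homologyπ z = 0 ↔ S.moduleCatHomologyIso.hom (S.homologyπ z) = 0 := by
    constructor
    · intro h; rw [h, map_zero]
    · intro h
      have := congrArg S.moduleCatHomologyIso.inv h
      rwa [map_zero, Iso.hom_inv_id_apply] at this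
  refine h3.trans ?_
  rw [h1]
  refine (Submodule.Quotient.mk_eq_zero (LinearMap.range S.moduleCatToCycles)).trans ?_
  constructor
  · rintro ⟨y, hy⟩
    exact ⟨y, (congrArg Subtype.val hy).trans h2⟩
  · rintro ⟨y, hy⟩
    exact ⟨y, Subtype.ext (hy.trans h2.symm)⟩

end

/-- The differential of the page `E_r`, `[x] ↦ [d x]`. The target indices are variables, so that any
expression for them may be used without a cast. -/
noncomputable def dE (r p n p' n' : ℤ) (hp : p + r = p') (hn : n + 1 = n') :
    K.E r p n →ₗ[ℚ] K.E r p' n' :=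
  Submodule.mapQ _ _ ((K.d n).restrict (p := K.Z r p n) (q := K.Z r p' n')
    fun x hx => K.d_mem_Z hn (K.F_le _ _ hx.1) (hp ▸ hn ▸ hx.2)) (by
    intro x hx
    obtain ⟨u, hu, v, hv, h⟩ := (K.mkE_eq_zero x).1 ((Submodule.Quotient.mk_eq_zero _).2 hx)
    subst hp hn
    have h1 : K.d n x ∈ K.Z r (p + r) (n + 1) := K.d_mem_Z rfl (K.F_le _ _ x.2.1) x.2.2
    have h2 : K.mkE r (p + r) (n + 1) ⟨_, h1⟩ = 0 := by
      rw [mkE_eq_zero]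
      refine ⟨0, zero_mem _, u, ?_, ?_⟩
      · rw [show p + r - r + 1 = p + 1 by ring, show n + 1 - 1 = n by ring]; exact hu
      · rw [show n + 1 - 1 = n by ring]
        have h0 : K.d n (K.d (n - 1) v) = 0 := by
          have := K.d_d (n - 1) v (K.F_le _ _ hv.1)
          rwa [sub_add_cancel] at this
        change 0 + K.d n u = K.d n x
        rw [← h, map_add, h0, zero_add, add_zero]
    exact Submodule.mem_comap.2 ((Submodule.Quotient.mk_eq_zero _).1 h2))

theorem dE_mkE (r p n p' n' : ℤ) (hp : p + r = p') (hn : n + 1 = n') (x : K.Z r p n)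
    (y : K.Z r p' n') (h : (y : K.W) = K.d n x) :
    K.dE r p n p' n' hp hn (K.mkE r p n x) = K.mkE r p' n' y :=
  congrArg (K.mkE r p' n') (Subtype.ext h.symm)

theorem dE_dE (r p n p' n' p'' n'' : ℤ) (hp : p + r = p') (hn : n + 1 = n')
    (hp' : p' + r = p'') (hn' : n' + 1 = n'') (x : K.E r p n) :
    K.dE r p' n' p'' n'' hp' hn' (K.dE r p n p' n' hp hn x) = 0 := by
  obtain ⟨x, rfl⟩ := K.mkE_surjective r p n x
  subst hp hn hp' hn'
  have h1 : K.d n x ∈ K.Z r (p + r) (n + 1) :=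
    K.d_mem_Z rfl (K.F_le _ _ x.2.1) x.2.2
  rw [K.dE_mkE r p n _ _ rfl rfl x ⟨_, h1⟩ rfl, K.dE_mkE r _ _ _ _ rfl rfl ⟨_, h1⟩ 0, map_zero]
  exact (K.d_d n x (K.F_le _ _ x.2.1)).symm

open Classical in
/-- The page `E_r` of the spectral sequence of a filtered complex. -/
noncomputable def pageE (r : ℤ) :
    HomologicalComplex (ModuleCat.{u} ℚ) (ComplexShape.up' (⟨r, 1 - r⟩ : ℤ × ℤ)) where
  X pq := ModuleCat.of ℚ (K.E r pq.1 (pq.1 + pq.2))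
  d a b := if h : a.1 + r = b.1 ∧ a.1 + a.2 + 1 = b.1 + b.2 then
    ModuleCat.ofHom (K.dE r a.1 (a.1 + a.2) b.1 (b.1 + b.2) h.1 h.2) else 0
  shape a b h := by
    rw [dif_neg]
    rintro ⟨h1, h2⟩
    refine h ?_
    change a + (r, 1 - r) = b
    ext
    · exact h1
    · change a.2 + (1 - r) = b.2
      omega
  d_comp_d' a b c _ _ := by
    split_ifs with h1 h2
    · refine ModuleCat.hom_ext (LinearMap.ext fun x => ?_)
      exact K.dE_dE _ _ _ _ _ _ _ h1.1 h1.2 h2.1 h2.2 x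
    all_goals simp

theorem pageE_d (r : ℤ) (a b : ℤ × ℤ) (h1 : a.1 + r = b.1) (h2 : a.1 + a.2 + 1 = b.1 + b.2) :
    (K.pageE r).d a b = ModuleCat.ofHom (K.dE r a.1 (a.1 + a.2) b.1 (b.1 + b.2) h1 h2) :=
  dif_pos ⟨h1, h2⟩

/-- Every `d_r`-cycle of `E_r` is represented by an element of `Z_{r+1}`. -/
theorem exists_sub_mem_of_dE_eq_zero {r p n p' n' : ℤ} {hp : p + r = p'} {hn : n + 1 = n'}
    (x : K.Z r p n) (h : K.dE r p n p' n' hp hn (K.mkE r p n x) = 0) :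
    ∃ y ∈ K.Z (r + 1) p n, (x : K.W) - y ∈ K.Z (r - 1) (p + 1) n := by
  subst hp hn
  have h1 : K.d n x ∈ K.Z r (p + r) (n + 1) :=
    K.d_mem_Z rfl (K.F_le _ _ x.2.1) x.2.2
  rw [K.dE_mkE r p n _ _ rfl rfl x ⟨_, h1⟩ rfl, mkE_eq_zero] at h
  obtain ⟨u, hu, v, hv, h⟩ := h
  rw [show p + r - r + 1 = p + 1 by ring, show n + 1 - 1 = n by ring] at hv
  rw [show n + 1 - 1 = n by ring] at h
  have h : u + K.d n v = K.d n x := h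
  refine ⟨x - v, K.mem_Z.2 ⟨sub_mem x.2.1 (K.F_anti _ _ hv.1), ?_⟩, by simpa using hv⟩
  rw [map_sub, ← h, add_sub_cancel_right, ← add_assoc]
  exact hu.1

/-- An element of `Z_{r+1}` represents a `d_r`-boundary in `E_r` exactly if its class in `E_{r+1}`
vanishes. -/
theorem exists_dE_eq_mkE_iff {r p n p' n' : ℤ} {hp : p' + r = p} {hn : n' + 1 = n}
    (x : K.Z r p n) (x' : K.Z (r + 1) p n) (hx : (x : K.W) = x') :
    (∃ y, K.dE r p' n' p n hp hn y = K.mkE r p n x) ↔ K.mkE (r + 1) p n x' = 0 := by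
  obtain rfl : p' = p - r := by omega
  obtain rfl : n' = n - 1 := by omega
  rw [mkE_eq_zero, show r + 1 - 1 = r by ring, show p - (r + 1) + 1 = p - r by ring]
  constructor
  · rintro ⟨y, hy⟩
    obtain ⟨y, rfl⟩ := K.mkE_surjective _ _ _ y
    have hdy : K.d (n - 1) y ∈ K.Z r p n := by
      have := (K.mem_Z.1 y.2).2
      rw [sub_add_cancel, sub_add_cancel] at this
      exact K.d_mem_Z (sub_add_cancel n 1) (K.F_le _ _ y.2.1) this
    rw [K.dE_mkE r _ _ _ _ _ _ y ⟨_, hdy⟩ rfl, eq_comm, ← sub_eq_zero, ← map_sub,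
      mkE_eq_zero] at hy
    obtain ⟨u, hu, v, hv, h⟩ := hy
    have h : u + K.d (n - 1) v = x - K.d (n - 1) y := h
    refine ⟨u, K.mem_Z.2 ⟨hu.1, ?_⟩, y + v, K.mem_Z.2 ⟨add_mem y.2.1 ?_, ?_⟩, ?_⟩
    · have h0 : K.d n u = K.d n x := by
        have h1 := K.d_d (n - 1) v (K.F_le _ _ hv.1)
        have h2 := K.d_d (n - 1) y (K.F_le _ _ y.2.1)
        rw [sub_add_cancel] at h1 h2
        have := congrArg (K.d n) h
        rwa [map_add, map_sub, h1, h2, add_zero, sub_zero] at this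
      rw [h0, hx, show p + 1 + r = p + (r + 1) by ring]
      exact x'.2.2
    · exact K.F_anti _ _ hv.1
    · rw [map_add]
      refine add_mem y.2.2 ?_
      have := (K.mem_Z.1 hv).2
      rwa [show p - r + 1 + (r - 1) = p - r + r by ring] at this
    · rw [map_add, ← hx]
      have : (x : K.W) = u + K.d (n - 1) v + K.d (n - 1) y := by rw [h]; abel
      rw [this]
      abel
  · rintro ⟨u, hu, v, hv, h⟩
    refine ⟨K.mkE r _ _ ⟨v, hv⟩, ?_⟩
    have hdv : K.d (n - 1) v ∈ K.Z r p n := by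
      have := (K.mem_Z.1 hv).2
      rw [sub_add_cancel, sub_add_cancel] at this
      exact K.d_mem_Z (sub_add_cancel n 1) (K.F_le _ _ hv.1) this
    rw [K.dE_mkE r _ _ _ _ _ _ ⟨v, hv⟩ ⟨_, hdv⟩ rfl, eq_comm]
    refine K.mkE_eq_of_sub ?_
    change (x : K.W) - K.d (n - 1) v ∈ _
    rw [hx, ← h, add_sub_cancel_right]
    exact ⟨hu.1, K.F_le_of_le (by omega) _ hu.2⟩

/-- The isomorphism `H(E_r) ≅ E_{r+1}`, which is characterised by its values on elements of `Z_{r+1}`. -/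
theorem exists_pageE_homology_equiv (r : ℤ) (pq : ℤ × ℤ) :
    ∃ e : (K.pageE r).homology pq ≃ₗ[ℚ] K.E (r + 1) pq.1 (pq.1 + pq.2),
      ∀ (z : (K.pageE r).cycles pq) (f : K.Z r pq.1 (pq.1 + pq.2))
        (f' : K.Z (r + 1) pq.1 (pq.1 + pq.2)),
        (K.pageE r).iCycles pq z = K.mkE _ _ _ f → (f : K.W) = f' →
          e ((K.pageE r).homologyπ pq z) = K.mkE _ _ _ f' := by
  obtain ⟨p, q⟩ := pq
  let P := K.pageE r
  have hle : K.Z (r + 1) p (p + q) ≤ K.Z r p (p + q) := fun x hx =>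
    ⟨hx.1, K.F_le_of_le (by omega) _ hx.2⟩
  -- pairs of an element of `Z_{r+1}` and a cycle of the page `E_r` that it represents
  let T : Submodule ℚ (K.Z (r + 1) p (p + q) × P.cycles (p, q)) :=
    LinearMap.eqLocus
      (((K.mkE r p (p + q)).comp (Submodule.inclusion hle)).comp (LinearMap.fst ℚ _ _))
      ((P.iCycles (p, q)).hom.comp (LinearMap.snd ℚ _ _))
  let a : T →ₗ[ℚ] P.homology (p, q) :=
    ((P.homologyπ (p, q)).hom.comp (LinearMap.snd ℚ _ _)).comp T.subtype
  let b : T →ₗ[ℚ] K.E (r + 1) p (p + q) :=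
    ((K.mkE (r + 1) p (p + q)).comp (LinearMap.fst ℚ _ _)).comp T.subtype
  have hnext : (ComplexShape.up' (⟨r, 1 - r⟩ : ℤ × ℤ)).next (p, q) = (p + r, q + (1 - r)) :=
    ComplexShape.next_eq' _ rfl
  have hprev : (ComplexShape.up' (⟨r, 1 - r⟩ : ℤ × ℤ)).prev (p, q) = (p - r, q - (1 - r)) :=
    ComplexShape.prev_eq' _ (by
      change ((p - r + r, q - (1 - r) + (1 - r)) : ℤ × ℤ) = _
      simp)
  have hT : ∀ t : T, K.mkE r p (p + q) ⟨t.1.1, hle t.1.1.2⟩ = P.iCycles (p, q) t.1.2 :=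
    fun t => t.2
  have hd : P.d (p, q) (p + r, q + (1 - r)) = _ :=
    K.pageE_d r (p, q) (p + r, q + (1 - r)) rfl (by simp only; ring)
  have hd' : P.d (p - r, q - (1 - r)) (p, q) = _ :=
    K.pageE_d r (p - r, q - (1 - r)) (p, q) (by simp) (by simp only; ring)
  have ha : Function.Surjective a := by
    intro c
    obtain ⟨c, rfl⟩ := (ModuleCat.epi_iff_surjective (P.homologyπ (p, q))).1 inferInstance c
    obtain ⟨x, hx⟩ := K.mkE_surjective r p (p + q) (P.iCycles (p, q) c)
    have h0 : P.d (p, q) (p + r, q + (1 - r)) (K.mkE r p (p + q) x) = 0 := by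
      rw [hx, ← ConcreteCategory.comp_apply, HomologicalComplex.iCycles_d]
      rfl
    rw [hd] at h0
    obtain ⟨y, hy, hxy⟩ := K.exists_sub_mem_of_dE_eq_zero (hp := rfl)
      (hn := by simp only; ring) x h0
    exact ⟨⟨(⟨y, hy⟩, c), (K.mkE_eq_of_sub (y := ⟨y, hle hy⟩) hxy).symm.trans hx⟩, rfl⟩
  have hb : Function.Surjective b := by
    intro x
    obtain ⟨x, rfl⟩ := K.mkE_surjective _ _ _ x
    have h0 : P.d (p, q) (p + r, q + (1 - r)) (K.mkE r p (p + q) ⟨x, hle x.2⟩) = 0 := by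
      rw [hd]
      have h2 := (K.mem_Z.1 x.2).2
      have h1 : K.d (p + q) x ∈ K.Z r (p + r) (p + r + (q + (1 - r))) :=
        K.d_mem_Z (by ring) (K.F_le _ _ x.2.1) (by
          have := K.F_le_of_le (show p + r ≤ p + (r + 1) by omega) _ h2
          rwa [show p + q + 1 = p + r + (q + (1 - r)) by ring] at this)
      refine (K.dE_mkE r p (p + q) (p + r) (p + r + (q + (1 - r))) rfl (by ring) ⟨x, hle x.2⟩
        ⟨_, h1⟩ rfl).trans ((K.mkE_eq_zero _).2 ?_)
      refine ⟨K.d (p + q) x, K.d_mem_Z (by ring) (K.F_le _ _ x.2.1) ?_, 0, zero_mem _, ?_⟩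
      · rwa [← add_assoc, show p + q + 1 = p + r + (q + (1 - r)) by ring] at h2
      · rw [map_zero, add_zero]
    obtain ⟨c, hc⟩ := exists_cycle_of_d_eq_zero P hnext _ h0
    exact ⟨⟨(x, c), hc.symm⟩, rfl⟩
  have hab : ∀ t, a t = 0 ↔ b t = 0 := by
    intro t
    refine (homologyπ_eq_zero_iff P hprev t.1.2).trans ?_
    rw [← hT t, hd']
    exact K.exists_dE_eq_mkE_iff (hp := sub_add_cancel p r) (hn := by simp only; ring) _ t.1.1 rfl
  obtain ⟨e, he⟩ := exists_linearEquiv_of_ker_eq a b ha hb hab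
  refine ⟨e, fun z f f' hz hf => he ⟨(f', z), ?_⟩⟩
  exact (congrArg (K.mkE r p (p + q)) (Subtype.ext hf.symm)).trans hz.symm

/-- The spectral sequence of a filtered complex. -/
noncomputable def spectralSequence : CohomologicalSpectralSequence (ModuleCat.{u} ℚ) 1 where
  page r _ := K.pageE r
  iso r r' pq hrr' hr := by
    subst hrr'
    exact (K.exists_pageE_homology_equiv r pq).choose.toModuleIso

/-- The terms of the spectral sequence of a filtered complex are the quotients `K.E`. -/
noncomputable def spectralSequenceIdentification : K.Identification K.spectralSequence where
  e r _ p q := LinearEquiv.refl ℚ (K.E r p (p + q))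
  d_comm r hr p q x f g hx hg := by
    have hd : (K.pageE r).d (p, q) (p + r, q + (1 - r)) = _ :=
      K.pageE_d r (p, q) (p + r, q + (1 - r)) rfl (by simp only; ring)
    change (K.pageE r).d (p, q) (p + r, q + (1 - r)) x = _
    rw [hd, show x = K.mkE r p (p + q) f from hx]
    exact K.dE_mkE r p (p + q) (p + r) _ rfl (by ring) f g hg
  iso_comm r hr p q z f f' hz hf :=
    (K.exists_pageE_homology_equiv r (p, q)).choose_spec z f f' hz hf

end FiltCx

/-! ### Strong convergence -/

namespace Cx

variable (K : Cx.{u})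

theorem cls_surjective (n : ℤ) : Function.Surjective (K.cls n) := Submodule.mkQ_surjective _

theorem cls_eq_zero {n : ℤ} (z : K.cocycles n) :
    K.cls n z = 0 ↔ ∃ v ∈ K.C (n - 1), K.d (n - 1) v = z :=
  Submodule.Quotient.mk_eq_zero _

end Cx

namespace FiltCx

variable (K : FiltCx.{u})

section

variable {n : ℤ} {V : Type u} [AddCommGroup V] [Module ℚ V] (α : K.H n ≃ₗ[ℚ] V)

theorem mem_fil {p : ℤ} {v : V} :
    v ∈ K.fil n α p ↔ ∃ z : K.cocycles n, (z : K.W) ∈ K.F p n ∧ α (K.toCx.cls n z) = v := by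
  constructor
  · rintro ⟨_, ⟨z, hz, rfl⟩, rfl⟩
    exact ⟨z, hz, rfl⟩
  · rintro ⟨z, hz, rfl⟩
    exact ⟨_, ⟨z, hz, rfl⟩, rfl⟩

theorem fil_le_of_le {p p' : ℤ} (h : p ≤ p') : K.fil n α p' ≤ K.fil n α p := by
  intro v hv
  obtain ⟨z, hz, rfl⟩ := (K.mem_fil α).1 hv
  exact (K.mem_fil α).2 ⟨z, K.F_le_of_le h n hz, rfl⟩

end

/-- A filtration that is everything in non-positive filtration degrees, and such that in each
degree the subcomplexes of high filtration have no cohomology, gives a strongly convergent spectral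
sequence. -/
theorem convergesStrongly_of_acyclic (h0 : ∀ p ≤ 0, ∀ n, K.C n ≤ K.F p n)
    (h1 : ∀ n, ∃ p₀ : ℤ, ∀ p > p₀, ∀ x ∈ K.F p n, K.d n x = 0 →
      ∃ v ∈ K.F p (n - 1), K.d (n - 1) v = x)
    (n : ℤ) {V : Type u} [AddCommGroup V] [Module ℚ V] (α : K.H n ≃ₗ[ℚ] V) :
    K.ConvergesStrongly n α := by
  obtain ⟨p₀, hp₀⟩ := h1 n
  have hbot : ∀ p > p₀, K.fil n α p = ⊥ := by
    intro p hp
    rw [eq_bot_iff]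
    intro v hv
    obtain ⟨z, hz, rfl⟩ := (K.mem_fil α).1 hv
    obtain ⟨v, hv, hvz⟩ := hp₀ p hp z hz z.2.2
    rw [Submodule.mem_bot, (K.toCx.cls_eq_zero z).2 ⟨v, K.F_le _ _ hv, hvz⟩, map_zero]
  refine ⟨?_, ?_, ?_, ?_⟩
  · rw [eq_top_iff]
    intro v _
    refine Submodule.mem_iSup_of_mem 0 ((K.mem_fil α).2 ?_)
    obtain ⟨z, hz⟩ := K.toCx.cls_surjective n (α.symm v)
    exact ⟨z, h0 0 le_rfl n z.2.1, by rw [hz, LinearEquiv.apply_symm_apply]⟩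
  · rw [eq_bot_iff, ← hbot (p₀ + 1) (by omega)]
    exact iInf_le _ _
  · intro x hx
    have hk : ∀ p (k : ℕ), x (p + k) - x p ∈ K.fil n α p := by
      intro p k
      induction k with
      | zero => simp
      | succ k ih =>
        have := add_mem (K.fil_le_of_le α (show p ≤ p + k by omega) (hx (p + k))) ih
        rwa [sub_add_sub_cancel, show p + (k : ℤ) + 1 = p + (k + 1 : ℕ) by push_cast; ring] at this
    refine ⟨x (p₀ + 1), fun p => ?_⟩
    rcases le_total p (p₀ + 1) with hp | hp
    · obtain ⟨k, hk'⟩ := Int.le.dest hp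
      rw [← hk']
      exact hk p k
    · obtain ⟨k, rfl⟩ := Int.le.dest hp
      have := hk (p₀ + 1) k
      rw [hbot _ (by omega), Submodule.mem_bot, sub_eq_zero] at this
      rw [this, sub_self]
      exact zero_mem _
  · -- both graded pieces are quotients of the space of cocycles in `F^p`
    intro p
    let T : Submodule ℚ (K.cocycles n) := (K.F p n).comap (K.cocycles n).subtype
    have hZ : ∀ z ∈ T, (z : K.W) ∈ K.ZInf p n := by
      intro z hz
      refine Submodule.mem_iInf _ |>.2 fun r => Submodule.mem_sup_left (K.mem_Z.2 ⟨hz, ?_⟩)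
      rw [show K.d n z = 0 from z.2.2]
      exact zero_mem _
    have hF : K.F (p + 1) n ≤ K.BInf p n := le_trans le_sup_right
      (le_iSup (fun r : ℕ => K.B r p n ⊔ K.F (p + 1) n) 0)
    let a : T →ₗ[ℚ] K.fil n α p ⧸ (K.fil n α (p + 1)).comap (K.fil n α p).subtype :=
      (Submodule.mkQ _).comp ((α.toLinearMap.comp ((K.toCx.cls n).comp T.subtype)).codRestrict
        (K.fil n α p) fun z => (K.mem_fil α).2 ⟨z.1, z.2, rfl⟩)
    let b : T →ₗ[ℚ] K.EInf p n := (K.mkEInf p n).comp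
      (((K.cocycles n).subtype.comp T.subtype).codRestrict (K.ZInf p n) fun z => hZ z.1 z.2)
    have ha : Function.Surjective a := by
      intro v
      obtain ⟨⟨v, hv⟩, rfl⟩ := Submodule.mkQ_surjective _ v
      obtain ⟨z, hz, rfl⟩ := (K.mem_fil α).1 hv
      exact ⟨⟨z, hz⟩, rfl⟩
    have hb : Function.Surjective b := by
      intro w
      obtain ⟨⟨w, hw⟩, rfl⟩ := Submodule.mkQ_surjective _ w
      obtain ⟨p₁, hp₁⟩ := h1 (n + 1)
      let r : ℕ := (p₁ - p).toNat + 1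
      have hr : p₁ < p + r := by simp only [r]; push_cast; omega
      obtain ⟨x, hx, u, hu, rfl⟩ := Submodule.mem_sup.1 ((Submodule.mem_iInf _).1 hw r)
      -- `d x` has high filtration, so it is the coboundary of an element `v` of high filtration
      obtain ⟨v, hv, hvx⟩ := hp₁ (p + r) hr (K.d n x) hx.2 (K.d_d n x (K.F_le _ _ hx.1))
      rw [add_sub_cancel_right] at hv hvx
      have hv' : v ∈ K.F (p + 1) n := K.F_le_of_le (by simp only [r]; push_cast; omega) n hv
      have hz : x - v ∈ K.F p n := sub_mem hx.1 (K.F_anti _ _ hv')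
      refine ⟨⟨⟨x - v, K.F_le _ _ hz, ?_⟩, hz⟩, ?_⟩
      · change K.d n (x - v) = 0
        rw [map_sub, hvx, sub_self]
      · refine (Submodule.Quotient.eq _).2 (hF ?_)
        change x - v - (x + u) ∈ K.F (p + 1) n
        rw [show x - v - (x + u) = -(v + u) by abel]
        exact neg_mem (add_mem hv' hu)
    have hab : ∀ t, a t = 0 ↔ b t = 0 := by
      rintro ⟨z, hz⟩
      have h1 : a ⟨z, hz⟩ = 0 ↔ α (K.toCx.cls n z) ∈ K.fil n α (p + 1) :=
        Submodule.Quotient.mk_eq_zero _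
      have h2 : b ⟨z, hz⟩ = 0 ↔ (z : K.W) ∈ K.BInf p n := Submodule.Quotient.mk_eq_zero _
      rw [h1, h2, mem_fil]
      constructor
      · rintro ⟨z', hz', h⟩
        have h := α.injective h
        rw [eq_comm, ← sub_eq_zero, ← map_sub, Cx.cls_eq_zero] at h
        obtain ⟨v, hv, hvz⟩ := h
        have hvz : K.d (n - 1) v = z - z' := hvz
        have e : (z : K.W) = K.d (n - 1) v + z' := by rw [hvz]; abel
        rw [e]
        -- with `r > p`, the element `v` lies in `F^{p-r+1}`, which is the whole complex
        let r : ℕ := (p + 1).toNat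
        refine Submodule.mem_iSup_of_mem r (add_mem (Submodule.mem_sup_left ⟨v, K.mem_Z.2 ⟨?_, ?_⟩, rfl⟩)
          (Submodule.mem_sup_right hz'))
        · exact h0 _ (by simp only [r]; omega) _ hv
        · rw [hvz, show p - (r : ℤ) + 1 + (r - 1) = p by ring, sub_add_cancel]
          exact sub_mem hz (K.F_anti _ _ hz')
      · intro h
        have hle : K.BInf p n ≤ (K.C (n - 1)).map (K.d (n - 1)) ⊔ K.F (p + 1) n :=
          iSup_le fun r => sup_le_sup_right
            (Submodule.map_mono (le_trans inf_le_left (K.F_le _ _))) _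
        obtain ⟨_, ⟨v, hv, rfl⟩, u, hu, h⟩ := Submodule.mem_sup.1 (hle h)
        have hd : K.d n (K.d (n - 1) v) = 0 := by
          have := K.d_d (n - 1) v hv
          rwa [sub_add_cancel] at this
        have hu' : K.d n u = 0 := by
          have := congrArg (K.d n) h
          rwa [map_add, hd, zero_add, show K.d n z = 0 from z.2.2] at this
        refine ⟨⟨u, K.F_le _ _ hu, hu'⟩, hu, congrArg α ?_⟩
        rw [eq_comm, ← sub_eq_zero, ← map_sub, Cx.cls_eq_zero]
        refine ⟨v, hv, ?_⟩
        change _ = (z : K.W) - u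
        rw [← h, add_sub_cancel_right]
    obtain ⟨e, he⟩ := exists_linearEquiv_of_ker_eq a b ha hb hab
    refine ⟨e, fun z v w hz hv hw => ?_⟩
    have h1 : a ⟨z, hz⟩ = Submodule.Quotient.mk v :=
      congrArg Submodule.Quotient.mk (Subtype.ext hv.symm)
    have h2 : b ⟨z, hz⟩ = K.mkEInf p n w := congrArg (K.mkEInf p n) (Subtype.ext hw.symm)
    rw [← h1, he, h2]

end FiltCx

/-! ### The normalised bar construction as a free resolution -/

theorem GAlg.twist_mul (R : GAlg.{u}) (n : ℤ) (a b : R) :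
    twist R.internal n (a * b) = twist R.internal n a * twist R.internal n b := by
  induction a using graded_induction R.internal with
  | h0 => simp
  | hadd x y hx hy => simp only [add_mul, map_add, hx, hy]
  | hgr i a ha =>
    induction b using graded_induction R.internal with
    | h0 => simp
    | hadd x y hx hy => simp only [mul_add, map_add, hx, hy]
    | hgr j b hb =>
      rw [twist_of_mem _ _ ha, twist_of_mem _ _ hb, twist_of_mem _ _ (R.mul_mem ha hb), mul_add,
        sgn_add, smul_mul_smul_comm]

theorem twist_zero {V : Type*} [AddCommGroup V] [Module ℚ V] {gr : ℤ → Submodule ℚ V}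
    (h : DirectSum.IsInternal gr) (x : V) : twist h 0 x = x := by
  induction x using graded_induction h with
  | h0 => simp
  | hadd x y hx hy => simp only [map_add, hx, hy]
  | hgr i x hx => rw [twist_of_mem h _ hx, zero_mul, sgn_zero, one_smul]

namespace GMod

variable {R : GAlg.{u}} (N : GMod.{u} R)

theorem normBar_induction {k : ℕ} {P : normBar N k → Prop} (h0 : P 0)
    (hadd : ∀ x y, P x → P y → P (x + y))
    (h : ∀ i, ∀ a ∈ R.gr i, ∀ v, P (normMk N k (btmul N a v))) (x : normBar N k) : P x := by
  obtain ⟨x, rfl⟩ := normMk_surjective N k x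
  refine bar_induction' N (P := fun x => P (normMk N k x)) ?_ (fun x y hx hy => ?_) h x
  · rw [map_zero]; exact h0
  · rw [map_add]; exact hadd _ _ hx hy

theorem normMk_btmul {k : ℕ} (a : R) (v : barT N k) :
    normMk N k (btmul N a v) = a • normMk N k (btmul N 1 v) := by
  rw [← map_smul, smul_one_btmul]

theorem normMk_one_of_mem_insSpan {k : ℕ} {v : barT N k} (hv : v ∈ insSpan N k) :
    normMk N k (btmul N 1 v) = 0 :=
  (normMk_eq_zero N k).2 (btmul_mem_degenerate N k 1 v hv)

theorem normMk_one_mem {k : ℕ} {j : ℤ} {v : barT N k} (hv : v ∈ (barT N k).gr j) :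
    normMk N k (btmul N 1 v) ∈ (normBar N k).gr j := by
  have := btmul_mem N R.one_mem hv
  rw [zero_add] at this
  exact normMk_degPres N k j _ this

/-- The map `v ↦ 1 ⊗ v` from `R^{⊗ k} ⊗ N` to the normalised bar construction. -/
noncomputable def normOne (k : ℕ) : barT N k →ₗ[ℚ] normBar N k :=
  ((normMk N k).restrictScalars ℚ).comp (bunit N k)

theorem normOne_apply (k : ℕ) (v : barT N k) : normOne N k v = normMk N k (btmul N 1 v) := rfl

variable {N} {X : GMod.{u} R}

/-- The map `a ⊗ v ↦ (-1)^{n |a|} a φ(v)` on `R ⊗ R^{⊗ k} ⊗ N`. -/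
noncomputable def barExt (n : ℤ) {k : ℕ} (φ : barT N k →ₗ[ℚ] X) : barT N (k + 1) →ₗ[ℚ] X :=
  (TensorProduct.lift (((Algebra.lsmul ℚ ℚ X).toLinearMap.comp (twist R.internal n)).compl₂ φ) :)

theorem barExt_btmul (n : ℤ) {k : ℕ} (φ : barT N k →ₗ[ℚ] X) (a : R) (v : barT N k) :
    barExt n φ (btmul N a v) = twist R.internal n a • φ v := rfl

theorem barExt_smul (n : ℤ) {k : ℕ} (φ : barT N k →ₗ[ℚ] X) (a : R) (x : barT N (k + 1)) :
    barExt n φ (a • x) = twist R.internal n a • barExt n φ x := by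
  refine bar_induction N (P := fun x => barExt n φ (a • x) = twist R.internal n a • barExt n φ x)
    (by simp) (fun x y hx hy => by simp only [smul_add, map_add, hx, hy]) (fun b v => ?_) x
  rw [smul_btmul, barExt_btmul, barExt_btmul, GAlg.twist_mul, mul_smul]

theorem barExt_degenerate (n : ℤ) {k : ℕ} (φ : barT N k →ₗ[ℚ] X)
    (hφ : ∀ w ∈ insSpan N k, φ w = 0) : ∀ x ∈ degenerate N k, barExt n φ x = 0 :=
  degenerate_induction N (map_zero _) (fun x y hx hy => by rw [map_add, hx, hy, add_zero])
    fun a y hy => by rw [barExt_btmul, hφ y hy, smul_zero]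

/-- The extension of a `ℚ`-linear map `φ` from `R^{⊗ k} ⊗ N` to `X`, which vanishes on the elements
with a factor `1`, to the map `a ⊗ v ↦ (-1)^{n |a|} a φ(v)` on the normalised bar construction. -/
noncomputable def normExt (n : ℤ) {k : ℕ} (φ : barT N k →ₗ[ℚ] X)
    (hφ : ∀ w ∈ insSpan N k, φ w = 0) : normBar N k →ₗ[ℚ] X :=
  (((degenerate N k).restrictScalars ℚ).liftQ (barExt n φ) (barExt_degenerate n φ hφ) :)

section

variable (n : ℤ) {k : ℕ} (φ : barT N k →ₗ[ℚ] X) (hφ : ∀ w ∈ insSpan N k, φ w = 0)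

theorem normExt_mk (x : barT N (k + 1)) : normExt n φ hφ (normMk N k x) = barExt n φ x := rfl

theorem normExt_smul (a : R) (x : normBar N k) :
    normExt n φ hφ (a • x) = twist R.internal n a • normExt n φ hφ x := by
  obtain ⟨x, rfl⟩ := normMk_surjective N k x
  rw [← map_smul, normExt_mk, normExt_mk, barExt_smul]

theorem normExt_one (v : barT N k) : normExt n φ hφ (normMk N k (btmul N 1 v)) = φ v := by
  rw [normExt_mk, barExt_btmul, twist_of_mem _ _ R.one_mem, mul_zero, sgn_zero, one_smul, one_smul]

theorem normExt_mem {e : ℤ} (h : ∀ j, ∀ v ∈ (barT N k).gr j, φ v ∈ X.gr (j + e)) (j : ℤ) :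
    ∀ x ∈ (normBar N k).gr j, normExt n φ hφ x ∈ X.gr (j + e) := by
  intro x hx
  obtain ⟨y, hy, rfl⟩ := exists_of_mem_normBar_gr N hx
  refine bar_gr_le N (S := (X.gr (j + e)).comap (barExt n φ)) ?_ hy
  rintro i j rfl a ha v hv
  change barExt n φ (btmul N a v) ∈ X.gr (i + j + e)
  rw [barExt_btmul, twist_of_mem _ _ ha, smul_assoc, add_assoc]
  exact Submodule.smul_mem _ _ (X.smul_mem ha (h j v hv))

/-- The `R`-linear extension `a ⊗ v ↦ a φ(v)`, which is `normExt 0`. -/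
noncomputable def normLin : normBar N k →ₗ[R] X where
  toFun := normExt 0 φ hφ
  map_add' := map_add _
  map_smul' a x := by rw [normExt_smul, twist_zero]; rfl

theorem normLin_one (v : barT N k) : normLin φ hφ (normMk N k (btmul N 1 v)) = φ v :=
  normExt_one 0 φ hφ v

theorem normLin_mem {e : ℤ} (h : ∀ j, ∀ v ∈ (barT N k).gr j, φ v ∈ X.gr (j + e)) (j : ℤ) :
    ∀ x ∈ (normBar N k).gr j, normLin φ hφ x ∈ X.gr (j + e) :=
  normExt_mem 0 φ hφ h j

end

/-- Maps out of the normalised bar construction that are linear up to a sign are determined by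
their values on the elements `1 ⊗ v`. -/
theorem homDeg_normBar_ext {k : ℕ} {n : ℤ} {f g : normBar N k →ₗ[ℚ] X}
    (hf : f ∈ homDeg (normBar N k) X n) (hg : g ∈ homDeg (normBar N k) X n)
    (h : ∀ j, ∀ v ∈ (barT N k).gr j,
      f (normMk N k (btmul N 1 v)) = g (normMk N k (btmul N 1 v))) : f = g := by
  have h : (f.comp (normOne N k)) = g.comp (normOne N k) := ext_graded _ h
  refine LinearMap.ext fun x => ?_
  refine normBar_induction N (P := fun x => f x = g x) (by simp)
    (fun x y hx hy => by simp only [map_add, hx, hy]) (fun i a ha v => ?_) x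
  rw [normMk_btmul, hf.2 i a ha, hg.2 i a ha]
  exact congrArg _ (congrArg _ (LinearMap.congr_fun h v))

variable (N)

/-- The normalised bar construction is free on `(R/ℚ)^{⊗ k} ⊗ N`, so it is projective. -/
theorem normBar_isProjective (k : ℕ) : (normBar N k).IsProjective := by
  intro X Y g hg hs f hf
  obtain ⟨s, hs, hgs⟩ := exists_graded_rightInverse X.internal Y.internal (g.restrictScalars ℚ) hg hs
  have hgs : ∀ y, g (s y) = y := hgs
  let φ : barT N k →ₗ[ℚ] X := s.comp ((f.restrictScalars ℚ).comp (normOne N k))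
  have φ_def : ∀ v, φ v = s (f (normMk N k (btmul N 1 v))) := fun v => rfl
  have hφ : ∀ w ∈ insSpan N k, φ w = 0 := fun w hw => by
    rw [φ_def, normMk_one_of_mem_insSpan N hw, map_zero, map_zero]
  refine ⟨normLin φ hφ, fun j x hx => ?_, fun x => ?_⟩
  · have := normLin_mem φ hφ (e := 0) (fun j v hv => by
      rw [add_zero]; exact hs j _ (hf j _ (normMk_one_mem N hv))) j x hx
    rwa [add_zero] at this
  · refine normBar_induction N (P := fun x => g (normLin φ hφ x) = f x) (by simp)
      (fun x y hx hy => by simp only [map_add, hx, hy]) (fun i a ha v => ?_) x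
    rw [normMk_btmul, map_smul, map_smul, map_smul, normLin_one, φ_def, hgs]

/-- The contraction `x ↦ 1 ⊗ x` of the normalised bar construction, which is linear over `ℚ` only. -/
noncomputable def normUnit (k : ℕ) : normBar N k →ₗ[ℚ] normBar N (k + 1) :=
  (((degenerate N k).restrictScalars ℚ).mapQ ((degenerate N (k + 1)).restrictScalars ℚ)
    (bunit N (k + 1))
    (fun x hx => btmul_mem_degenerate N (k + 1) 1 x (degenerate_le_insSpan N k x hx)) :)

theorem normUnit_mk (k : ℕ) (x : barT N (k + 1)) :
    normUnit N k (normMk N k x) = normMk N (k + 1) (btmul N 1 x) := rfl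

theorem normUnit_degPres (k : ℕ) : DegPres (normUnit N k) := by
  intro j x hx
  obtain ⟨y, hy, rfl⟩ := exists_of_mem_normBar_gr N hx
  exact normMk_one_mem N hy

theorem normBd_normUnit_zero (x : normBar N 0) :
    normBd N 0 (normUnit N 0 x) = x - normOne N 0 (normAug N x) := by
  obtain ⟨x, rfl⟩ := normMk_surjective N 0 x
  rw [normUnit_mk, normBd_mk, bd_succ, one_smul, map_sub, bd_zero]
  rfl

theorem normBd_normUnit_succ (k : ℕ) (x : normBar N (k + 1)) :
    normBd N (k + 1) (normUnit N (k + 1) x) = x - normUnit N k (normBd N k x) := by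
  obtain ⟨x, rfl⟩ := normMk_surjective N (k + 1) x
  rw [normUnit_mk, normBd_mk, bd_succ, one_smul, map_sub]
  rfl

theorem normAug_normOne (v : N) : normAug N (normOne N 0 v) = v := one_smul R v

/-- The normalised bar construction is exact since `x ↦ 1 ⊗ x` contracts it. -/
theorem barComplex_isProjectiveResolution : (barComplex N).IsProjectiveResolution := by
  have h0 : ∀ x : normBar N 0, normAug N x = 0 → normBd N 0 (normUnit N 0 x) = x := fun x hx => by
    rw [normBd_normUnit_zero, hx]
    exact (congrArg (x - ·) (map_zero (normOne N 0))).trans (sub_zero x)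
  have h1 : ∀ k (x : normBar N (k + 1)), normBd N k x = 0 →
      normBd N (k + 1) (normUnit N (k + 1) x) = x := fun k x hx => by
    rw [normBd_normUnit_succ, hx, map_zero, sub_zero]
  exact ⟨normBar_isProjective N, fun v => ⟨normOne N 0 v, normAug_normOne N v⟩,
    fun x hx => ⟨_, h0 x hx⟩, fun k x hx => ⟨_, h1 k x hx⟩⟩

/-! ### Comparison of projective resolutions -/

/-- The kernel of a morphism of graded modules. -/
def kerMod {X Y : GMod.{u} R} (g : X →ₗ[R] Y) (hg : DegPres (g.restrictScalars ℚ)) : GMod.{u} R where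
  carrier := LinearMap.ker g
  gr n := (X.gr n).comap ((LinearMap.ker g).subtype.restrictScalars ℚ)
  internal := by
    refine isInternal_comap X.internal _ Subtype.val_injective fun x n => ?_
    refine ⟨⟨proj X.internal n x, ?_⟩, rfl⟩
    have := hg.proj n x.1
    change g _ = 0
    refine this.symm.trans ?_
    change proj Y.internal n (g x) = 0
    rw [show g x = 0 from x.2, map_zero]
  smul_mem ha hx := X.smul_mem ha hx

/-- Maps from projective graded modules lift along exact sequences. -/
theorem IsProjective.exists_lift_of_exact {P X Y Z : GMod.{u} R} (hP : P.IsProjective)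
    (a : X →ₗ[R] Y) (ha : DegPres (a.restrictScalars ℚ)) (b : Y →ₗ[R] Z)
    (hb : DegPres (b.restrictScalars ℚ)) (hba : ∀ x, b (a x) = 0)
    (hex : ∀ y, b y = 0 → ∃ x, a x = y) (f : P →ₗ[R] Y) (hf : DegPres (f.restrictScalars ℚ))
    (hbf : ∀ x, b (f x) = 0) :
    ∃ h : P →ₗ[R] X, DegPres (h.restrictScalars ℚ) ∧ ∀ x, a (h x) = f x := by
  obtain ⟨h, hh, e⟩ := hP X (kerMod b hb) (a.codRestrict (LinearMap.ker b) hba)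
    (fun i x hx => ha i x hx)
    (fun y => by
      obtain ⟨x, hx⟩ := hex y.1 y.2
      exact ⟨x, Subtype.ext hx⟩)
    (f.codRestrict (LinearMap.ker b) hbf) (fun i x hx => hf i x hx)
  exact ⟨h, hh, fun x => congrArg Subtype.val (e x)⟩

namespace ComplexOver

variable {N} {Q Q' Q'' : ComplexOver N}

theorem _root_.HyperExt.exists_sequence {T : ℕ → Type*} {r : ∀ s, T s → T (s + 1) → Prop}
    (t₀ : T 0) (h : ∀ s t, ∃ t', r s t t') : ∃ t : ∀ s, T s, t 0 = t₀ ∧ ∀ s, r s (t s) (t (s + 1)) := by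
  choose f hf using h
  exact ⟨fun s => Nat.rec t₀ f s, rfl, fun s => hf s _⟩

/-- The comparison theorem: a complex of projectives over `N` maps to every resolution of `N`. -/
theorem exists_hom (hQ : ∀ s, (Q.X s).IsProjective) (hQ' : Q'.IsProjectiveResolution) :
    Nonempty (Q.Hom Q') := by
  obtain ⟨-, hε, h0, hd⟩ := hQ'
  -- consecutive components of the chain map that is being built
  let T : ℕ → Type _ := fun s => {t : (Q.X s →ₗ[R] Q'.X s) × (Q.X (s + 1) →ₗ[R] Q'.X (s + 1)) //
    DegPres (t.1.restrictScalars ℚ) ∧ DegPres (t.2.restrictScalars ℚ) ∧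
      ∀ x, t.1 (Q.d s x) = Q'.d s (t.2 x)}
  obtain ⟨f₀, hf₀, e₀⟩ := hQ 0 (Q'.X 0) N Q'.ε Q'.ε_deg hε Q.ε Q.ε_deg
  obtain ⟨f₁, hf₁, e₁⟩ := (hQ 1).exists_lift_of_exact (Q'.d 0) (Q'.d_deg 0) Q'.ε Q'.ε_deg Q'.ε_d h0
    (f₀.comp (Q.d 0)) (fun i x hx => hf₀ i _ (Q.d_deg 0 i x hx))
    (fun x => (e₀ _).trans (Q.ε_d x))
  obtain ⟨t, ht₀, ht⟩ := exists_sequence (T := T) (r := fun s t t' => t'.1.1 = t.1.2)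
    ⟨(f₀, f₁), hf₀, hf₁, fun x => (e₁ x).symm⟩ (by
      rintro s ⟨⟨f, g⟩, hf, hg, e⟩
      obtain ⟨h, hh, e'⟩ := (hQ (s + 2)).exists_lift_of_exact (Q'.d (s + 1)) (Q'.d_deg _)
        (Q'.d s) (Q'.d_deg s) (Q'.d_d s) (hd s) (g.comp (Q.d (s + 1)))
        (fun i x hx => hg i _ (Q.d_deg _ i x hx)) (fun x => by
          change Q'.d s (g (Q.d (s + 1) x)) = 0
          rw [← e, Q.d_d, map_zero])
      exact ⟨⟨(g, h), hg, hh, fun x => (e' x).symm⟩, rfl⟩)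
  refine ⟨⟨fun s => (t s).1.1, fun s => (t s).2.1, fun s x => ?_, fun x => ?_⟩⟩
  · rw [ht s]
    exact (t s).2.2.2 x
  · rw [ht₀]
    exact e₀ x

/-- Two chain maps from a complex of projectives to a resolution are homotopic, so that they induce
the same maps on the cohomology of `Hom(-, M)`. -/
theorem Hom.comp_sub_comp_mem_coboundaries (hQ : ∀ s, (Q.X s).IsProjective)
    (hQ' : Q'.IsProjectiveResolution) (F G : Q.Hom Q') (M : GMod.{u} R) (s : ℕ) (t : ℤ)
    (g : Q'.X s →ₗ[ℚ] M) (hg : g ∈ Q'.cocycles M s t) :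
    g.comp ((F.f s).restrictScalars ℚ) - g.comp ((G.f s).restrictScalars ℚ)
      ∈ Q.coboundaries M s t := by
  obtain ⟨-, -, h0, hd⟩ := hQ'
  -- the components of a homotopy, with what is needed to go on to the next one
  let T : ℕ → Type _ := fun s => {h : Q.X s →ₗ[R] Q'.X (s + 1) // DegPres (h.restrictScalars ℚ) ∧
    ∀ x, Q'.d s (F.f (s + 1) x - G.f (s + 1) x - h (Q.d s x)) = 0}
  obtain ⟨h₀, hh₀, e₀⟩ := (hQ 0).exists_lift_of_exact (Q'.d 0) (Q'.d_deg 0) Q'.ε Q'.ε_deg Q'.ε_d h0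
    (F.f 0 - G.f 0) (fun i x hx => sub_mem (F.deg 0 i x hx) (G.deg 0 i x hx))
    (fun x => by rw [LinearMap.sub_apply, map_sub, F.ε_comm, G.ε_comm, sub_self])
  obtain ⟨h, hh0, hh⟩ := exists_sequence (T := T)
    (r := fun s h h' => ∀ x, Q'.d (s + 1) (h'.1 x)
      = F.f (s + 1) x - G.f (s + 1) x - h.1 (Q.d s x))
    ⟨h₀, hh₀, fun x => by
      rw [map_sub, map_sub, ← F.comm, ← G.comm, e₀, LinearMap.sub_apply, sub_self]⟩ (by
      rintro s ⟨h, hh, e⟩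
      obtain ⟨h', hh', e'⟩ := (hQ (s + 1)).exists_lift_of_exact (Q'.d (s + 1)) (Q'.d_deg _)
        (Q'.d s) (Q'.d_deg s) (Q'.d_d s) (hd s) (F.f (s + 1) - G.f (s + 1) - h.comp (Q.d s))
        (fun i x hx => sub_mem (sub_mem (F.deg _ i x hx) (G.deg _ i x hx))
          (hh i _ (Q.d_deg _ i x hx))) e
      refine ⟨⟨h', hh', fun x => ?_⟩, e'⟩
      rw [map_sub, map_sub, ← F.comm, ← G.comm, e', LinearMap.sub_apply, LinearMap.sub_apply,
        LinearMap.comp_apply, Q.d_d, map_zero, sub_zero, sub_self])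
  obtain ⟨⟨hg1, hg2⟩, hg3⟩ := hg
  have hg3 : ∀ x, g (Q'.d s x) = 0 := fun x => LinearMap.congr_fun hg3 x
  match s with
  | 0 =>
    refine (Submodule.mem_bot ℚ).2 (LinearMap.ext fun x => ?_)
    change g (F.f 0 x) - g (G.f 0 x) = 0
    rw [← map_sub, ← LinearMap.sub_apply, ← e₀, hg3]
  | s + 1 =>
    refine ⟨g.comp ((h s).1.restrictScalars ℚ), ⟨fun i x hx => hg1 i _ ((h s).2.1 i x hx),
      fun i a ha x => ?_⟩, LinearMap.ext fun x => ?_⟩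
    · change g ((h s).1 (a • x)) = _
      rw [map_smul, hg2 i a ha]
      rfl
    · change g ((h s).1 (Q.d s x)) = g (F.f (s + 1) x) - g (G.f (s + 1) x)
      have := congrArg g (hh s x)
      rw [hg3, map_sub, map_sub] at this
      rw [eq_comm, ← sub_eq_zero]
      exact this.symm

/-- The composition of chain maps over `N`. -/
def Hom.comp (G : Q'.Hom Q'') (F : Q.Hom Q') : Q.Hom Q'' where
  f s := (G.f s).comp (F.f s)
  deg s i x hx := G.deg s i _ (F.deg s i x hx)
  comm s x := by
    change G.f s (F.f s (Q.d s x)) = Q''.d s (G.f (s + 1) (F.f (s + 1) x))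
    rw [F.comm, G.comm]
  ε_comm x := (G.ε_comm _).trans (F.ε_comm x)

/-- The identity chain map. -/
def Hom.id (Q : ComplexOver N) : Q.Hom Q where
  f _ := LinearMap.id
  deg _ _ _ h := h
  comm _ _ := rfl
  ε_comm _ := rfl

theorem Hom.comp_mem_cocycles (F : Q.Hom Q') (M : GMod.{u} R) {s : ℕ} {t : ℤ}
    {g : Q'.X s →ₗ[ℚ] M} (hg : g ∈ Q'.cocycles M s t) :
    g.comp ((F.f s).restrictScalars ℚ) ∈ Q.cocycles M s t := by
  obtain ⟨⟨hg1, hg2⟩, hg3⟩ := hg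
  refine ⟨⟨fun i x hx => hg1 i _ (F.deg s i x hx), fun i a ha x => ?_⟩, LinearMap.ext fun x => ?_⟩
  · change g (F.f s (a • x)) = _
    rw [map_smul, hg2 i a ha]
    rfl
  · change g (F.f s (Q.d s x)) = 0
    rw [F.comm]
    exact LinearMap.congr_fun hg3 _

theorem Hom.comp_mem_coboundaries (F : Q.Hom Q') (M : GMod.{u} R) {s : ℕ} {t : ℤ}
    {g : Q'.X s →ₗ[ℚ] M} (hg : g ∈ Q'.coboundaries M s t) :
    g.comp ((F.f s).restrictScalars ℚ) ∈ Q.coboundaries M s t := by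
  match s with
  | 0 => rw [(Submodule.mem_bot ℚ).1 hg]; exact zero_mem _
  | s + 1 =>
    obtain ⟨g, ⟨hg1, hg2⟩, rfl⟩ := hg
    refine ⟨g.comp ((F.f s).restrictScalars ℚ), ⟨fun i x hx => hg1 i _ (F.deg s i x hx),
      fun i a ha x => ?_⟩, LinearMap.ext fun x => ?_⟩
    · change g (F.f s (a • x)) = _
      rw [map_smul, hg2 i a ha]
      rfl
    · change g (F.f s (Q.d s x)) = g (Q'.d s (F.f (s + 1) x))
      rw [F.comm]

theorem mkExt_eq_zero {M : GMod.{u} R} {s : ℕ} {t : ℤ} (g : Q.cocycles M s t) :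
    Q.mkExt M s t g = 0 ↔ (g : Q.X s →ₗ[ℚ] M) ∈ Q.coboundaries M s t :=
  Submodule.Quotient.mk_eq_zero _

theorem mkExt_surjective (Q : ComplexOver N) (M : GMod.{u} R) (s : ℕ) (t : ℤ) :
    Function.Surjective (Q.mkExt M s t) := Submodule.mkQ_surjective _

/-- A chain map between projective resolutions induces isomorphisms on `Ext`. -/
theorem Hom.exists_ext_equiv (hQ : Q.IsProjectiveResolution) (hQ' : Q'.IsProjectiveResolution)
    (F : Q.Hom Q') (M : GMod.{u} R) (s : ℕ) (t : ℤ) :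
    ∃ e : Q'.Ext M s t ≃ₗ[ℚ] Q.Ext M s t, ∀ g : Q'.cocycles M s t,
      e (Q'.mkExt M s t g) = Q.mkExt M s t ⟨_, F.comp_mem_cocycles M g.2⟩ := by
  obtain ⟨G⟩ := exists_hom (Q := Q') (Q' := Q) hQ'.1 hQ
  let c : Q'.cocycles M s t →ₗ[ℚ] Q.cocycles M s t :=
    (LinearMap.lcomp ℚ M ((F.f s).restrictScalars ℚ)).restrict
      fun g hg => F.comp_mem_cocycles M hg
  refine exists_linearEquiv_of_ker_eq (Q'.mkExt M s t) ((Q.mkExt M s t).comp c)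
    (Q'.mkExt_surjective M s t) (fun x => ?_) (fun g => ?_)
  · obtain ⟨x, rfl⟩ := Q.mkExt_surjective M s t x
    refine ⟨⟨_, G.comp_mem_cocycles M x.2⟩, ?_⟩
    rw [← sub_eq_zero, LinearMap.comp_apply, ← map_sub, mkExt_eq_zero]
    exact Hom.comp_sub_comp_mem_coboundaries hQ.1 hQ (G.comp F) (Hom.id Q) M s t x.1 x.2
  · rw [LinearMap.comp_apply, mkExt_eq_zero, mkExt_eq_zero]
    refine ⟨fun hg => F.comp_mem_coboundaries M hg, fun hg => ?_⟩
    have h1 := Hom.comp_sub_comp_mem_coboundaries hQ'.1 hQ' (F.comp G) (Hom.id Q') M s t g.1 g.2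
    have h2 : (g.1.comp ((F.f s).restrictScalars ℚ)).comp ((G.f s).restrictScalars ℚ)
      ∈ Q'.coboundaries M s t := G.comp_mem_coboundaries M hg
    have := sub_mem h2 h1
    rwa [show (g.1.comp ((F.f s).restrictScalars ℚ)).comp ((G.f s).restrictScalars ℚ) -
      (g.1.comp (((F.comp G).f s).restrictScalars ℚ) -
        g.1.comp (((Hom.id Q').f s).restrictScalars ℚ)) = g.1 from sub_sub_cancel _ _] at this

end ComplexOver

end GMod

/-! ### The bar construction is a cofibrant replacement -/

namespace DGMod

open GMod

variable {A : CDGA.{u}}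

/-- Quasi-isomorphisms in terms of cocycles and coboundaries. -/
theorem Hom.quasiIso_iff {M N : DGMod.{u} A} (φ : Hom M N) :
    φ.QuasiIso ↔ (∀ x, M.d x = 0 → (∃ y, N.d y = φ.f x) → ∃ y, M.d y = x) ∧
      ∀ z, N.d z = 0 → ∃ x, M.d x = 0 ∧ ∃ y, N.d y = φ.f x - z := by
  have hcomm : ∀ x, M.d x = 0 → N.d (φ.f x) = 0 := fun x hx => by rw [← φ.comm, hx, map_zero]
  have key : ∀ x (hx : M.d x = 0), φ.hMap (M.cls ⟨x, hx⟩) = N.cls ⟨φ.f x, hcomm x hx⟩ :=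
    fun x hx => rfl
  constructor
  · rintro ⟨h1, h2⟩
    refine ⟨fun x hx hy => ?_, fun z hz => ?_⟩
    · refine (M.cls_eq_zero ⟨x, hx⟩).1 (h1 ?_)
      rw [key x hx]
      exact ((N.cls_eq_zero _).2 hy).trans (map_zero φ.hMap).symm
    · obtain ⟨x, hx⟩ := h2 (N.cls ⟨z, hz⟩)
      obtain ⟨⟨x, hx'⟩, rfl⟩ := M.cls_surjective x
      refine ⟨x, hx', ?_⟩
      have : N.cls (⟨φ.f x, hcomm x hx'⟩ - ⟨z, hz⟩) = 0 := by
        rw [map_sub, sub_eq_zero]; exact hx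
      exact (N.cls_eq_zero _).1 this
  · rintro ⟨h1, h2⟩
    refine ⟨(injective_iff_map_eq_zero φ.hMap).2 fun x hx => ?_, fun z => ?_⟩
    · obtain ⟨⟨x, hx'⟩, rfl⟩ := M.cls_surjective x
      exact (M.cls_eq_zero _).2 (h1 x hx' ((N.cls_eq_zero _).1 hx))
    · obtain ⟨⟨z, hz⟩, rfl⟩ := N.cls_surjective z
      obtain ⟨x, hx, y, hy⟩ := h2 z hz
      refine ⟨M.cls ⟨x, hx⟩, (key x hx).trans (sub_eq_zero.1 ?_)⟩
      have : N.cls (⟨φ.f x, hcomm x hx⟩ - ⟨z, hz⟩) = 0 := (N.cls_eq_zero _).2 ⟨y, hy⟩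
      rwa [map_sub] at this

/-- The kernel of a surjective quasi-isomorphism is contractible over `ℚ`. -/
theorem Hom.exists_kernel_contraction {X Y : DGMod.{u} A} (g : Hom X Y)
    (hs : Function.Surjective g.f) (hq : g.QuasiIso) :
    ∃ κ : X →ₗ[ℚ] X, ∀ x, g.f x = 0 → g.f (κ x) = 0 ∧ X.d (κ x) + κ (X.d x) = x ∧
      ∀ i, x ∈ X.gr i → κ x ∈ X.gr (i - 1) := by
  obtain ⟨h1, h2⟩ := g.quasiIso_iff.1 hq
  let K : Submodule ℚ X := LinearMap.ker (g.f.restrictScalars ℚ)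
  have hK : ∀ x, x ∈ K ↔ g.f x = 0 := fun x => Iff.rfl
  let d : K →ₗ[ℚ] K := X.d.restrict fun x hx => by
    rw [hK] at hx ⊢
    rw [g.comm, hx, map_zero]
  have hint : DirectSum.IsInternal fun n => (X.gr n).comap K.subtype :=
    isInternal_comap X.internal _ Subtype.val_injective fun x n => ⟨⟨proj X.internal n x, by
      rw [hK]
      have := proj_apply_map X.internal Y.internal (g.f.restrictScalars ℚ) 0
        (fun i x hx => by rw [add_zero]; exact g.mem i x hx) n x
      refine this.symm.trans ?_
      change proj Y.internal _ (g.f x) = 0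
      rw [(hK _).1 x.2, map_zero]⟩, rfl⟩
  have hacyc : ∀ x, d x = 0 → ∃ y, d y = x := by
    rintro ⟨x, hx⟩ hdx
    rw [hK] at hx
    have hdx : X.d x = 0 := congrArg Subtype.val hdx
    obtain ⟨y, hy⟩ := h1 x hdx ⟨0, by rw [map_zero, hx]⟩
    obtain ⟨x', hx', w, hw⟩ := h2 (g.f y) (by rw [← g.comm, hy, hx])
    obtain ⟨v, rfl⟩ := hs w
    refine ⟨⟨y - x' + X.d v, ?_⟩, Subtype.ext ?_⟩
    · rw [hK, map_add, map_sub, g.comm, hw]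
      abel
    · change X.d (y - x' + X.d v) = x
      rw [map_add, map_sub, X.d_d, hy, hx', sub_zero, add_zero]
  obtain ⟨κ, hκ, hκd⟩ := exists_contraction_of_acyclic hint d (fun i x hx => X.d_mem i _ hx)
    (fun x => Subtype.ext (X.d_d x)) hacyc
  obtain ⟨κ', hκ'⟩ := LinearMap.exists_extend (K.subtype.comp κ)
  have hκ' : ∀ x : K, κ' x = κ x := fun x => LinearMap.congr_fun hκ' x
  refine ⟨κ', fun x hx => ⟨?_, ?_, fun i hi => ?_⟩⟩
  · rw [hκ' ⟨x, hx⟩]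
    exact (κ ⟨x, hx⟩).2
  · have := congrArg Subtype.val (hκd ⟨x, hx⟩)
    change X.d (κ' (⟨x, hx⟩ : K)) + κ' (d ⟨x, hx⟩) = x
    rw [hκ', hκ']
    exact this
  · rw [hκ' ⟨x, hx⟩]
    exact hκ i ⟨x, hx⟩ hi

variable (N : DGMod.{u} A)

theorem normDiff_one {k : ℕ} (v : barT N.toGMod k) :
    normDiff N k (normMk N.toGMod k (btmul N.toGMod 1 v))
      = normMk N.toGMod k (btmul N.toGMod 1 (barDiff N k v)) := by
  rw [normDiff_mk, barDiff_btmul]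
  erw [A.d_one, A.σ_one]
  rw [zero_btmul, zero_add]

theorem normDiff_normUnit (k : ℕ) (x : normBar N.toGMod k) :
    normDiff N (k + 1) (normUnit N.toGMod k x) = normUnit N.toGMod k (normDiff N k x) := by
  obtain ⟨x, rfl⟩ := normMk_surjective _ _ x
  rw [normUnit_mk, normDiff_one]
  rfl

/-- The `k`-th summand in the construction of a lift from the bar construction along a surjective
quasi-isomorphism `g`. The map `c` is what the lower summands contribute to the differential. -/
theorem exists_lift_normBar {X Y : DGMod.{u} A} (g : Hom X Y) (hs : Function.Surjective g.f)
    (hq : g.QuasiIso) (k : ℕ) (f : normBar N.toGMod k →ₗ[A] Y)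
    (hf : ∀ j, ∀ x ∈ (normBar N.toGMod k).gr j, f x ∈ Y.gr (j + -k))
    (c : normBar N.toGMod k →ₗ[ℚ] X)
    (hc : ∀ j, ∀ x ∈ (normBar N.toGMod k).gr j, c x ∈ X.gr (j + -k + 1))
    (hcσ : ∀ (a : A) x, c (a • x) = A.σ a • c x)
    (hcd : ∀ x, X.d (c x) = -c (normDiff N k x))
    (hgc : ∀ x, Y.d (f x) = f (normDiff N k x) + g.f (c x)) :
    ∃ h : normBar N.toGMod k →ₗ[A] X, (∀ j, ∀ x ∈ (normBar N.toGMod k).gr j, h x ∈ X.gr (j + -k)) ∧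
      (∀ x, g.f (h x) = f x) ∧ ∀ x, X.d (h x) = h (normDiff N k x) + c x := by
  obtain ⟨s, hs, hgs⟩ := exists_graded_rightInverse X.internal Y.internal (g.f.restrictScalars ℚ)
    g.mem hs
  have hgs : ∀ y, g.f (s y) = y := hgs
  obtain ⟨κ, hκ⟩ := g.exists_kernel_contraction ‹_› hq
  let o := normOne N.toGMod k
  have o_diff : ∀ v, normDiff N k (o v) = o (barDiff N k v) := fun v => normDiff_one N v
  have o_ins : ∀ w ∈ insSpan N.toGMod k, o w = 0 := fun w hw => normMk_one_of_mem_insSpan _ hw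
  have o_mem : ∀ j, ∀ v ∈ (barT N.toGMod k).gr j, o v ∈ (normBar N.toGMod k).gr j :=
    fun j v hv => normMk_one_mem _ hv
  -- a lift `u` of `f` that need not be compatible with the differentials, and its defect `E`
  let u : barT N.toGMod k →ₗ[ℚ] X := s.comp ((f.restrictScalars ℚ).comp o)
  let E : barT N.toGMod k →ₗ[ℚ] X := X.d.comp u - u.comp (barDiff N k) - c.comp o
  have u_def : ∀ v, u v = s (f (o v)) := fun v => rfl
  have E_def : ∀ v, E v = X.d (u v) - u (barDiff N k v) - c (o v) := fun v => rfl
  have u_mem : ∀ j, ∀ v ∈ (barT N.toGMod k).gr j, u v ∈ X.gr (j + -k) :=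
    fun j v hv => hs _ _ (hf _ _ (o_mem j v hv))
  have gE : ∀ v, g.f (E v) = 0 := fun v => by
    rw [E_def, map_sub, map_sub, g.comm, u_def, u_def, hgs, hgs, hgc, o_diff]
    abel
  have dE : ∀ v, X.d (E v) = -E (barDiff N k v) := fun v => by
    rw [E_def, E_def, map_sub, map_sub, X.d_d, hcd, o_diff, barDiff_barDiff, map_zero]
    abel
  have E_mem : ∀ j, ∀ v ∈ (barT N.toGMod k).gr j, E v ∈ X.gr (j + -k + 1) := fun j v hv => by
    refine sub_mem (sub_mem (X.d_mem _ _ (u_mem j v hv)) ?_) (hc j _ (o_mem j v hv))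
    have := u_mem _ _ (barDiff_mem N k j v hv)
    rwa [add_right_comm] at this
  -- the defect is a twisted cocycle in the kernel of `g`, so the contraction `κ` removes it
  let φ : barT N.toGMod k →ₗ[ℚ] X := u - κ.comp E
  have φ_def : ∀ v, φ v = u v - κ (E v) := fun v => rfl
  have hφ : ∀ w ∈ insSpan N.toGMod k, φ w = 0 := fun w hw => by
    rw [φ_def, E_def, u_def, u_def, o_ins w hw, o_ins _ (barDiff_insSpan N k w hw)]
    simp
  refine ⟨normLin φ hφ, normLin_mem φ hφ fun j v hv => ?_, fun x => ?_, fun x => ?_⟩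
  · refine sub_mem (u_mem j v hv) ?_
    have := (hκ _ (gE v)).2.2 _ (E_mem j v hv)
    rwa [add_sub_cancel_right] at this
  · refine normBar_induction _ (P := fun x => g.f (normLin φ hφ x) = f x) (by simp)
      (fun x y hx hy => by simp only [map_add, hx, hy]) (fun i a ha v => ?_) x
    rw [normMk_btmul, map_smul, map_smul, map_smul, normLin_one, φ_def, map_sub, (hκ _ (gE v)).1,
      u_def, hgs, sub_zero]
    rfl
  · refine normBar_induction _ (P := fun x => X.d (normLin φ hφ x)
      = normLin φ hφ (normDiff N k x) + c x) (by simp)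
      (fun x y hx hy => by simp only [map_add, hx, hy]; abel) (fun i a ha v => ?_) x
    have h1 : X.d (φ v) = φ (barDiff N k v) + c (o v) := by
      have h2 := (hκ _ (gE v)).2.1
      rw [dE, map_neg] at h2
      have h3 : X.d (κ (E v)) = E v + κ (E (barDiff N k v)) := by
        rw [← sub_eq_add_neg, sub_eq_iff_eq_add] at h2
        exact h2
      rw [φ_def, φ_def, map_sub, h3, E_def]
      abel
    rw [normMk_btmul, map_smul, normLin_one, X.d_smul, normDiff_smul, map_add, map_smul, map_smul,
      hcσ, normDiff_one, normLin_one, normLin_one, h1, smul_add, add_assoc]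
    rfl

/-- A lift along a surjective quasi-isomorphism is built one summand at a time. -/
theorem bar_isCofibrant : (bar N).IsCofibrant := by
  intro X Y g hs hq f
  let fk : ∀ k, normBar N.toGMod k →ₗ[A] Y := fun k => f.f.comp (barInc N k)
  -- the part of the total differential that lowers the number of factors
  let δ : ∀ k, normBar N.toGMod (k + 1) →ₗ[ℚ] normBar N.toGMod k := fun k =>
    ((normBd N.toGMod k).restrictScalars ℚ).comp (parity (normBar N.toGMod (k + 1)).internal)
  have δ_def : ∀ k x, δ k x = normBd N.toGMod k (parity (normBar N.toGMod (k + 1)).internal x) :=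
    fun k x => rfl
  have hfk : ∀ k, ∀ j, ∀ x ∈ (normBar N.toGMod k).gr j, fk k x ∈ Y.gr (j + -k) :=
    fun k j x hx => f.mem _ _ (inc_mem N (by rwa [neg_add_cancel_right]))
  have hf0 : ∀ x, Y.d (fk 0 x) = fk 0 (normDiff N 0 x) := fun x => by
    have := f.comm (inc N 0 x)
    rw [show (bar N).d (inc N 0 x) = _ from barD_zero N x] at this
    exact this.symm
  have hf1 : ∀ k x, Y.d (fk (k + 1) x) = fk (k + 1) (normDiff N (k + 1) x) + fk k (δ k x) :=
    fun k x => by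
    have := f.comm (inc N (k + 1) x)
    rw [show (bar N).d (inc N (k + 1) x) = _ from barD_succ N k x] at this
    exact this.symm.trans (map_add f.f _ _)
  have δ_diff : ∀ k x, normDiff N k (δ k x) = -δ k (normDiff N (k + 1) x) := fun k x => by
    rw [δ_def, δ_def, ← normBd_normDiff, parity_shift _ (normDiff_mem N (k + 1)), map_neg]
  have δδ : ∀ k x, δ k (δ (k + 1) x) = 0 := fun k x => by
    have h := parity_degPres (normBd_degPres N.toGMod (k + 1))
      (parity (normBar N.toGMod (k + 2)).internal x)
    rw [δ_def, δ_def]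
    refine (congrArg (normBd N.toGMod k) h).trans ?_
    rw [parity_parity]
    exact normBd_normBd N.toGMod k x
  -- the components of a lift, with what is needed to go on to the next one
  let T : ℕ → Type u := fun k => {h : normBar N.toGMod k →ₗ[A] X //
    (∀ j, ∀ x ∈ (normBar N.toGMod k).gr j, h x ∈ X.gr (j + -k)) ∧ (∀ x, g.f (h x) = fk k x) ∧
      ∀ x, X.d (h (δ k x)) = h (normDiff N k (δ k x))}
  obtain ⟨h₀, hh₀, hg₀, hd₀⟩ := exists_lift_normBar N g hs hq 0 (fk 0) (hfk 0) 0
    (fun j x _ => zero_mem _) (fun a x => by simp) (fun x => by simp) (fun x => by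
      rw [hf0]; simp)
  obtain ⟨t, ht₀, ht⟩ := exists_sequence (T := T) (r := fun k h h' =>
      ∀ x, X.d (h'.1 x) = h'.1 (normDiff N (k + 1) x) + h.1 (δ k x))
    ⟨h₀, hh₀, hg₀, fun x => by rw [hd₀]; simp⟩ (by
      rintro k ⟨h, hh, hg, hd⟩
      obtain ⟨h', hh', hg', hd'⟩ := exists_lift_normBar N g hs hq (k + 1) (fk (k + 1))
        (hfk (k + 1)) ((h.restrictScalars ℚ).comp (δ k))
        (fun j x hx => by
          have := hh _ _ (normBd_degPres N.toGMod k _ _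
            (parity_mem (normBar N.toGMod (k + 1)).internal hx))
          rwa [show j + -(k : ℤ) = j + -((k + 1 : ℕ) : ℤ) + 1 by push_cast; ring] at this)
        (fun a x => by
          change h (δ k (a • x)) = A.σ a • h (δ k x)
          rw [δ_def, parity_smul, map_smul, map_smul]
          rfl)
        (fun x => by
          change X.d (h (δ k x)) = -h (δ k _)
          rw [hd, δ_diff, map_neg])
        (fun x => by
          rw [hf1]
          exact congrArg _ (hg _).symm)
      refine ⟨⟨h', hh', hg', fun x => ?_⟩, hd'⟩
      rw [hd']
      change _ + h (δ k (δ (k + 1) x)) = _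
      rw [δδ, map_zero, add_zero])
  have hinc : ∀ k x, DirectSum.toModule A ℕ X (fun k => (t k).1) (inc N k x) = (t k).1 x :=
    fun k x => DirectSum.toModule_lof (M := fun k => (normBar N.toGMod k : Type u)) A k x
  refine ⟨⟨DirectSum.toModule A ℕ X (fun k => (t k).1), fun i => ?_, fun x => ?_⟩, fun x => ?_⟩
  · refine barGr_induction N (P := fun x => DirectSum.toModule A ℕ X (fun k => (t k).1) x ∈ X.gr i)
      (by rw [map_zero]; exact zero_mem _)
      (fun x y hx hy => by rw [map_add]; exact add_mem hx hy) fun k x hx => ?_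
    rw [hinc]
    have := (t k).2.1 _ x hx
    rwa [add_neg_cancel_right] at this
  · refine barCarrier_induction (P := fun x => DirectSum.toModule A ℕ X (fun k => (t k).1) (barD N x)
      = X.d (DirectSum.toModule A ℕ X (fun k => (t k).1) x)) (by simp)
      (fun x y hx hy => by simp only [map_add, hx, hy]) (fun k x => ?_) x
    match k with
    | 0 =>
      rw [barD_zero, hinc, hinc, ht₀, hd₀]
      exact (add_zero _).symm
    | k + 1 =>
      rw [barD_succ, map_add, hinc, hinc, hinc]
      exact (ht k x).symm
  · refine barCarrier_induction (P := fun x => g.f (DirectSum.toModule A ℕ X (fun k => (t k).1) x)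
      = f.f x) ?_ (fun x y hx hy => ?_) (fun k x => ?_) x
    · rw [map_zero, map_zero]
      exact (map_zero f.f).symm
    · rw [map_add, map_add, hx, hy]
      exact (map_add f.f x y).symm
    · rw [hinc, (t k).2.2.1]
      rfl

/-- The chain homotopy `x ↦ (-1)^{|x|} 1 ⊗ x` on the bar construction. -/
noncomputable def barHomotopy : BarCarrier N →ₗ[ℚ] BarCarrier N :=
  barLift fun k => ((inc N (k + 1)).restrictScalars ℚ).comp
    ((normUnit N.toGMod k).comp (parity (normBar N.toGMod k).internal))

theorem barHomotopy_inc (k : ℕ) (x : normBar N.toGMod k) :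
    barHomotopy N (inc N k x)
      = inc N (k + 1) (normUnit N.toGMod k (parity (normBar N.toGMod k).internal x)) :=
  barLift_inc N _ k x

/-- The bar construction retracts to `N`, by a homotopy that is linear over `ℚ` only. -/
theorem barD_barHomotopy (x : BarCarrier N) :
    barD N (barHomotopy N x) + barHomotopy N (barD N x)
      = x - inc N 0 (normOne N.toGMod 0 (augMap N x)) := by
  refine barCarrier_induction (P := fun x => barD N (barHomotopy N x) + barHomotopy N (barD N x)
      = x - inc N 0 (normOne N.toGMod 0 (augMap N x))) ?_ (fun x y hx hy => ?_) (fun k x => ?_) x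
  · have := map_zero (normOne N.toGMod 0)
    simp only [map_zero, add_zero, zero_sub]
    exact (neg_eq_zero.2 ((congrArg (inc N 0) this).trans (map_zero _))).symm
  · have h1 : ∀ z w : N, normOne N.toGMod 0 (z + w)
      = normOne N.toGMod 0 z + normOne N.toGMod 0 w := map_add (normOne N.toGMod 0)
    rw [map_add, map_add, map_add, map_add, map_add, h1, map_add, add_add_add_comm, hx, hy]
    abel
  · have hp : ∀ k (y : normBar N.toGMod k), parity (normBar N.toGMod (k + 1)).internal
        (normUnit N.toGMod k (parity (normBar N.toGMod k).internal y)) = normUnit N.toGMod k y :=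
      fun k y => by rw [parity_degPres (normUnit_degPres N.toGMod k), parity_parity]
    have hd := parity_shift (normBar N.toGMod k).internal (normDiff_mem N k) x
    rw [barHomotopy_inc, barD_succ, hp, normDiff_normUnit, hd]
    match k with
    | 0 =>
      rw [barD_zero, barHomotopy_inc, augMap_zero, normBd_normUnit_zero, map_sub, map_neg, map_neg]
      abel
    | k + 1 =>
      have hp' := parity_degPres (normBd_degPres N.toGMod k)
        (parity (normBar N.toGMod (k + 1)).internal x)
      rw [parity_parity] at hp'
      rw [barD_succ, map_add, barHomotopy_inc, barHomotopy_inc, augMap_succ, normBd_normUnit_succ,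
        map_sub, map_neg, map_neg]
      have hz : inc N 0 (normOne N.toGMod 0 (0 : N)) = 0 :=
        (congrArg (inc N 0) (map_zero (normOne N.toGMod 0))).trans (map_zero _)
      rw [hz]
      have hp'' : inc N (k + 1) (normUnit N.toGMod k (parity (normBar N.toGMod k).internal
        (normBd N.toGMod k (parity (normBar N.toGMod (k + 1)).internal x))))
          = inc N (k + 1) (normUnit N.toGMod k (normBd N.toGMod k x)) :=
        congrArg (fun y => inc N (k + 1) (normUnit N.toGMod k y)) hp'
      rw [hp'']
      abel

theorem augMap_normOne (z : N) : augMap N (inc N 0 (normOne N.toGMod 0 z)) = z :=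
  (augMap_zero N _).trans (normAug_normOne N.toGMod z)

theorem barAug_surjective : Function.Surjective (barAug N).f := fun z => ⟨_, augMap_normOne N z⟩

theorem barD_normOne (z : N) :
    barD N (inc N 0 (normOne N.toGMod 0 z)) = inc N 0 (normOne N.toGMod 0 (N.d z)) :=
  (barD_zero N _).trans (congrArg (inc N 0) (normDiff_one N (k := 0) z))

theorem barAug_quasiIso : (barAug N).QuasiIso := by
  have hz : inc N 0 (normOne N.toGMod 0 (0 : N)) = 0 :=
    (congrArg (inc N 0) (map_zero (normOne N.toGMod 0))).trans (map_zero _)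
  rw [Hom.quasiIso_iff]
  refine ⟨fun x hx => ?_, fun z hz' => ⟨inc N 0 (normOne N.toGMod 0 z), ?_, 0, ?_⟩⟩
  · rintro ⟨y, hy⟩
    have hx : barD N x = 0 := hx
    have hy : N.d y = augMap N x := hy
    have h := barD_barHomotopy N x
    rw [hx, map_zero, add_zero, ← hy, ← barD_normOne] at h
    have h := eq_sub_iff_add_eq.1 h
    rw [← map_add] at h
    exact ⟨_, h⟩
  · exact (barD_normOne N z).trans (by rw [hz']; exact hz)
  · rw [map_zero]
    exact (sub_eq_zero.2 (augMap_normOne N z)).symm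

theorem barAug_isCofibrantReplacement : (barAug N).IsCofibrantReplacement :=
  ⟨bar_isCofibrant N, barAug_quasiIso N⟩

end DGMod

/-! ### Homotopy invariance of the Hom complex -/

section

variable {V W : Type*} [AddCommGroup V] [Module ℚ V] [AddCommGroup W] [Module ℚ W]
  {gr : ℤ → Submodule ℚ V} {gr' : ℤ → Submodule ℚ W}

theorem isInternal_prod (h : DirectSum.IsInternal gr) (h' : DirectSum.IsInternal gr') :
    DirectSum.IsInternal fun n => (gr n).prod (gr' n) := by
  refine isInternal_of_proj (fun n => (proj h n).prodMap (proj h' n)) ?_ ?_ ?_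
  · rintro n x ⟨h1, h2⟩
    exact Prod.ext (proj_same h h1) (proj_same h' h2)
  · rintro m n x ⟨h1, h2⟩ hmn
    exact Prod.ext (proj_ne h h1 hmn) (proj_ne h' h2 hmn)
  · rintro ⟨x, y⟩
    have hx : ((x, 0) : V × W) ∈ ⨆ n, (gr n).prod (gr' n) := by
      induction x using graded_induction h with
      | h0 => exact zero_mem _
      | hadd x x' hx hx' => simpa using add_mem hx hx'
      | hgr i x hx => exact Submodule.mem_iSup_of_mem i ⟨hx, zero_mem _⟩
    have hy : ((0, y) : V × W) ∈ ⨆ n, (gr n).prod (gr' n) := by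
      induction y using graded_induction h' with
      | h0 => exact zero_mem _
      | hadd y y' hy hy' => simpa using add_mem hy hy'
      | hgr i y hy => exact Submodule.mem_iSup_of_mem i ⟨zero_mem _, hy⟩
    simpa using add_mem hx hy

theorem isInternal_shift (h : DirectSum.IsInternal gr) (k : ℤ) :
    DirectSum.IsInternal fun n => gr (n + k) := by
  refine isInternal_of_proj (fun n => proj h (n + k)) (fun n x hx => proj_same h hx)
    (fun m n x hx hmn => proj_ne h hx (by omega)) fun x => ?_
  induction x using graded_induction h with
  | h0 => exact zero_mem _
  | hadd x y hx hy => exact add_mem hx hy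
  | hgr i x hx => exact Submodule.mem_iSup_of_mem (i - k) (by rwa [sub_add_cancel])

end

/-- The ring automorphism `a ↦ (-1)^{n |a|} a`. -/
noncomputable def GAlg.twistHom (R : GAlg.{u}) (n : ℤ) : R →+* R where
  toFun := twist R.internal n
  map_one' := by rw [twist_of_mem _ _ R.one_mem, mul_zero, sgn_zero, one_smul]
  map_mul' := R.twist_mul n
  map_zero' := map_zero _
  map_add' := map_add _

namespace GMod

variable {R : GAlg.{u}}

/-- The direct sum of two graded modules. -/
def prod (X Y : GMod.{u} R) : GMod.{u} R where
  carrier := X × Y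
  gr n := (X.gr n).prod (Y.gr n)
  internal := isInternal_prod X.internal Y.internal
  smul_mem ha hx := ⟨X.smul_mem ha hx.1, Y.smul_mem ha hx.2⟩

/-- The shift `Y[-1]`, with `Y` in degrees raised by one and with the action twisted by a sign. -/
noncomputable def shift (Y : GMod.{u} R) : GMod.{u} R where
  carrier := Y
  module := Module.compHom Y (R.twistHom 1)
  tower := by
    refine @IsScalarTower.mk ℚ R Y _ (Module.compHom Y (R.twistHom 1)).toSMul _ fun c r x => ?_
    change twist R.internal 1 (c • r) • x = c • (twist R.internal 1 r • x)
    rw [map_smul, smul_assoc]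
  gr n := Y.gr (n + -1)
  internal := isInternal_shift Y.internal (-1)
  smul_mem {i j a x} ha hx := by
    change twist R.internal 1 a • x ∈ Y.gr (i + j + -1)
    rw [twist_of_mem _ _ ha, smul_assoc, add_assoc]
    exact Submodule.smul_mem _ _ (Y.smul_mem ha hx)

end GMod

namespace DGMod

open GMod

variable {A : CDGA.{u}}

/-- The direct sum of `X` and the acyclic cone `Y ⊕ Y[-1]` on `Y`, with the differential
`(x, y, z) ↦ (d x, d y, y - d z)`. -/
noncomputable def coneSum (X Y : DGMod.{u} A) : DGMod.{u} A where
  toGMod := X.toGMod.prod (Y.toGMod.prod Y.toGMod.shift)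
  d := (X.d.prodMap ((Y.d.comp (LinearMap.fst ℚ Y Y)).prod
    (LinearMap.fst ℚ Y Y - Y.d.comp (LinearMap.snd ℚ Y Y))) : X × Y × Y →ₗ[ℚ] X × Y × Y)
  d_mem := by
    rintro i ⟨x, y, z⟩ ⟨hx, hy, hz⟩
    refine ⟨X.d_mem i x hx, Y.d_mem i y hy, ?_⟩
    have hz : z ∈ Y.gr (i + -1) := hz
    have hy : y ∈ Y.gr i := hy
    change y - Y.d z ∈ Y.gr (i + 1 + -1)
    have := Y.d_mem _ z hz
    rw [show i + -1 + 1 = i by ring] at this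
    rw [show i + 1 + -1 = i by ring]
    exact sub_mem hy this
  d_d := by
    rintro ⟨x, y, z⟩
    refine Prod.ext (X.d_d x) (Prod.ext (Y.d_d y) ?_)
    change Y at y z
    change Y.d y - Y.d (y - Y.d z) = 0
    rw [map_sub, Y.d_d, sub_zero, sub_self]
  leibniz := by
    rintro i a ha ⟨x, y, z⟩
    refine Prod.ext (X.leibniz i a ha x) (Prod.ext (Y.leibniz i a ha y) ?_)
    change X at x
    change Y at y z
    change a • y - Y.d (twist A.internal 1 a • z)
      = twist A.internal 1 (A.d a) • z + sgn i • (twist A.internal 1 a • (y - Y.d z))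
    rw [twist_of_mem _ _ ha, twist_of_mem _ _ (A.d_mem i a ha), smul_assoc, smul_assoc, smul_assoc,
      map_smul, Y.leibniz i a ha, one_mul, one_mul, sgn_add, sgn_one, smul_add, smul_smul, smul_smul,
      sgn_sq, one_smul, one_smul, smul_sub, mul_neg, mul_one, neg_smul]
    abel

theorem coneSum_d (X Y : DGMod.{u} A) (x : X) (y z : Y) :
    (coneSum X Y).d ((x, y, z) : X × Y × Y) = ((X.d x, Y.d y, y - Y.d z) : X × Y × Y) := rfl

/-- The extension of a morphism `X → Y` to a surjection from the sum of `X` and the cone on `Y`. -/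
noncomputable def Hom.coneSum {X Y : DGMod.{u} A} (g : Hom X Y) : Hom (DGMod.coneSum X Y) Y where
  f := {
    toFun := fun w : X × Y × Y => g.f w.1 + w.2.1
    map_add' := fun w w' => by
      change g.f (w.1 + w'.1) + (w.2.1 + w'.2.1) = _
      rw [map_add]
      abel
    map_smul' := fun a w => by
      change g.f (a • w.1) + a • w.2.1 = a • (g.f w.1 + w.2.1)
      rw [map_smul, smul_add] }
  mem _ w hw := add_mem (g.mem _ _ hw.1) hw.2.1
  comm w := by
    change g.f (X.d w.1) + Y.d w.2.1 = Y.d (g.f w.1 + w.2.1)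
    rw [map_add, g.comm]

theorem Hom.coneSum_f {X Y : DGMod.{u} A} (g : Hom X Y) (x : X) (y z : Y) :
    g.coneSum.f ((x, y, z) : X × Y × Y) = g.f x + y := rfl

theorem Hom.coneSum_surjective {X Y : DGMod.{u} A} (g : Hom X Y) :
    Function.Surjective g.coneSum.f := fun y =>
  ⟨((0, y, 0) : X × Y × Y), by rw [g.coneSum_f, map_zero, zero_add]⟩

theorem Hom.coneSum_quasiIso {X Y : DGMod.{u} A} (g : Hom X Y) (hg : g.QuasiIso) :
    g.coneSum.QuasiIso := by
  obtain ⟨h1, h2⟩ := g.quasiIso_iff.1 hg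
  rw [Hom.quasiIso_iff]
  constructor
  · rintro ⟨x, y, z⟩ hw ⟨w, hw'⟩
    change X at x
    change Y at y z w
    have hw : ((X.d x, Y.d y, y - Y.d z) : X × Y × Y) = (0, 0, 0) := hw
    rw [Prod.mk.injEq, Prod.mk.injEq] at hw
    have hw' : Y.d w = g.f x + y := hw'
    obtain ⟨x', hx'⟩ := h1 x hw.1 ⟨w - z, by
      rw [map_sub, hw', sub_eq_zero.1 hw.2.2, add_sub_cancel_right]⟩
    refine ⟨((x', z, 0) : X × Y × Y), ?_⟩
    rw [coneSum_d, hx', map_zero, sub_zero, ← sub_eq_zero.1 hw.2.2]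
    rfl
  · intro z hz
    obtain ⟨x, hx, y, hy⟩ := h2 z hz
    refine ⟨((x, 0, 0) : X × Y × Y), ?_, y, ?_⟩
    · rw [coneSum_d, hx, map_zero, sub_zero]
      rfl
    · rw [g.coneSum_f, add_zero, hy]

/-- The composition of morphisms of differential graded modules. -/
def Hom.comp {X Y Z : DGMod.{u} A} (g : Hom Y Z) (f : Hom X Y) : Hom X Z where
  f := g.f.comp f.f
  mem i x hx := g.mem i _ (f.mem i x hx)
  comm x := by
    change g.f (f.f (X.d x)) = Z.d (g.f (f.f x))
    rw [f.comm, g.comm]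

/-- The identity morphism. -/
def Hom.id (X : DGMod.{u} A) : Hom X X where
  f := LinearMap.id
  mem _ _ h := h
  comm _ := rfl

/-- Homotopy of morphisms of differential graded modules. -/
def Hom.Homotopic {X Y : DGMod.{u} A} (f g : Hom X Y) : Prop :=
  ∃ t ∈ homDeg X.toGMod Y.toGMod (-1), ∀ x, f.f x - g.f x = Y.d (t x) + t (X.d x)

namespace Hom.Homotopic

variable {X Y Z : DGMod.{u} A}

theorem symm {f g : Hom X Y} (h : f.Homotopic g) : g.Homotopic f := by
  obtain ⟨t, ht, e⟩ := h
  refine ⟨-t, neg_mem ht, fun x => ?_⟩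
  rw [LinearMap.neg_apply, LinearMap.neg_apply, map_neg, ← neg_add, ← e, neg_sub]

theorem trans {f g k : Hom X Y} (h : f.Homotopic g) (h' : g.Homotopic k) : f.Homotopic k := by
  obtain ⟨t, ht, e⟩ := h
  obtain ⟨t', ht', e'⟩ := h'
  refine ⟨t + t', add_mem ht ht', fun x => ?_⟩
  rw [LinearMap.add_apply, LinearMap.add_apply, map_add, add_add_add_comm, ← e, ← e',
    sub_add_sub_cancel]

theorem comp_left {f g : Hom X Y} (h : f.Homotopic g) (k : Hom Y Z) :
    (k.comp f).Homotopic (k.comp g) := by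
  obtain ⟨t, ht, e⟩ := h
  refine ⟨(k.f.restrictScalars ℚ).comp t, ⟨fun i x hx => k.mem _ _ (ht.1 i x hx),
    fun i a ha x => ?_⟩, fun x => ?_⟩
  · change k.f (t (a • x)) = sgn (-1 * i) • a • k.f (t x)
    rw [ht.2 i a ha, LinearMap.map_smul_of_tower, map_smul]
  · change k.f (f.f x) - k.f (g.f x) = Z.d (k.f (t x)) + k.f (t (X.d x))
    rw [← map_sub, e, map_add, k.comm]

theorem comp_right {f g : Hom Y Z} (h : f.Homotopic g) (k : Hom X Y) :
    (f.comp k).Homotopic (g.comp k) := by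
  obtain ⟨t, ht, e⟩ := h
  refine ⟨t.comp (k.f.restrictScalars ℚ), ⟨fun i x hx => ht.1 _ _ (k.mem i x hx),
    fun i a ha x => ?_⟩, fun x => ?_⟩
  · change t (k.f (a • x)) = sgn (-1 * i) • a • t (k.f x)
    rw [map_smul, ht.2 i a ha]
  · change f.f (k.f x) - g.f (k.f x) = Z.d (t (k.f x)) + t (k.f (X.d x))
    rw [e, k.comm]

end Hom.Homotopic

/-- A quasi-isomorphism with cofibrant target has a right inverse up to homotopy. -/
theorem Hom.QuasiIso.exists_comp_homotopic_id {X Y : DGMod.{u} A} {g : Hom X Y} (hg : g.QuasiIso)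
    (hY : Y.IsCofibrant) : ∃ s : Hom Y X, (g.comp s).Homotopic (Hom.id Y) := by
  -- lift the identity of `Y` to the sum of `X` and the cone on `Y`
  obtain ⟨h, hh⟩ := hY _ _ g.coneSum g.coneSum_surjective (g.coneSum_quasiIso hg) (Hom.id Y)
  let h' : Y →ₗ[ℚ] X × Y × Y := h.f.restrictScalars ℚ
  have h'_smul : ∀ (a : A) y, h' (a • y)
      = (a • (h' y).1, a • (h' y).2.1, twist A.internal 1 a • (h' y).2.2) :=
    fun a y => h.f.map_smul a y
  have h'_d : ∀ y, h' (Y.d y) = (X.d (h' y).1, Y.d (h' y).2.1, (h' y).2.1 - Y.d (h' y).2.2) :=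
    h.comm
  have h'_g : ∀ y, g.f (h' y).1 + (h' y).2.1 = y := hh
  have h'_mem : ∀ i, ∀ y ∈ Y.gr i, (h' y).1 ∈ X.gr i ∧ (h' y).2.1 ∈ Y.gr i ∧
      (h' y).2.2 ∈ Y.gr (i + -1) := h.mem
  refine ⟨⟨⟨⟨fun y => (h' y).1, fun y y' => by rw [map_add]; rfl⟩, fun a y => by
      simp only [h'_smul, RingHom.id_apply]⟩,
    fun i y hy => (h'_mem i y hy).1, fun y => by
      change (h' (Y.d y)).1 = X.d (h' y).1
      rw [h'_d]⟩,
    -((LinearMap.snd ℚ Y Y).comp (LinearMap.snd ℚ X (Y × Y))).comp h',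
    ⟨fun i y hy => neg_mem (h'_mem i y hy).2.2, fun i a ha y => ?_⟩, fun y => ?_⟩
  · change -(h' (a • y)).2.2 = sgn (-1 * i) • a • -(h' y).2.2
    have hs : sgn (-1 * i) = sgn (1 * i) := by
      have h0 : sgn (1 * i) * sgn (-1 * i) = 1 := by
        rw [← sgn_add, show 1 * i + -1 * i = 0 by ring, sgn_zero]
      rw [← mul_one (sgn (-1 * i)), ← sgn_sq (1 * i), mul_comm, mul_assoc, h0, mul_one]
    rw [h'_smul, hs, twist_of_mem _ _ ha, smul_assoc, smul_neg, smul_neg]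
  · change g.f (h' y).1 - y = Y.d (-(h' y).2.2) + -(h' (Y.d y)).2.2
    have h1 : (h' (Y.d y)).2.2 = (h' y).2.1 - Y.d (h' y).2.2 := by rw [h'_d]
    have h2 := h'_g y
    rw [h1, map_neg, neg_sub, eq_sub_of_add_eq h2]
    abel

/-- A right inverse up to homotopy of a quasi-isomorphism is a quasi-isomorphism. -/
theorem Hom.QuasiIso.of_comp_homotopic_id {X Y : DGMod.{u} A} {g : Hom X Y} (hg : g.QuasiIso)
    {s : Hom Y X} (h : (g.comp s).Homotopic (Hom.id Y)) : s.QuasiIso := by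
  obtain ⟨t, -, ht⟩ := h
  have ht : ∀ y, g.f (s.f y) - y = Y.d (t y) + t (Y.d y) := ht
  obtain ⟨h1, h2⟩ := g.quasiIso_iff.1 hg
  rw [Hom.quasiIso_iff]
  constructor
  · rintro y hy ⟨x, hx⟩
    have h3 := ht y
    rw [hy, map_zero, add_zero, ← hx, g.comm, sub_eq_iff_eq_add] at h3
    exact ⟨g.f x - t y, by rw [map_sub, h3]; abel⟩
  · intro x hx
    have hgx : Y.d (g.f x) = 0 := by rw [← g.comm, hx, map_zero]
    have h3 := ht (g.f x)
    rw [hgx, map_zero, add_zero, ← map_sub] at h3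
    have h4 : X.d (s.f (g.f x) - x) = 0 := by
      rw [map_sub, ← s.comm, hgx, hx, map_zero, sub_zero]
    exact ⟨g.f x, hgx, h1 _ h4 ⟨_, h3.symm⟩⟩

/-- Homotopic morphisms induce the same map on the cohomology of the complex of maps to `M`. -/
theorem Hom.Homotopic.comp_sub_comp_mem_coboundaries {X Y : DGMod.{u} A} {f g : Hom X Y}
    (h : f.Homotopic g) (M : DGMod.{u} A) (n : ℤ) (c : Y →ₗ[ℚ] M) (hc : c ∈ (homCx Y M).cocycles n) :
    c.comp (f.f.restrictScalars ℚ) - c.comp (g.f.restrictScalars ℚ) ∈ (homCx X M).coboundaries n := by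
  obtain ⟨t, ⟨ht1, ht2⟩, ht⟩ := h
  obtain ⟨⟨hc1, hc2⟩, hc3⟩ := hc
  have hc3 : ∀ y, M.d (c y) - sgn n • c (Y.d y) = 0 := fun y => LinearMap.congr_fun hc3 y
  have hcd : ∀ y, c (Y.d y) = sgn n • M.d (c y) := fun y => by
    rw [sub_eq_zero.1 (hc3 y), smul_smul, sgn_sq, one_smul]
  have hu : sgn n • c.comp t ∈ homDeg X.toGMod M.toGMod (n - 1) := by
    refine Submodule.smul_mem _ _ ⟨fun i x hx => ?_, fun i a ha x => ?_⟩
    · have := hc1 _ _ (ht1 i x hx)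
      rwa [show i + -1 + n = i + (n - 1) by ring] at this
    · change c (t (a • x)) = _
      rw [ht2 i a ha, map_smul, hc2 i a ha, smul_smul, ← sgn_add, show -1 * i + n * i = (n - 1) * i by
        ring]
      rfl
  refine ⟨_, hu, LinearMap.ext fun x => ?_⟩
  change M.d (sgn n • c (t x)) - sgn (n - 1) • sgn n • c (t (X.d x)) = c (f.f x) - c (g.f x)
  rw [← map_sub, ht, map_add, hcd, map_smul, smul_smul, ← sgn_add,
    show n - 1 + n = (n + n) + -1 by ring, sgn_add, sgn_add, sgn_sq, one_mul,
    show sgn (-1) = -1 by simp [sgn]]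
  simp

/-- A quasi-isomorphism between cofibrant modules induces isomorphisms on the cohomology of the
complexes of maps to any module. -/
theorem Hom.QuasiIso.precomp_bijective {P X : DGMod.{u} A} {φ : Hom P X} (hφ : φ.QuasiIso)
    (hP : P.IsCofibrant) (hX : X.IsCofibrant) (M : DGMod.{u} A) (n : ℤ) :
    Function.Bijective (φ.precomp M n) := by
  obtain ⟨ψ, h1⟩ := hφ.exists_comp_homotopic_id hX
  obtain ⟨χ, h2⟩ := (hφ.of_comp_homotopic_id h1).exists_comp_homotopic_id hP
  -- the right inverse `χ` of `ψ` is homotopic to `φ`, so `ψ` is a two-sided inverse of `φ`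
  have h3 : (ψ.comp φ).Homotopic (Hom.id P) :=
    ((h2.comp_left (ψ.comp φ)).symm.trans ((h1.comp_right χ).comp_left ψ)).trans h2
  have key : ∀ c : (homCx X M).cocycles n,
      φ.precomp M n ((homCx X M).cls n c) = (homCx P M).cls n (φ.precompCocycles M n c) :=
    fun c => rfl
  constructor
  · rw [injective_iff_map_eq_zero]
    intro c hc
    obtain ⟨c, rfl⟩ := (homCx X M).cls_surjective n c
    rw [key, Cx.cls_eq_zero] at hc
    rw [Cx.cls_eq_zero]
    have h4 := h1.comp_sub_comp_mem_coboundaries M n c.1 c.2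
    have h5 := ψ.precomp_coboundary M n _ hc
    have h6 := sub_mem h5 h4
    exact (sub_sub_cancel (c.1.comp ((φ.comp ψ).f.restrictScalars ℚ)) c.1) ▸ h6
  · intro c
    obtain ⟨c, rfl⟩ := (homCx P M).cls_surjective n c
    refine ⟨(homCx X M).cls n (ψ.precompCocycles M n c), ?_⟩
    rw [key, ← sub_eq_zero, ← map_sub, Cx.cls_eq_zero]
    exact h3.comp_sub_comp_mem_coboundaries M n c.1 c.2

/-- Every cofibrant replacement of `N` maps to the bar construction over `N`, and the map induces
isomorphisms on the cohomology of the complexes of maps to any module. -/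
theorem Hom.IsCofibrantReplacement.exists_hom_bar {P N : DGMod.{u} A} {π : Hom P N}
    (hπ : π.IsCofibrantReplacement) :
    ∃ φ : Hom P (bar N), (∀ x, (barAug N).f (φ.f x) = π.f x) ∧
      ∀ M n, Function.Bijective (φ.precomp M n) := by
  obtain ⟨φ, hφ⟩ := hπ.1 _ _ (barAug N) (barAug_surjective N) (barAug_quasiIso N) π
  have hq : φ.QuasiIso := by
    have h1 := hπ.2
    have h2 : π.hMap = (barAug N).hMap.comp φ.hMap := by
      refine LinearMap.ext fun x => ?_
      obtain ⟨x, rfl⟩ := P.cls_surjective x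
      exact congrArg N.cls (Subtype.ext (hφ x).symm)
    have h3 : Function.Bijective ((barAug N).hMap ∘ φ.hMap) := by
      rw [Hom.QuasiIso, h2] at h1
      exact h1
    exact (Function.Bijective.of_comp_iff' (barAug_quasiIso N) _).1 h3
  exact ⟨φ, hφ, fun M n => hq.precomp_bijective hπ.1 (bar_isCofibrant N) M n⟩

end DGMod

/-! ### Contraction of the bar construction onto cohomology -/

theorem CDGA.exists_contraction (A : CDGA.{u}) :
    ∃ r : Contraction A.gr A.d A.H.gr, ∀ z : A.cocycles, r.π z = A.hmk z :=
  exists_contraction_cohomology A.internal A.d A.d_mem A.d_d A.cocycles.val.toLinearMap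
    Subtype.val_injective
    (fun v => ⟨fun h => ⟨⟨v, h⟩, rfl⟩, by rintro ⟨z, rfl⟩; exact A.d_coe z⟩)
    A.cls.toLinearMap A.cls_surjective A.cls_eq_zero

theorem DGMod.exists_contraction {A : CDGA.{u}} (M : DGMod.{u} A) :
    ∃ r : Contraction M.gr M.d M.H.gr, ∀ z : LinearMap.ker M.d, r.π z = M.hmk z :=
  exists_contraction_cohomology M.internal M.d M.d_mem M.d_d (LinearMap.ker M.d).subtype
    Subtype.val_injective
    (fun v => ⟨fun h => ⟨⟨v, h⟩, rfl⟩, by rintro ⟨z, rfl⟩; exact M.d_coe z⟩)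
    M.cls M.cls_surjective M.cls_eq_zero

namespace CDGA

variable (A : CDGA.{u})

/-- A chosen contraction of `A` onto its cohomology. -/
noncomputable def contraction : Contraction A.gr A.d A.H.gr := A.exists_contraction.choose

theorem contraction_π (z : A.cocycles) : A.contraction.π z = A.hmk z :=
  A.exists_contraction.choose_spec z

theorem contraction_π_one : A.contraction.π 1 = 1 := A.contraction_π 1

/-- The homotopy kills `1`, since `A` has no elements of degree `-1`. This makes the contraction of the
bar construction compatible with normalisation. -/
theorem contraction_η_one : A.contraction.η 1 = 0 := by
  have := A.contraction.η_mem 0 1 A.one_mem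
  rwa [A.nonneg _ (by norm_num), Submodule.mem_bot] at this

theorem contraction_ι_one : A.contraction.ι 1 = 1 := by
  have := A.contraction.homotopy 1
  rw [contraction_η_one, contraction_π_one, A.d_one, map_zero, map_zero, add_zero] at this
  exact (sub_eq_zero.1 this.symm).symm

theorem contraction_π_mul_ι {z : A} (hz : A.d z = 0) (b : A.H) :
    A.contraction.π (z * A.contraction.ι b) = A.contraction.π z * b := by
  have h := A.contraction_π (⟨z, hz⟩ * ⟨A.contraction.ι b, A.contraction.d_ι b⟩)
  have h1 := A.contraction_π ⟨z, hz⟩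
  have h2 := A.contraction_π ⟨A.contraction.ι b, A.contraction.d_ι b⟩
  rw [A.contraction.π_ι] at h2
  exact h.trans (congrArg₂ (· * ·) h1.symm h2.symm)

end CDGA

namespace DGMod

open GMod

variable {A : CDGA.{u}} (N : DGMod.{u} A)

/-- A chosen contraction of a differential graded module onto its cohomology. -/
noncomputable def contraction : Contraction N.gr N.d N.H.gr := N.exists_contraction.choose

theorem contraction_π (z : LinearMap.ker N.d) : N.contraction.π z = N.hmk z :=
  N.exists_contraction.choose_spec z

theorem contraction_π_smul {z : A} (hz : A.d z = 0) {x : N} (hx : N.d x = 0) :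
    N.contraction.π (z • x) = A.contraction.π z • N.contraction.π x := by
  have hd : N.d (z • x) = 0 := by rw [d_smul, hz, hx, zero_smul, smul_zero, add_zero]
  have h := N.contraction_π ⟨_, hd⟩
  have h1 := A.contraction_π ⟨z, hz⟩
  have h2 := N.contraction_π ⟨x, hx⟩
  rw [h1, h2]
  exact h

section Tensor

variable {M : GMod.{u} A.toGAlg} {M' : GMod.{u} A.H} {δ : M →ₗ[ℚ] M}
  (r : Contraction M.gr δ M'.gr)

/-- The map `ι ⊗ ι` for the contractions of `A` and of `M`. -/
noncomputable def tensι : M'.tens →ₗ[ℚ] M.tens :=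
  (TensorProduct.map A.contraction.ι r.ι : A.H ⊗[ℚ] M' →ₗ[ℚ] A ⊗[ℚ] M)

/-- The map `π ⊗ π` for the contractions of `A` and of `M`. -/
noncomputable def tensπ : M.tens →ₗ[ℚ] M'.tens :=
  (TensorProduct.map A.contraction.π r.π : A ⊗[ℚ] M →ₗ[ℚ] A.H ⊗[ℚ] M')

/-- The homotopy `η ⊗ ι π ± 1 ⊗ η` for the contractions of `A` and of `M`. -/
noncomputable def tensη : M.tens →ₗ[ℚ] M.tens :=
  (TensorProduct.map A.contraction.η (r.ι.comp r.π) + TensorProduct.map A.σ r.η :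
    A ⊗[ℚ] M →ₗ[ℚ] A ⊗[ℚ] M)

theorem tensι_tmul (a : A.H) (y : M') :
    tensι r (M'.tmul a y) = M.tmul (A.contraction.ι a) (r.ι y) := rfl

theorem tensπ_tmul (a : A) (x : M) :
    tensπ r (M.tmul a x) = M'.tmul (A.contraction.π a) (r.π x) := rfl

theorem tensη_tmul (a : A) (x : M) :
    tensη r (M.tmul a x) = M.tmul (A.contraction.η a) (r.ι (r.π x)) + M.tmul (A.σ a) (r.η x) := rfl

theorem tensDiff_tmul (a : A) (x : M) :
    tensDiff M δ (M.tmul a x) = M.tmul (A.d a) x + M.tmul (A.σ a) (δ x) := rfl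

theorem _root_.HyperExt.GMod.tmul_zero {R : GAlg.{u}} (M : GMod.{u} R) (a : R) :
    M.tmul a 0 = 0 := TensorProduct.tmul_zero _ a

theorem _root_.HyperExt.GMod.zero_tmul {R : GAlg.{u}} (M : GMod.{u} R) (x : M) :
    M.tmul 0 x = 0 := TensorProduct.zero_tmul _ x

theorem _root_.HyperExt.GMod.tmul_sub {R : GAlg.{u}} (M : GMod.{u} R) (a : R) (x y : M) :
    M.tmul a (x - y) = M.tmul a x - M.tmul a y := TensorProduct.tmul_sub a x y

theorem _root_.HyperExt.GMod.sub_tmul {R : GAlg.{u}} (M : GMod.{u} R) (a b : R) (x : M) :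
    M.tmul (a - b) x = M.tmul a x - M.tmul b x := TensorProduct.sub_tmul a b x

theorem _root_.HyperExt.GMod.neg_tmul {R : GAlg.{u}} (M : GMod.{u} R) (a : R) (x : M) :
    M.tmul (-a) x = -M.tmul a x := TensorProduct.neg_tmul a x

/-- The tensor product of the contraction of `A` with a contraction of `M`. -/
noncomputable def tensContraction : Contraction M.tens.gr (tensDiff M δ) M'.tens.gr where
  ι := tensι r
  π := tensπ r
  η := tensη r
  ι_mem n := tens_gr_le (S := (M.tens.gr n).comap (tensι r)) (by
    rintro i j rfl a ha x hx
    exact tmul_mem (A.contraction.ι_mem i a ha) (r.ι_mem j x hx))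
  π_mem n := tens_gr_le (S := (M'.tens.gr n).comap (tensπ r)) (by
    rintro i j rfl a ha x hx
    exact tmul_mem (A.contraction.π_mem i a ha) (r.π_mem j x hx))
  η_mem n := tens_gr_le (S := (M.tens.gr (n - 1)).comap (tensη r)) (by
    rintro i j rfl a ha x hx
    have h1 := tmul_mem (A.contraction.η_mem i a ha) (r.ι_mem j _ (r.π_mem j x hx))
    have h2 := tmul_mem (parity_mem A.internal ha) (r.η_mem j x hx)
    rw [sub_add_eq_add_sub] at h1
    rw [← add_sub_assoc] at h2
    exact add_mem h1 h2)
  d_ι := tens_induction (by simp) (fun x y hx hy => by simp only [map_add, hx, hy, add_zero])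
    fun a y => by
      rw [tensι_tmul, tensDiff_tmul, A.contraction.d_ι, r.d_ι, zero_tmul, tmul_zero, add_zero]
  π_d := tens_induction (by simp) (fun x y hx hy => by simp only [map_add, hx, hy, add_zero])
    fun a x => by
      rw [tensDiff_tmul, map_add, tensπ_tmul, tensπ_tmul, A.contraction.π_d, r.π_d, zero_tmul,
        tmul_zero, add_zero]
  π_ι := tens_induction (by simp) (fun x y hx hy => by simp only [map_add, hx, hy])
    fun a x => by rw [tensι_tmul, tensπ_tmul, A.contraction.π_ι, r.π_ι]
  homotopy := tens_induction (by simp)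
    (fun x y hx hy => by
      simp only [map_add]
      rw [add_add_add_comm, hx, hy]
      abel)
    fun a x => by
      rw [tensη_tmul, tensDiff_tmul, map_add, map_add, tensDiff_tmul, tensDiff_tmul, tensη_tmul,
        tensη_tmul, tensπ_tmul, tensι_tmul, r.d_ι, r.π_d, map_zero, parity_parity,
        parity_shift _ A.d_mem, eq_sub_of_add_eq (A.contraction.homotopy a),
        eq_sub_of_add_eq (r.homotopy x)]
      simp only [sub_tmul, tmul_sub, neg_tmul, tmul_zero]
      abel

end Tensor

/-- The contraction of `A ⊗ ⋯ ⊗ A ⊗ N` onto `H(A) ⊗ ⋯ ⊗ H(A) ⊗ H(N)`. -/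
noncomputable def barContraction :
    (k : ℕ) → Contraction (barT N.toGMod k).gr (barDiff N k) (barT N.H k).gr
  | 0 => N.contraction
  | k + 1 => tensContraction (barContraction k)

theorem barContraction_ι_btmul {k : ℕ} (a : A.H) (y : barT N.H k) :
    (barContraction N (k + 1)).ι (btmul N.H a y)
      = btmul N.toGMod (A.contraction.ι a) ((barContraction N k).ι y) := rfl

theorem barContraction_π_btmul {k : ℕ} (a : A) (x : barT N.toGMod k) :
    (barContraction N (k + 1)).π (btmul N.toGMod a x)
      = btmul N.H (A.contraction.π a) ((barContraction N k).π x) := rfl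

theorem barContraction_η_btmul {k : ℕ} (a : A) (x : barT N.toGMod k) :
    (barContraction N (k + 1)).η (btmul N.toGMod a x)
      = btmul N.toGMod (A.contraction.η a) ((barContraction N k).ι ((barContraction N k).π x))
        + btmul N.toGMod (A.σ a) ((barContraction N k).η x) := rfl

theorem _root_.HyperExt.GMod.btmul_mem_insSpan {R : GAlg.{u}} (N : GMod.{u} R) {k : ℕ} (a : R)
    {x : barT N k} (hx : x ∈ insSpan N k) : btmul N a x ∈ insSpan N (k + 1) :=
  degenerate_le_insSpan N k _ (btmul_mem_degenerate N k a x hx)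

theorem _root_.HyperExt.GMod.one_btmul_mem_insSpan {R : GAlg.{u}} (N : GMod.{u} R) {k : ℕ}
    (x : barT N k) : btmul N 1 x ∈ insSpan N (k + 1) := by
  rw [← bunit_apply, ← ins_zero]
  exact ins_mem_insSpan N (by omega) x

/-- Like `π` and `η` below, the map `ι` preserves the span of the elements with a factor `1`, so that
the contraction passes to the normalisation. -/
theorem barContraction_ι_insSpan : ∀ k, ∀ y ∈ insSpan N.H k,
    (barContraction N k).ι y ∈ insSpan N.toGMod k
  | 0 => fun y hy => by rw [mem_insSpan_zero N.H hy, map_zero]; exact zero_mem _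
  | k + 1 => insSpan_succ_induction' N.H
      (P := fun y => (barContraction N (k + 1)).ι y ∈ insSpan N.toGMod (k + 1))
      (by rw [map_zero]; exact zero_mem _)
      (fun x y hx hy => by rw [map_add]; exact add_mem hx hy)
      (fun y => by
        rw [barContraction_ι_btmul, A.contraction_ι_one]
        exact one_btmul_mem_insSpan _ _)
      (fun a w hw => by
        rw [barContraction_ι_btmul]
        exact btmul_mem_insSpan _ _ (barContraction_ι_insSpan k w hw))

theorem barContraction_π_insSpan : ∀ k, ∀ x ∈ insSpan N.toGMod k,
    (barContraction N k).π x ∈ insSpan N.H k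
  | 0 => fun y hy => by rw [mem_insSpan_zero N.toGMod hy, map_zero]; exact zero_mem _
  | k + 1 => insSpan_succ_induction' N.toGMod
      (P := fun y => (barContraction N (k + 1)).π y ∈ insSpan N.H (k + 1))
      (by rw [map_zero]; exact zero_mem _)
      (fun x y hx hy => by rw [map_add]; exact add_mem hx hy)
      (fun y => by
        rw [barContraction_π_btmul]
        erw [A.contraction_π_one]
        exact one_btmul_mem_insSpan _ _)
      (fun a w hw => by
        rw [barContraction_π_btmul]
        exact btmul_mem_insSpan _ _ (barContraction_π_insSpan k w hw))

theorem barContraction_η_insSpan : ∀ k, ∀ x ∈ insSpan N.toGMod k,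
    (barContraction N k).η x ∈ insSpan N.toGMod k
  | 0 => fun y hy => by rw [mem_insSpan_zero N.toGMod hy, map_zero]; exact zero_mem _
  | k + 1 => insSpan_succ_induction' N.toGMod
      (P := fun y => (barContraction N (k + 1)).η y ∈ insSpan N.toGMod (k + 1))
      (by rw [map_zero]; exact zero_mem _)
      (fun x y hx hy => by rw [map_add]; exact add_mem hx hy)
      (fun y => by
        rw [barContraction_η_btmul]
        erw [A.contraction_η_one, A.σ_one]
        rw [zero_btmul, zero_add]
        exact one_btmul_mem_insSpan _ _)
      (fun a w hw => by
        rw [barContraction_η_btmul]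
        exact add_mem (btmul_mem_insSpan _ _ (barContraction_ι_insSpan N k _
          (barContraction_π_insSpan N k w hw)))
          (btmul_mem_insSpan _ _ (barContraction_η_insSpan k w hw)))

theorem barContraction_π_smul_ι {z : A} (hz : A.d z = 0) : ∀ (k : ℕ) (y : barT N.H k),
    (barContraction N k).π (z • (barContraction N k).ι y) = A.contraction.π z • y
  | 0 => fun y => (N.contraction_π_smul hz (N.contraction.d_ι y)).trans
      (congrArg (A.contraction.π z • ·) (N.contraction.π_ι y))
  | k + 1 => bar_induction N.H (by simp) (fun x y hx hy => by simp only [map_add, smul_add, hx, hy])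
      fun a y => by
        rw [barContraction_ι_btmul, smul_btmul, barContraction_π_btmul, A.contraction_π_mul_ι hz,
          (barContraction N k).π_ι, smul_btmul]

/-- On representing cocycles, the boundary of the bar construction of `N` represents the boundary of
the bar construction of `H(N)`. -/
theorem barContraction_π_bd_ι : ∀ (k : ℕ) (y : barT N.H (k + 1)),
    (barContraction N k).π (bd N.toGMod k ((barContraction N (k + 1)).ι y)) = bd N.H k y
  | 0 => by
    refine bar_induction N.H (P := fun y => (barContraction N 0).π
      (bd N.toGMod 0 ((barContraction N 1).ι y)) = bd N.H 0 y) (by simp)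
      (fun x y hx hy => by simp only [map_add, hx, hy]) fun a y => ?_
    rw [barContraction_ι_btmul, bd_zero, bd_zero, bact_btmul, bact_btmul,
      barContraction_π_smul_ι N (A.contraction.d_ι a), A.contraction.π_ι]
  | k + 1 => by
    refine bar_induction N.H (P := fun y => (barContraction N (k + 1)).π
      (bd N.toGMod (k + 1) ((barContraction N (k + 2)).ι y)) = bd N.H (k + 1) y) (by simp)
      (fun x y hx hy => by simp only [map_add, hx, hy]) fun a y => ?_
    rw [barContraction_ι_btmul, bd_succ, bd_succ, map_sub,
      barContraction_π_smul_ι N (A.contraction.d_ι a), A.contraction.π_ι, barContraction_π_btmul,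
      A.contraction.π_ι, barContraction_π_bd_ι k]

theorem barContraction_ι_degenerate (k : ℕ) : ∀ y ∈ degenerate N.H k,
    (barContraction N (k + 1)).ι y ∈ degenerate N.toGMod k :=
  degenerate_induction N.H (by rw [map_zero]; exact zero_mem _)
    (fun x y hx hy => by rw [map_add]; exact add_mem hx hy)
    fun a y hy => by
      rw [barContraction_ι_btmul]
      exact btmul_mem_degenerate _ _ _ _ (barContraction_ι_insSpan N k y hy)

/-- The map `H(A) ⊗ (H(A)/ℚ)^{⊗ k} ⊗ H(N) → A ⊗ (A/ℚ)^{⊗ k} ⊗ N` that picks representing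
cocycles. -/
noncomputable def normRep (k : ℕ) : normBar N.H k →ₗ[ℚ] normBar N.toGMod k :=
  (((degenerate N.H k).restrictScalars ℚ).mapQ ((degenerate N.toGMod k).restrictScalars ℚ)
    (barContraction N (k + 1)).ι (barContraction_ι_degenerate N k) :)

theorem normRep_mk (k : ℕ) (y : barT N.H (k + 1)) :
    normRep N k (normMk N.H k y) = normMk N.toGMod k ((barContraction N (k + 1)).ι y) := rfl

theorem normDiff_normRep (k : ℕ) (y : normBar N.H k) : normDiff N k (normRep N k y) = 0 := by
  obtain ⟨y, rfl⟩ := normMk_surjective N.H k y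
  rw [normRep_mk, normDiff_mk, (barContraction N (k + 1)).d_ι, map_zero]

/-- If `x` and `y` are as in `IsClassOf`, then `x` is a cocycle of degree `j` whose class, under the
contraction of the bar construction, is `y`. -/
theorem IsClassOf.spec : ∀ {k : ℕ} {j : ℤ} {x : barT N.toGMod k} {y : barT N.H k},
    IsClassOf N k j x y →
      x ∈ (barT N.toGMod k).gr j ∧ barDiff N k x = 0 ∧ (barContraction N k).π x = y
  | 0, j, x, y => by
    rintro ⟨z, hz, rfl, rfl⟩
    exact ⟨hz, N.d_coe z, N.contraction_π z⟩
  | k + 1, j, x, y => by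
    rintro ⟨i, a, x', y', ha, h, rfl, rfl⟩
    obtain ⟨h1, h2, h3⟩ := IsClassOf.spec h
    refine ⟨?_, ?_, ?_⟩
    · have := btmul_mem N.toGMod ha h1
      rwa [add_sub_cancel] at this
    · rw [barDiff_btmul, A.d_coe, h2, zero_btmul, btmul_zero, add_zero]
    · rw [barContraction_π_btmul, A.contraction_π, h3]

end DGMod

namespace DGMod

open GMod

variable {A : CDGA.{u}} {N M : DGMod.{u} A}

/-! ### Cochains on the bar construction -/

/-- The cochain on the bar construction that is given by `ψ k` on the `k`-th summand. -/
noncomputable def barCochain (ψ : ∀ k, normBar N.toGMod k →ₗ[ℚ] M) : bar N →ₗ[ℚ] M :=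
  barLift (V := M) ψ

theorem barCochain_inc (ψ : ∀ k, normBar N.toGMod k →ₗ[ℚ] M) (k : ℕ) (x : normBar N.toGMod k) :
    barCochain ψ (barInc N k x) = ψ k x := barLift_inc N ψ k x

theorem barCochain_mem_homDeg (ψ : ∀ k, normBar N.toGMod k →ₗ[ℚ] M) {n : ℤ}
    (h : ∀ (k : ℕ) (j : ℤ), ∀ x ∈ (normBar N.toGMod k).gr (j + k), ψ k x ∈ M.gr (j + n))
    (h' : ∀ (k : ℕ) (i : ℤ), ∀ a ∈ A.gr i, ∀ x, ψ k (a • x) = sgn (n * i) • a • ψ k x) :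
    barCochain ψ ∈ homDeg (bar N).toGMod M.toGMod n := by
  refine ⟨fun j => ?_, fun i a ha x => ?_⟩
  · refine barGr_induction N (P := fun x => barCochain ψ x ∈ M.gr (j + n))
      ?_ (fun x y hx hy => ?_) fun k x hx => ?_
    · have : barCochain ψ 0 = 0 := map_zero _
      exact this ▸ zero_mem _
    · have : barCochain ψ (x + y) = barCochain ψ x + barCochain ψ y := map_add (barCochain ψ) x y
      exact this ▸ add_mem hx hy
    · exact (barCochain_inc ψ k x).symm ▸ h k j x hx
  · refine barCarrier_induction (P := fun x => barCochain ψ (a • (x : bar N))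
      = sgn (n * i) • a • barCochain ψ x) ?_ (fun x y hx hy => ?_) (fun k x => ?_) x
    · have : barCochain ψ 0 = 0 := map_zero _
      have e : a • (0 : bar N) = 0 := smul_zero a
      refine (congrArg (barCochain ψ) e).trans (this.trans ?_)
      exact (congrArg (fun y => sgn (n * i) • a • y) this).trans (by simp) |>.symm
    · have h1 : barCochain ψ (x + y) = barCochain ψ x + barCochain ψ y := map_add (barCochain ψ) x y
      have h2 : barCochain ψ (a • (x + y : bar N))
          = barCochain ψ (a • (x : bar N)) + barCochain ψ (a • (y : bar N)) :=
        (congrArg (barCochain ψ) (smul_add a (x : bar N) y)).trans (map_add _ _ _)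
      refine h2.trans ?_
      rw [hx, hy]
      refine Eq.trans ?_ (congrArg (fun y => sgn (n * i) • a • y) h1).symm
      rw [smul_add, smul_add]
    · have h1 : a • barInc N k x = barInc N k (a • x) := (map_smul (barInc N k) a x).symm
      have h2 := barCochain_inc ψ k x
      refine (congrArg (barCochain ψ) h1).trans ((barCochain_inc ψ k _).trans ?_)
      rw [h' k i a ha]
      exact (congrArg (fun y => sgn (n * i) • a • y) h2).symm

/-- A map on `A^{⊗ p} ⊗ N` that vanishes on the elements with a factor `1` extends to a cochain
that is supported on the `p`-th summand of the bar construction. -/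
theorem exists_cochain_of_summand {p : ℕ} {n : ℤ} (w : barT N.toGMod p →ₗ[ℚ] M)
    (hw : ∀ v ∈ insSpan N.toGMod p, w v = 0)
    (hw' : ∀ (j : ℤ), ∀ v ∈ (barT N.toGMod p).gr j, w v ∈ M.gr (j + (n - p))) :
    ∃ f ∈ skelFil N M p n, ∀ v, f (barInc N p (normOne N.toGMod p v)) = w v := by
  let ψ : ∀ k, normBar N.toGMod k →ₗ[ℚ] M := Pi.single p (normExt n w hw)
  have ψ_same : ψ p = normExt n w hw := Pi.single_eq_same _ _
  have ψ_ne : ∀ k, k ≠ p → ψ k = 0 := fun k hk => Pi.single_eq_of_ne hk _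
  refine ⟨barCochain ψ, ⟨barCochain_mem_homDeg ψ (fun k j x hx => ?_) fun k i a ha x => ?_,
    fun k hk x => ?_⟩, fun v => ?_⟩
  · by_cases hk : k = p
    · subst hk
      have := normExt_mem n w hw hw' _ x hx
      rw [ψ_same]
      rwa [show j + k + (n - k) = j + n by ring] at this
    · rw [ψ_ne k hk]; exact zero_mem _
  · by_cases hk : k = p
    · subst hk
      rw [ψ_same, normExt_smul, twist_of_mem _ _ ha, smul_assoc]
    · rw [ψ_ne k hk]; simp
  · rw [barCochain_inc, ψ_ne k (by omega)]; rfl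
  · rw [barCochain_inc, ψ_same]
    exact normExt_one n w hw v

theorem mem_skelFil_succ {p : ℕ} {n : ℤ} {f : bar N →ₗ[ℚ] M} (hf : f ∈ skelFil N M p n)
    (h : ∀ v, f (barInc N p (normOne N.toGMod p v)) = 0) : f ∈ skelFil N M (p + 1) n := by
  refine ⟨hf.1, fun k hk x => ?_⟩
  by_cases hkp : k < p
  · exact hf.2 k (by omega) x
  · obtain rfl : k = p := by omega
    refine normBar_induction N.toGMod (P := fun x => f (barInc N k x) = 0) (by simp)
      (fun x y hx hy => by simp only [map_add, hx, hy, add_zero]) (fun i a ha v => ?_) x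
    rw [normMk_btmul, map_smul, hf.1.2 i a ha]
    have := h v
    rw [normOne_apply] at this
    rw [this, smul_zero, smul_zero]

theorem homD_barInc {p : ℕ} {n : ℤ} {f : bar N →ₗ[ℚ] M} (hf : f ∈ skelFil N M p n)
    (x : normBar N.toGMod p) :
    homD (bar N) M n f (barInc N p x)
      = M.d (f (barInc N p x)) - sgn n • f (barInc N p (normDiff N p x)) := by
  have h : f ((bar N).d (barInc N p x)) = f (barInc N p (normDiff N p x)) := by
    match p with
    | 0 => exact congrArg f (barD_zero N x)
    | p + 1 =>
      have e : (bar N).d (barInc N (p + 1) x) = barInc N (p + 1) (normDiff N (p + 1) x) +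
        barInc N p (normBd N.toGMod p
          (parity (normBar N.toGMod (p + 1)).internal x)) := barD_succ N p x
      rw [e, map_add, hf.2 p (by omega), add_zero]
  rw [homD_apply, h]

theorem homD_barInc_succ {p : ℕ} (n : ℤ) (f : bar N →ₗ[ℚ] M)
    (x : normBar N.toGMod (p + 1)) :
    homD (bar N) M n f (barInc N (p + 1) x)
      = M.d (f (barInc N (p + 1) x)) - sgn n • (f (barInc N (p + 1) (normDiff N (p + 1) x))
        + f (barInc N p (normBd N.toGMod p (parity (normBar N.toGMod (p + 1)).internal x)))) := by
  have e : (bar N).d (barInc N (p + 1) x) = barInc N (p + 1) (normDiff N (p + 1) x) +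
    barInc N p (normBd N.toGMod p
      (parity (normBar N.toGMod (p + 1)).internal x)) := barD_succ N p x
  rw [homD_apply, e, map_add]

theorem homD_barInc_one {p : ℕ} {n : ℤ} {f : bar N →ₗ[ℚ] M} (hf : f ∈ skelFil N M p n)
    (v : barT N.toGMod p) :
    homD (bar N) M n f (barInc N p (normOne N.toGMod p v))
      = M.d (f (barInc N p (normOne N.toGMod p v)))
        - sgn n • f (barInc N p (normOne N.toGMod p (barDiff N p v))) := by
  rw [homD_barInc hf, normOne_apply, normDiff_one]
  rfl

/-! ### The leading term of a cochain on cohomology -/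

variable (N M) in
/-- The map `H(A) ⊗ (H(A)/ℚ)^{⊗ p} ⊗ H(N) → H(M)` that a cochain in the `p`-th step of the
filtration induces on cohomology, with the sign `(-1)^{p j}` in degree `j`. The sign turns a cochain
of degree `p + q` into a map of degree `q` that is linear up to the sign required in degree `q`. -/
noncomputable def symbol (p : ℕ) : (bar N →ₗ[ℚ] M) →ₗ[ℚ] (normBar N.H p →ₗ[ℚ] M.H) where
  toFun f := M.contraction.π.comp (f.comp (((barInc N p).restrictScalars ℚ).comp
    ((normRep N p).comp (twist (normBar N.H p).internal p))))
  map_add' _ _ := LinearMap.ext fun _ => map_add M.contraction.π _ _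
  map_smul' c _ := LinearMap.ext fun _ => map_smul M.contraction.π c _

theorem symbol_apply {p : ℕ} (f : bar N →ₗ[ℚ] M) {j : ℤ} {x : normBar N.H p}
    (hx : x ∈ (normBar N.H p).gr j) :
    symbol N M p f x = sgn (p * j) • M.contraction.π (f (barInc N p (normRep N p x))) := by
  change M.contraction.π (f (barInc N p (normRep N p (twist (normBar N.H p).internal p x)))) = _
  rw [twist_of_mem _ _ hx, map_smul]
  have : barInc N p (sgn (p * j) • normRep N p x) = sgn (p * j) • barInc N p (normRep N p x) :=
    map_smul ((barInc N p).restrictScalars ℚ) _ _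
  rw [this, map_smul, map_smul]

theorem symbol_eq_zero {p : ℕ} {n : ℤ} {f : bar N →ₗ[ℚ] M} (hf : f ∈ skelFil N M (p + 1) n) :
    symbol N M p f = 0 := by
  refine ext_graded _ fun j x hx => ?_
  rw [symbol_apply f hx, hf.2 p (by omega), map_zero, smul_zero]
  rfl

section

variable {p : ℕ} {n : ℤ} {f : bar N →ₗ[ℚ] M}

/-- On the `p`-th summand, a cochain in `Z_1^p` is a chain map up to a sign. -/
theorem apply_normDiff (hf : f ∈ skelFil N M p n)
    (hdf : homD (bar N) M n f ∈ skelFil N M (p + 1) (n + 1))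
    (x : normBar N.toGMod p) :
    f (barInc N p (normDiff N p x)) = sgn n • M.d (f (barInc N p x)) := by
  have h := homD_barInc hf x
  rw [hdf.2 p (by omega), eq_comm, sub_eq_zero] at h
  rw [h, smul_smul, sgn_sq, one_smul]

theorem d_apply_eq_zero (hf : f ∈ skelFil N M p n)
    (hdf : homD (bar N) M n f ∈ skelFil N M (p + 1) (n + 1))
    {x : barT N.toGMod (p + 1)} (hx : barDiff N (p + 1) x = 0) :
    M.d (f (barInc N p (normMk N.toGMod p x))) = 0 := by
  have h := apply_normDiff hf hdf (normMk N.toGMod p x)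
  rw [normDiff_mk, hx, map_zero, map_zero, map_zero, eq_comm] at h
  rw [← one_smul ℚ (M.d _), ← sgn_sq n, mul_smul, h, smul_zero]

/-- The symbol of a cochain in `Z_1^p` may be computed from any representing cocycles. -/
theorem symbol_normMk (hf : f ∈ skelFil N M p n)
    (hdf : homD (bar N) M n f ∈ skelFil N M (p + 1) (n + 1))
    {j : ℤ} {x : barT N.toGMod (p + 1)} (hxj : x ∈ (barT N.toGMod (p + 1)).gr j)
    (hx : barDiff N (p + 1) x = 0) :
    symbol N M p f (normMk N.H p ((barContraction N (p + 1)).π x))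
      = sgn (p * j) • M.contraction.π (f (barInc N p (normMk N.toGMod p x))) := by
  have h := (barContraction N (p + 1)).homotopy x
  rw [hx, map_zero, add_zero] at h
  have h2 : normMk N.toGMod p x = normRep N p (normMk N.H p ((barContraction N (p + 1)).π x))
      + normDiff N p (normMk N.toGMod p ((barContraction N (p + 1)).η x)) := by
    rw [normDiff_mk, normRep_mk, ← map_add, h, add_sub_cancel]
  have h3 : normMk N.H p ((barContraction N (p + 1)).π x) ∈ (normBar N.H p).gr j :=
    normMk_degPres N.H p j _ ((barContraction N (p + 1)).π_mem j x hxj)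
  rw [symbol_apply f h3, h2, map_add, map_add, map_add, apply_normDiff hf hdf, map_smul,
    M.contraction.π_d, smul_zero,
    add_zero]

/-- The symbol is linear over `H(A)`, although the representatives that define it are not chosen in an
`H(A)`-linear way. -/
theorem symbol_mem_homDeg (hf : f ∈ skelFil N M p n)
    (hdf : homD (bar N) M n f ∈ skelFil N M (p + 1) (n + 1))
    {q : ℤ} (hq : n = p + q) :
    symbol N M p f ∈ homDeg (normBar N.H p) M.H q := by
  refine ⟨fun j x hx => ?_, fun i b hb x => ?_⟩
  · obtain ⟨y, hy, rfl⟩ := exists_of_mem_normBar_gr _ hx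
    rw [symbol_apply f hx, normRep_mk]
    have h1 := normMk_degPres N.toGMod p j _ ((barContraction N (p + 1)).ι_mem j y hy)
    have h2 := hf.1.1 (j - p) _ (inc_mem N (by rwa [sub_add_cancel]))
    rw [hq, show j - p + (p + q) = j + q by ring] at h2
    exact Submodule.smul_mem _ _ (M.contraction.π_mem _ _ h2)
  · obtain ⟨y, rfl⟩ := normMk_surjective N.H p x
    induction y using graded_induction (barT N.H (p + 1)).internal with
    | h0 => simp
    | hadd x y hx hy => simp only [map_add, smul_add, hx, hy]
    | hgr j y hy =>
      let z := A.contraction.ι b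
      let Y := (barContraction N (p + 1)).ι y
      have hz : A.d z = 0 := A.contraction.d_ι b
      have hY : barDiff N (p + 1) Y = 0 := (barContraction N (p + 1)).d_ι y
      have hYj : Y ∈ (barT N.toGMod (p + 1)).gr j := (barContraction N (p + 1)).ι_mem j y hy
      have hzi : z ∈ A.gr i := A.contraction.ι_mem i b hb
      have hyj : normMk N.H p y ∈ (normBar N.H p).gr j := normMk_degPres N.H p j _ hy
      have hzY : barDiff N (p + 1) (z • Y) = 0 := by
        rw [barDiff_smul, hz, hY, zero_smul, smul_zero, add_zero]
      have h1 := symbol_normMk hf hdf ((barT N.toGMod (p + 1)).smul_mem hzi hYj) hzY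
      rw [barContraction_π_smul_ι N hz, A.contraction.π_ι, map_smul (normMk N.H p),
        map_smul (normMk N.toGMod p), map_smul (barInc N p), hf.1.2 i z hzi,
        map_smul M.contraction.π, M.contraction_π_smul hz (d_apply_eq_zero hf hdf hY),
        A.contraction.π_ι] at h1
      rw [h1, symbol_apply f hyj, normRep_mk, smul_comm b, smul_smul, smul_smul]
      congr 1
      rw [← sgn_add, ← sgn_add, hq, show (p : ℤ) * (i + j) + (p + q) * i
        = p * i + p * i + (q * i + p * j) by ring, sgn_add, sgn_add (p * i), sgn_sq, one_mul]

/-- The first differential of the spectral sequence is, up to sign, the differential of the complex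
of maps from the normalised bar construction of `H(N)` to `H(M)`. -/
theorem symbol_homD (hf : f ∈ skelFil N M p n)
    (hdf : homD (bar N) M n f ∈ skelFil N M (p + 1) (n + 1)) :
    symbol N M (p + 1) (homD (bar N) M n f)
      = -sgn n • (symbol N M p f).comp ((normBd N.H p).restrictScalars ℚ) := by
  refine ext_graded _ fun j x hx => ?_
  obtain ⟨y, hy, rfl⟩ := exists_of_mem_normBar_gr _ hx
  have hI := (barContraction N (p + 2)).ι_mem j y hy
  have hI' : normMk N.toGMod (p + 1) ((barContraction N (p + 2)).ι y)
      ∈ (normBar N.toGMod (p + 1)).gr j := normMk_degPres N.toGMod (p + 1) j _ hI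
  have h1 := symbol_normMk hf hdf (bd_degPres N.toGMod (p + 1) j _ hI) (by
    change barDiff N (p + 1) (bd N.toGMod (p + 1) _) = 0
    rw [← bd_barDiff, (barContraction N (p + 2)).d_ι, map_zero])
  have h1 : symbol N M p f (normMk N.H p ((barContraction N (p + 1)).π
    (bd N.toGMod (p + 1) ((barContraction N (p + 2)).ι y)))) = _ := h1
  rw [barContraction_π_bd_ι] at h1
  have h2 : ((-sgn n • (symbol N M p f).comp ((normBd N.H p).restrictScalars ℚ)) :
    normBar N.H (p + 1) →ₗ[ℚ] M.H) (normMk N.H (p + 1) y)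
      = -sgn n • symbol N M p f (normMk N.H p (bd N.H (p + 1) y)) := rfl
  rw [h2, h1, symbol_apply _ hx, homD_barInc_succ, normDiff_normRep, normRep_mk,
    parity_of_mem _ hI']
  have h3 : barInc N p (normBd N.toGMod p (sgn j • normMk N.toGMod (p + 1)
      ((barContraction N (p + 2)).ι y)))
      = sgn j • barInc N p (normMk N.toGMod p (bd N.toGMod (p + 1)
        ((barContraction N (p + 2)).ι y))) :=
    map_smul (((barInc N p).restrictScalars ℚ).comp ((normBd N.toGMod p).restrictScalars ℚ)) _ _
  rw [h3, map_zero, map_zero, zero_add, map_sub, M.contraction.π_d, zero_sub, map_smul, map_smul,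
    map_smul, smul_neg, smul_smul, smul_smul, smul_smul, ← neg_smul]
  congr 1
  push_cast
  rw [add_mul, one_mul, sgn_add]
  linear_combination -(sgn (p * j) * sgn n) * sgn_sq j

/-- A cochain in `Z_1^p` whose symbol vanishes is a coboundary up to `F^{p+1}`. -/
theorem exists_sub_homD_mem (hf : f ∈ skelFil N M p n)
    (hdf : homD (bar N) M n f ∈ skelFil N M (p + 1) (n + 1))
    (h0 : symbol N M p f = 0) :
    ∃ v ∈ skelFil N M p (n - 1), f - homD (bar N) M (n - 1) v ∈ skelFil N M (p + 1) n := by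
  let r := barContraction N p
  let o : barT N.toGMod p →ₗ[ℚ] M := f.comp (((barInc N p).restrictScalars ℚ).comp
    (normOne N.toGMod p))
  have o_def : ∀ v, o v = f (barInc N p (normOne N.toGMod p v)) := fun v => rfl
  have o_mem : ∀ j, ∀ v ∈ (barT N.toGMod p).gr j, o v ∈ M.gr (j + (n - p)) := fun j v hv => by
    have := hf.1.1 (j - p) _ (inc_mem N (by
      rw [sub_add_cancel]
      exact normMk_one_mem _ hv))
    rwa [show j - p + n = j + (n - p) by ring] at this
  have o_ins : ∀ v ∈ insSpan N.toGMod p, o v = 0 := fun v hv => by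
    rw [o_def, normOne_apply, normMk_one_of_mem_insSpan _ hv, map_zero, map_zero]
  have o_d : ∀ v, M.d (o v) = sgn n • o (barDiff N p v) := fun v => by
    have := apply_normDiff hf hdf (normOne N.toGMod p v)
    rw [normOne_apply, normDiff_one] at this
    have this : o (barDiff N p v) = sgn n • M.d (o v) := this
    rw [this, smul_smul, sgn_sq, one_smul]
  have o_ι : ∀ y, M.contraction.π (o (r.ι y)) = 0 := by
    have : (M.contraction.π.comp (o.comp r.ι)) = 0 := by
      refine ext_graded _ fun j y hy => ?_
      have h1 := symbol_apply f (normMk_one_mem N.H hy)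
      rw [h0, normRep_mk, barContraction_ι_btmul, A.contraction_ι_one] at h1
      have h1 : (0 : M.H) = sgn (p * j) • M.contraction.π (o (r.ι y)) := h1
      change M.contraction.π (o (r.ι y)) = 0
      rw [← one_smul ℚ (M.contraction.π _), ← sgn_sq (p * j), mul_smul, ← h1, smul_zero]
    exact fun y => LinearMap.congr_fun this y
  -- the homotopies of `M` and of the bar construction combine to a solution of `d w ± w d = o`
  let w : barT N.toGMod p →ₗ[ℚ] M :=
    M.contraction.η.comp (o.comp (r.ι.comp r.π)) + sgn n • o.comp r.η
  have w_def : ∀ v, w v = M.contraction.η (o (r.ι (r.π v))) + sgn n • o (r.η v) := fun v => rfl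
  have w_ins : ∀ v ∈ insSpan N.toGMod p, w v = 0 := fun v hv => by
    rw [w_def, o_ins _ (barContraction_ι_insSpan N p _ (barContraction_π_insSpan N p v hv)),
      o_ins _ (barContraction_η_insSpan N p v hv), map_zero, smul_zero, add_zero]
  have w_mem : ∀ j, ∀ v ∈ (barT N.toGMod p).gr j, w v ∈ M.gr (j + (n - 1 - p)) := fun j v hv => by
    have h1 := M.contraction.η_mem _ _ (o_mem j _ (r.ι_mem j _ (r.π_mem j v hv)))
    have h2 := o_mem _ _ (r.η_mem j v hv)
    rw [show j + (n - p) - 1 = j + (n - 1 - p) by ring] at h1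
    rw [show j - 1 + (n - p) = j + (n - 1 - p) by ring] at h2
    exact add_mem h1 (Submodule.smul_mem _ _ h2)
  have w_d : ∀ v, M.d (w v) + sgn n • w (barDiff N p v) = o v := fun v => by
    have h1 := M.contraction.homotopy (o (r.ι (r.π v)))
    rw [o_d, r.d_ι, map_zero, smul_zero, map_zero, add_zero, o_ι, map_zero, sub_zero] at h1
    have h2 := congrArg o (r.homotopy v)
    rw [map_add, map_sub] at h2
    rw [w_def, w_def, map_add, h1, map_smul, o_d, smul_smul, sgn_sq, one_smul, r.π_d, map_zero,
      map_zero, map_zero, zero_add, smul_smul, sgn_sq, one_smul, add_assoc, h2,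
      add_sub_cancel]
  obtain ⟨v, hv, hvw⟩ := exists_cochain_of_summand w w_ins w_mem
  have hdv := skelFil_d N M p (n - 1) v hv
  rw [sub_add_cancel] at hdv
  refine ⟨v, hv, mem_skelFil_succ (sub_mem hf hdv) fun x => ?_⟩
  have hs : sgn (n - 1) = -sgn n := by
    have := sgn_add (n - 1) 1
    rw [sub_add_cancel, sgn_one] at this
    rw [this]; ring
  rw [LinearMap.sub_apply, homD_barInc_one hv, hvw, hvw, hs, neg_smul, sub_neg_eq_add, w_d, o_def,
    sub_self]

end

/-- Every map on cohomology is a symbol. -/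
theorem exists_symbol_eq {p : ℕ} {n q : ℤ} (hq : n = p + q) {g : normBar N.H p →ₗ[ℚ] M.H}
    (hg : g ∈ homDeg (normBar N.H p) M.H q) :
    ∃ f ∈ skelFil N M p n, homD (bar N) M n f ∈ skelFil N M (p + 1) (n + 1) ∧
      symbol N M p f = g := by
  let r := barContraction N p
  -- the twist in `M` amounts to the sign `(-1)^{p j}` on the degree `j` part of the source
  let w : barT N.toGMod p →ₗ[ℚ] M := sgn (p * q) • (twist M.internal p).comp
    (M.contraction.ι.comp (g.comp ((normOne N.H p).comp r.π)))
  have w_def : ∀ v, w v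
      = sgn (p * q) • twist M.internal p (M.contraction.ι (g (normOne N.H p (r.π v)))) := fun _ => rfl
  have w_gr : ∀ j, ∀ v ∈ (barT N.toGMod p).gr j,
      w v = sgn (p * j) • M.contraction.ι (g (normOne N.H p (r.π v))) := fun j v hv => by
    have h := M.contraction.ι_mem _ _ (hg.1 j _ (normMk_one_mem N.H (r.π_mem j v hv)))
    rw [← normOne_apply] at h
    rw [w_def, twist_of_mem _ _ h, smul_smul, mul_add, sgn_add, mul_comm, mul_assoc, sgn_sq,
      mul_one]
  have w_ins : ∀ v ∈ insSpan N.toGMod p, w v = 0 := fun v hv => by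
    rw [w_def, normOne_apply, normMk_one_of_mem_insSpan _ (barContraction_π_insSpan N p v hv)]
    simp
  have w_mem : ∀ j, ∀ v ∈ (barT N.toGMod p).gr j, w v ∈ M.gr (j + (n - p)) := fun j v hv => by
    rw [w_gr j v hv, hq, add_sub_cancel_left]
    exact Submodule.smul_mem _ _ (M.contraction.ι_mem _ _ (hg.1 j _
      (normMk_one_mem N.H (r.π_mem j v hv))))
  have d_w : ∀ v, M.d (w v) = 0 := by
    have : M.d.comp w = 0 := ext_graded _ fun j v hv => by
      change M.d (w v) = 0
      rw [w_gr j v hv, map_smul, M.contraction.d_ι, smul_zero]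
    exact fun v => LinearMap.congr_fun this v
  have w_d : ∀ v, w (barDiff N p v) = 0 := by
    have : w.comp (barDiff N p) = 0 := ext_graded _ fun j v hv => by
      change w (barDiff N p v) = 0
      rw [w_gr _ _ (barDiff_mem N p j v hv), r.π_d, map_zero, map_zero, map_zero, smul_zero]
    exact fun v => LinearMap.congr_fun this v
  obtain ⟨f, hf, hfw⟩ := exists_cochain_of_summand w w_ins w_mem
  have hdf : homD (bar N) M n f ∈ skelFil N M (p + 1) (n + 1) :=
    mem_skelFil_succ (skelFil_d N M p n f hf) fun v => by
      rw [homD_barInc_one hf, hfw, hfw, d_w, w_d, smul_zero, sub_zero]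
  refine ⟨f, hf, hdf, homDeg_normBar_ext (symbol_mem_homDeg hf hdf hq) hg fun j y hy => ?_⟩
  rw [symbol_apply f (normMk_one_mem N.H hy), normRep_mk, barContraction_ι_btmul,
    A.contraction_ι_one]
  have h1 : f (barInc N p (normMk N.toGMod p (btmul N.toGMod 1 (r.ι y)))) = w (r.ι y) := hfw _
  refine (congrArg (fun m => sgn (p * j) • M.contraction.π m) h1).trans ?_
  rw [w_gr j _ (r.ι_mem j y hy), r.π_ι, map_smul, M.contraction.π_ι, smul_smul, sgn_sq, one_smul]
  rfl

end DGMod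

namespace DGMod

open GMod

variable {A : CDGA.{u}} {N M : DGMod.{u} A}

/-! ### The second page -/

theorem symbol_induces {p : ℕ} {n : ℤ} {f : bar N →ₗ[ℚ] M} (hf : f ∈ skelFil N M p n)
    (hdf : homD (bar N) M n f ∈ skelFil N M (p + 1) (n + 1)) :
    Induces N M p f (symbol N M p f) := by
  intro j x y hxy
  obtain ⟨hxj, hx, rfl⟩ := hxy.spec
  refine ⟨⟨sgn (p * j) • f (barInc N p (normMk N.toGMod p x)), ?_⟩, rfl, ?_⟩
  · rw [LinearMap.mem_ker, map_smul, d_apply_eq_zero hf hdf hx, smul_zero]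
  · rw [symbol_normMk hf hdf hxj hx, ← M.contraction_π, map_smul]

theorem skelFil_le_of_le {p p' : ℤ} (h : p ≤ p') (n : ℤ) : skelFil N M p' n ≤ skelFil N M p n :=
  (barFilt N M).F_le_of_le h n

theorem homD_mem_of_mem_Z_two {p n : ℤ} {f : bar N →ₗ[ℚ] M} (hf : f ∈ (barFilt N M).Z 2 p n) :
    homD (bar N) M n f ∈ skelFil N M (p + 1) (n + 1) :=
  skelFil_le_of_le (by omega) _ ((barFilt N M).mem_Z.1 hf).2

theorem symbol_mem_cocycles {p : ℕ} {q : ℤ} {f : bar N →ₗ[ℚ] M}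
    (hf : f ∈ (barFilt N M).Z 2 p (p + q)) :
    symbol N M p f ∈ (barComplex N.H).cocycles M.H p q := by
  have hf1 : f ∈ skelFil N M p (p + q) := ((barFilt N M).mem_Z.1 hf).1
  have hf2 : homD (bar N) M (p + q) f ∈ skelFil N M (p + 2) (p + q + 1) :=
    ((barFilt N M).mem_Z.1 hf).2
  have hdf := homD_mem_of_mem_Z_two hf
  refine ⟨symbol_mem_homDeg hf1 hdf rfl, ?_⟩
  have h := symbol_homD hf1 hdf
  rw [symbol_eq_zero (p := p + 1) (n := p + q + 1) (by
    push_cast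
    rwa [add_assoc, one_add_one_eq_two]), eq_comm, smul_eq_zero] at h
  refine h.resolve_left (neg_ne_zero.2 fun h0 => ?_)
  have := sgn_sq (p + q)
  rw [h0, zero_mul] at this
  exact zero_ne_one this

/-- Every cocycle of the complex of maps from the normalised bar construction of `H(N)` to `H(M)` is
the symbol of an element of `Z_2^p`. -/
theorem exists_mem_Z_two_symbol_eq {p : ℕ} {q : ℤ} {g : normBar N.H p →ₗ[ℚ] M.H}
    (hg : g ∈ (barComplex N.H).cocycles M.H p q) :
    ∃ f ∈ (barFilt N M).Z 2 p (p + q), symbol N M p f = g := by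
  obtain ⟨f, hf, hdf, rfl⟩ := exists_symbol_eq (n := p + q) rfl hg.1
  have hg2 : (symbol N M p f).comp ((normBd N.H p).restrictScalars ℚ) = 0 := hg.2
  have h0 := symbol_homD hf hdf
  rw [hg2, smul_zero] at h0
  have hddf : homD (bar N) M (p + q + 1) (homD (bar N) M (p + q) f) = 0 := homD_homD _ _ _ f
  -- the symbol of `d f` vanishes, so `f` may be corrected to have `d f` one step further down
  obtain ⟨v, hv, hfv⟩ := exists_sub_homD_mem (p := p + 1) (n := p + q + 1)
    (by exact_mod_cast hdf) (by rw [hddf]; exact zero_mem _) h0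
  rw [add_sub_cancel_right] at hv hfv
  push_cast at hv hfv
  refine ⟨f - v, (barFilt N M).mem_Z.2
    ⟨sub_mem hf (skelFil_le_of_le (by omega) _ hv), ?_⟩, ?_⟩
  · change homD (bar N) M (p + q) (f - v) ∈ skelFil N M (p + 2) (p + q + 1)
    rw [map_sub]
    rwa [add_assoc, one_add_one_eq_two] at hfv
  · rw [map_sub, symbol_eq_zero hv, sub_zero]

/-- An element of `Z_2^p` with vanishing symbol is zero in `E_2^p`. -/
theorem exists_of_symbol_eq_zero {p : ℕ} {n : ℤ} {f : bar N →ₗ[ℚ] M}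
    (hf : f ∈ skelFil N M p n) (hdf : homD (bar N) M n f ∈ skelFil N M (p + 2) (n + 1))
    (h0 : symbol N M p f = 0) :
    ∃ u : bar N →ₗ[ℚ] M, u ∈ (barFilt N M).Z (2 - 1) (p + 1) n ∧
      ∃ v : bar N →ₗ[ℚ] M, v ∈ (barFilt N M).Z (2 - 1) (p - 2 + 1) (n - 1) ∧
        u + homD (bar N) M (n - 1) v = f := by
  obtain ⟨v, hv, hfv⟩ := exists_sub_homD_mem hf (skelFil_le_of_le (by omega) _ hdf) h0
  have hddv := homD_homD (bar N) M (n - 1) v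
  have hdv := skelFil_d N M p (n - 1) v hv
  rw [sub_add_cancel] at hddv
  refine ⟨_, (barFilt N M).mem_Z.2 ⟨hfv, ?_⟩, v, (barFilt N M).mem_Z.2
    ⟨skelFil_le_of_le (by omega) _ hv, ?_⟩, sub_add_cancel _ _⟩
  · change homD (bar N) M n (f - homD (bar N) M (n - 1) v) ∈ skelFil N M (p + 1 + (2 - 1)) (n + 1)
    rw [map_sub, hddv, sub_zero]
    exact skelFil_le_of_le (by omega) _ hdf
  · change homD (bar N) M (n - 1) v ∈ skelFil N M (p - 2 + 1 + (2 - 1)) (n - 1 + 1)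
    exact skelFil_le_of_le (by omega) _ hdv

/-- Coboundaries of cochains in the same step of the filtration have vanishing symbol. -/
theorem symbol_homD_same {p : ℕ} {n : ℤ} {v : bar N →ₗ[ℚ] M} (hv : v ∈ skelFil N M p n) :
    symbol N M p (homD (bar N) M n v) = 0 := by
  refine ext_graded _ fun j x hx => ?_
  rw [symbol_apply _ hx, homD_barInc hv, normDiff_normRep, map_zero, map_zero, smul_zero, sub_zero,
    M.contraction.π_d, smul_zero]
  rfl

theorem mkE_two_eq_zero_iff {p : ℕ} {q : ℤ} (f : (barFilt N M).Z 2 p (p + q)) :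
    (barFilt N M).mkE 2 p (p + q) f = 0
      ↔ symbol N M p f.1 ∈ (barComplex N.H).coboundaries M.H p q := by
  obtain ⟨f, hf⟩ := f
  change bar N →ₗ[ℚ] M at f
  have hf1 : f ∈ skelFil N M p (p + q) := ((barFilt N M).mem_Z.1 hf).1
  have hf2 : homD (bar N) M (p + q) f ∈ skelFil N M (p + 2) (p + q + 1) :=
    ((barFilt N M).mem_Z.1 hf).2
  rw [FiltCx.mkE_eq_zero]
  constructor
  · rintro ⟨u, hu, v, hv, e⟩
    change bar N →ₗ[ℚ] M at u v
    have e : u + homD (bar N) M (p + q - 1) v = f := e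
    have hu0 : symbol N M p u = 0 := symbol_eq_zero ((barFilt N M).mem_Z.1 hu).1
    have hv1 := ((barFilt N M).mem_Z.1 hv).1
    have hv2 := ((barFilt N M).mem_Z.1 hv).2
    change symbol N M p f ∈ _
    rw [← e, map_add, hu0, zero_add]
    match p with
    | 0 =>
      -- `F^{-1} = F^0`, so there are no incoming differentials
      have hv3 : v ∈ skelFil N M (0 : ℕ) ((0 : ℕ) + q - 1) :=
        ⟨hv1.1, fun k hk x => by omega⟩
      rw [symbol_homD_same hv3]
      exact zero_mem _
    | s + 1 =>
      have hv3 : v ∈ skelFil N M s ((s + 1 : ℕ) + q - 1) :=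
        skelFil_le_of_le (by push_cast; omega) _ hv1
      have hv4 : homD (bar N) M ((s + 1 : ℕ) + q - 1) v
          ∈ skelFil N M (s + 1) ((s + 1 : ℕ) + q - 1 + 1) :=
        skelFil_le_of_le (by push_cast; omega) _ hv2
      rw [symbol_homD hv3 hv4]
      exact Submodule.smul_mem _ _
        ⟨_, symbol_mem_homDeg hv3 hv4 (by push_cast; ring), rfl⟩
  · intro h
    match p with
    | 0 => exact exists_of_symbol_eq_zero hf1 hf2 ((Submodule.mem_bot ℚ).1 h)
    | s + 1 =>
      obtain ⟨g, hg, hgf⟩ := h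
      have hgf : g.comp ((normBd N.H s).restrictScalars ℚ) = symbol N M (s + 1) f := hgf
      obtain ⟨v, hv, hdv, rfl⟩ := exists_symbol_eq (n := (s + 1 : ℕ) + q - 1)
        (by push_cast; ring) hg
      -- adding `± d v`, where `v` has the symbol `g`, makes the symbol of `f` vanish
      let c := sgn ((s + 1 : ℕ) + q - 1)
      have hc : c * c = 1 := sgn_sq _
      have hsv := symbol_homD hv hdv
      replace hsv := hsv.trans (congrArg (-c • ·) hgf)
      have hddv := homD_homD (bar N) M ((s + 1 : ℕ) + q - 1) v
      rw [sub_add_cancel] at hdv hddv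
      obtain ⟨u, hu, v', hv', e⟩ := exists_of_symbol_eq_zero
        (f := f + c • homD (bar N) M ((s + 1 : ℕ) + q - 1) v)
        (add_mem hf1 (Submodule.smul_mem _ c (by exact_mod_cast hdv)))
        (by rw [map_add, map_smul, hddv, smul_zero, add_zero]; exact hf2)
        (by
          rw [map_add, map_smul, hsv, smul_smul, mul_neg, hc, neg_smul, one_smul, add_neg_cancel])
      have hv'' := (barFilt N M).mem_Z.1 hv'
      refine ⟨u, hu, v' - c • v, (barFilt N M).mem_Z.2 ⟨sub_mem hv''.1
        (Submodule.smul_mem _ c (skelFil_le_of_le (by push_cast; omega) _ hv)), ?_⟩, ?_⟩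
      · change homD (bar N) M _ (v' - c • v) ∈ _
        rw [map_sub, map_smul]
        refine sub_mem hv''.2 (Submodule.smul_mem _ c ?_)
        change homD (bar N) M _ v ∈ skelFil N M _ _
        rw [sub_add_cancel]
        exact skelFil_le_of_le (by push_cast; omega) _ hdv
      · change u + homD (bar N) M _ (v' - c • v) = f
        rw [map_sub, map_smul, ← add_sub_assoc, e, add_sub_cancel_right]

/-- The term `E_2^{p,q}` is `Ext^{p,q}`, computed by the normalised bar construction. -/
theorem exists_E_two_equiv (N M : DGMod.{u} A) (p : ℕ) (q : ℤ) :
    ∃ e : (barFilt N M).E 2 p (p + q) ≃ₗ[ℚ] (barComplex N.H).Ext M.H p q,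
      ∀ f : (barFilt N M).Z 2 p (p + q), e ((barFilt N M).mkE 2 p (p + q) f)
        = (barComplex N.H).mkExt M.H p q ⟨_, symbol_mem_cocycles f.2⟩ := by
  let c : (barFilt N M).Z 2 p (p + q) →ₗ[ℚ] (barComplex N.H).cocycles M.H p q :=
    (symbol N M p).restrict fun f hf => symbol_mem_cocycles hf
  refine exists_linearEquiv_of_ker_eq _ (((barComplex N.H).mkExt M.H p q).comp c)
    ((barFilt N M).mkE_surjective _ _ _) (fun x => ?_) fun f => ?_
  · obtain ⟨g, rfl⟩ := (barComplex N.H).mkExt_surjective M.H p q x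
    obtain ⟨f, hf, e⟩ := exists_mem_Z_two_symbol_eq g.2
    exact ⟨⟨f, hf⟩, congrArg ((barComplex N.H).mkExt M.H p q) (Subtype.ext e : c ⟨f, hf⟩ = g)⟩
  · rw [mkE_two_eq_zero_iff, LinearMap.comp_apply, ComplexOver.mkExt_eq_zero]
    rfl

/-- In negative filtration degrees the filtration is constant. -/
theorem E_two_subsingleton {p : ℤ} (hp : p < 0) (n : ℤ) :
    Subsingleton ((barFilt N M).E 2 p n) := by
  refine subsingleton_of_forall_eq 0 fun x => ?_
  obtain ⟨⟨f, hf⟩, rfl⟩ := (barFilt N M).mkE_surjective _ _ _ x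
  have hf' := (barFilt N M).mem_Z.1 hf
  rw [FiltCx.mkE_eq_zero]
  refine ⟨f, (barFilt N M).mem_Z.2 ⟨⟨hf'.1.1, fun k hk => by omega⟩, ?_⟩, 0, zero_mem _, ?_⟩
  · exact skelFil_le_of_le (by omega) _ hf'.2
  · rw [map_zero, add_zero]

/-! ### Vanishing and convergence -/

theorem _root_.HyperExt.CDGA.H_gr_eq_bot (A : CDGA.{u}) {i : ℤ} (hi : A.gr i = ⊥) :
    A.H.gr i = ⊥ := by
  rw [eq_bot_iff]
  rintro _ ⟨z, hz, rfl⟩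
  have hz : (z : A) ∈ A.gr i := hz
  rw [hi, Submodule.mem_bot] at hz
  have : z = 0 := Subtype.ext hz
  rw [this, map_zero]
  exact zero_mem _

theorem _root_.HyperExt.CDGA.exists_eq_smul_one (A : CDGA.{u})
    (hA : A.gr 0 = Submodule.span ℚ {1}) {b : A.H} (hb : b ∈ A.H.gr 0) : ∃ c : ℚ, c • (1 : A.H) = b := by
  obtain ⟨z, hz, rfl⟩ := hb
  have hz : (z : A) ∈ A.gr 0 := hz
  rw [hA, Submodule.mem_span_singleton] at hz
  obtain ⟨c, hc⟩ := hz
  refine ⟨c, ?_⟩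
  have : z = c • 1 := Subtype.ext hc.symm
  rw [this]
  exact ((map_smul A.cls c 1).trans (congrArg (c • ·) (map_one A.cls))).symm

/-- Over a simply connected algebra, the normalised bar construction vanishes in low degrees: each
factor of `H(A)/ℚ` contributes at least two to the degree. -/
theorem mem_insSpan_of_lt (hA : A.IsSimplyConnected) {k : ℤ} (hk : ∀ i < k, N.H.gr i = ⊥) :
    ∀ (p : ℕ) {j : ℤ}, j < 2 * p + k → ∀ y ∈ (barT N.H p).gr j, y ∈ insSpan N.H p
  | 0, j, hj, y, hy => by
    have hy : y ∈ N.H.gr j := hy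
    rw [hk j (by simpa using hj)] at hy
    exact hy
  | p + 1, j, hj, y, hy => by
    refine bar_gr_le N.H (S := insSpan N.H (p + 1)) ?_ hy
    rintro i j rfl a ha x hx
    push_cast at hj
    have h0 : A.H.gr i = ⊥ → btmul N.H a x ∈ insSpan N.H (p + 1) := fun h => by
      rw [h, Submodule.mem_bot] at ha
      rw [ha, zero_btmul]
      exact zero_mem _
    rcases lt_trichotomy i 0 with hi | rfl | hi
    · exact h0 (A.H_gr_eq_bot (A.nonneg i hi))
    · obtain ⟨c, rfl⟩ := A.exists_eq_smul_one hA.2.1 ha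
      rw [smul_btmul']
      exact Submodule.smul_mem _ _ (one_btmul_mem_insSpan N.H x)
    · rcases eq_or_ne i 1 with rfl | hi'
      · exact h0 (A.H_gr_eq_bot hA.2.2)
      · exact btmul_mem_insSpan N.H a (mem_insSpan_of_lt hA hk p (by omega) x hx)

/-- In total degree `n = p + q`, the columns `p > l - k - n` of the complex that computes `Ext` vanish. -/
theorem homDeg_normBar_eq_bot (hA : A.IsSimplyConnected) {k l : ℤ} (hk : ∀ i < k, N.H.gr i = ⊥)
    (hl : ∀ i > l, M.H.gr i = ⊥) {p : ℕ} {q : ℤ} (hp : l < 2 * p + k + q) :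
    homDeg (normBar N.H p) M.H q = ⊥ := by
  rw [eq_bot_iff]
  intro g hg
  refine (Submodule.mem_bot ℚ).2 (homDeg_normBar_ext hg (zero_mem _) fun j y hy => ?_)
  by_cases hj : j < 2 * p + k
  · rw [normMk_one_of_mem_insSpan N.H (mem_insSpan_of_lt hA hk p hj y hy), map_zero, map_zero]
  · have := hg.1 j _ (normMk_one_mem N.H hy)
    rw [hl _ (by omega), Submodule.mem_bot] at this
    exact this

/-- The filtration of `[B, M]` is complete: on each summand of `B`, the sequence is eventually
constant. -/
theorem exists_limit {n : ℤ} {w : ℕ → (bar N →ₗ[ℚ] M)}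
    (hw : ∀ m, w m ∈ homDeg (bar N).toGMod M.toGMod n)
    (hw' : ∀ m : ℕ, w (m + 1) - w m ∈ skelFil N M m n) :
    ∃ W : bar N →ₗ[ℚ] M, ∀ m : ℕ, W - w m ∈ skelFil N M m n := by
  let ψ : ∀ k, normBar N.toGMod k →ₗ[ℚ] M := fun k =>
    (w (k + 1)).comp ((barInc N k).restrictScalars ℚ)
  have hψ : ∀ k x, ψ k x = w (k + 1) (barInc N k x) := fun k x => rfl
  refine ⟨barCochain ψ, fun m => ⟨sub_mem (barCochain_mem_homDeg ψ (fun k j x hx => ?_)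
    fun k i a ha x => ?_) (hw m), fun k hk x => ?_⟩⟩
  · exact (hw (k + 1)).1 j _ (inc_mem N hx)
  · rw [hψ, map_smul, (hw (k + 1)).2 i a ha, hψ]
  · have h : ∀ t : ℕ, w (k + 1 + t) (barInc N k x) = w (k + 1) (barInc N k x) := fun t => by
      induction t with
      | zero => rfl
      | succ t ih =>
        have := (hw' (k + 1 + t)).2 k (by push_cast; omega) x
        rw [LinearMap.sub_apply, sub_eq_zero] at this
        exact this.trans ih
    obtain ⟨t, rfl⟩ := Nat.exists_eq_add_of_le (show k + 1 ≤ m by omega)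
    rw [LinearMap.sub_apply, barCochain_inc, h t, hψ, sub_self]

/-- If the symbols of all cochains in sufficiently high filtration vanish, then every cocycle there
is a coboundary, by successive approximation. -/
theorem exists_homD_eq {p : ℕ} {n : ℤ}
    (h0 : ∀ p' ≥ p, homDeg (normBar N.H p') M.H (n - p') = ⊥) {z : bar N →ₗ[ℚ] M}
    (hz : z ∈ skelFil N M p n) (hdz : homD (bar N) M n z = 0) :
    ∃ v ∈ skelFil N M p (n - 1), homD (bar N) M (n - 1) v = z := by
  let T : ℕ → Type u := fun m => {v : bar N →ₗ[ℚ] M // v ∈ skelFil N M p (n - 1) ∧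
    z - homD (bar N) M (n - 1) v ∈ skelFil N M (p + m : ℕ) n}
  obtain ⟨t, -, ht⟩ := exists_sequence (T := T)
    (r := fun m v v' => v'.1 - v.1 ∈ skelFil N M (p + m : ℕ) (n - 1))
    ⟨0, zero_mem _, by rw [map_zero, sub_zero]; exact hz⟩ (by
      rintro m ⟨v, hv, hzv⟩
      have hddv := homD_homD (bar N) M (n - 1) v
      rw [sub_add_cancel] at hddv
      have hd : homD (bar N) M n (z - homD (bar N) M (n - 1) v)
          ∈ skelFil N M ((p + m : ℕ) + 1) (n + 1) := by
        rw [map_sub, hdz, hddv, sub_zero]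
        exact zero_mem _
      have hs := symbol_mem_homDeg hzv hd (q := n - (p + m : ℕ)) (by ring)
      rw [h0 _ (by omega), Submodule.mem_bot] at hs
      obtain ⟨v', hv', h⟩ := exists_sub_homD_mem hzv hd hs
      refine ⟨⟨v + v', add_mem hv (skelFil_le_of_le (by push_cast; omega) _ hv'), ?_⟩, ?_⟩
      · rw [map_add, ← sub_sub]
        exact_mod_cast h
      · change v + v' - v ∈ _
        rwa [add_sub_cancel_left])
  obtain ⟨W, hW⟩ := exists_limit (w := fun m => (t m).1) (n := n - 1) (fun m => (t m).2.1.1)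
    (fun m => skelFil_le_of_le (by push_cast; omega) _ (ht m))
  refine ⟨W, ?_, ?_⟩
  · have := add_mem (hW p) (t p).2.1
    rwa [sub_add_cancel] at this
  · have h1 : ∀ m : ℕ, z - homD (bar N) M (n - 1) W ∈ skelFil N M m n := fun m => by
      have h2 := skelFil_d N M m (n - 1) _ (hW m)
      rw [sub_add_cancel, map_sub] at h2
      have h3 : z - homD (bar N) M (n - 1) (t m).1 ∈ skelFil N M m n :=
        skelFil_le_of_le (by push_cast; omega) _ (t m).2.2
      have := sub_mem h3 h2
      rwa [sub_sub_sub_cancel_right] at this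
    have h2 : z - homD (bar N) M (n - 1) W = 0 := by
      refine LinearMap.ext fun x => ?_
      refine barCarrier_induction (P := fun x => (z - homD (bar N) M (n - 1) W) x = 0)
        (map_zero (z - homD (bar N) M (n - 1) W)) (fun x y hx hy => ?_) (fun k x => ?_) x
      · exact (map_add (z - homD (bar N) M (n - 1) W) x y).trans
          ((congrArg₂ (· + ·) hx hy).trans (add_zero 0))
      · exact (h1 (k + 1)).2 k (by push_cast; omega) x
    exact (sub_eq_zero.1 h2).symm

theorem barFilt_convergesStrongly (hA : A.IsSimplyConnected)
    (hM : ∃ l : ℤ, ∀ i > l, M.H.gr i = ⊥) (hN : ∃ k : ℤ, ∀ i < k, N.H.gr i = ⊥) (n : ℤ)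
    {V : Type u} [AddCommGroup V] [Module ℚ V] (α : (barFilt N M).H n ≃ₗ[ℚ] V) :
    (barFilt N M).ConvergesStrongly n α := by
  obtain ⟨l, hl⟩ := hM
  obtain ⟨k, hk⟩ := hN
  refine FiltCx.convergesStrongly_of_acyclic (barFilt N M)
    (fun p hp n f hf => (⟨hf, fun s hs => by omega⟩ : f ∈ skelFil N M p n))
    (fun n => ⟨max 0 (l - k - n), fun p hp x hx hdx => ?_⟩) n α
  obtain ⟨p, rfl⟩ := Int.eq_ofNat_of_zero_le (show 0 ≤ p by omega)
  exact exists_homD_eq (fun p' hp' => homDeg_normBar_eq_bot hA hk hl (by omega)) hx hdx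

end DGMod

end HyperExt

theorem mainTheorem7 (A : HyperExt.CDGA.{u}) (hA : A.IsSimplyConnected)
    (M N : HyperExt.DGMod.{u} A)
    (hM : ∃ l : ℤ, ∀ i > l, M.H.gr i = ⊥) (hN : ∃ k : ℤ, ∀ i < k, N.H.gr i = ⊥) :
    -- the bar construction is a cofibrant replacement of `N`, and the normalised bar construction
    -- over `H(A)` is a projective resolution of `H(N)`
    N.barAug.IsCofibrantReplacement ∧
    (HyperExt.GMod.barComplex N.H).IsProjectiveResolution ∧
    -- the spectral sequence of the skeletal filtration
    ∃ (S : CategoryTheory.CohomologicalSpectralSequence (ModuleCat.{u} ℚ) 1)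
      (I : (HyperExt.DGMod.barFilt N M).Identification S),
      -- the `E₂`-page is `Ext^{p,q}` over `H(A)`, computed by any projective resolution of `H(N)`
      (∀ p q : ℤ, p < 0 → Subsingleton ((S.page 2).X (p, q))) ∧
      (∀ Q : HyperExt.GMod.ComplexOver N.H, Q.IsProjectiveResolution →
        ∃ ψ : Q.Hom (HyperExt.GMod.barComplex N.H), ∀ (p : ℕ) (q : ℤ),
          ∃ θ : (S.page 2).X ((p : ℤ), q) ≃ₗ[ℚ] Q.Ext M.H p q,
            ∀ f : (HyperExt.DGMod.barFilt N M).Z 2 p (p + q),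
              ∃ g ∈ (HyperExt.GMod.barComplex N.H).cocycles M.H p q,
                HyperExt.DGMod.Induces N M p f.1 g ∧
                ∃ w : Q.cocycles M.H p q,
                  w.1 = g.comp ((ψ.f p).restrictScalars ℚ) ∧
                  θ ((I.e 2 (by norm_num) p q).symm
                    ((HyperExt.DGMod.barFilt N M).mkE 2 p (p + q) f)) = Q.mkExt M.H p q w) ∧
      -- it converges strongly to `Ext^n` over `A`, computed by any cofibrant replacement of `N`
      (∀ (P : HyperExt.DGMod.{u} A) (π : HyperExt.DGMod.Hom P N), π.IsCofibrantReplacement →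
        ∃ φ : HyperExt.DGMod.Hom P N.bar, (∀ x, N.barAug.f (φ.f x) = π.f x) ∧
          ∀ n : ℤ, ∃ α : (HyperExt.DGMod.barFilt N M).H n ≃ₗ[ℚ] (HyperExt.DGMod.homCx P M).H n,
            α.toLinearMap = φ.precomp M n ∧
            (HyperExt.DGMod.barFilt N M).ConvergesStrongly n α) := by
  have hB := HyperExt.GMod.barComplex_isProjectiveResolution N.H
  let I := (HyperExt.DGMod.barFilt N M).spectralSequenceIdentification
  refine ⟨N.barAug_isCofibrantReplacement, hB, _, I, fun p q hp => ?_, fun Q hQ => ?_,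
    fun P π hπ => ?_⟩
  · have := HyperExt.DGMod.E_two_subsingleton (N := N) (M := M) hp (p + q)
    exact (I.e 2 (by norm_num) p q).toEquiv.subsingleton
  · obtain ⟨ψ⟩ := HyperExt.GMod.ComplexOver.exists_hom hQ.1 hB
    refine ⟨ψ, fun p q => ?_⟩
    obtain ⟨e, he⟩ := HyperExt.DGMod.exists_E_two_equiv N M p q
    obtain ⟨e', he'⟩ := ψ.exists_ext_equiv hQ hB M.H p q
    refine ⟨((I.e 2 (by norm_num) p q).trans e).trans e', fun f =>
      ⟨_, HyperExt.DGMod.symbol_mem_cocycles f.2, HyperExt.DGMod.symbol_induces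
        ((HyperExt.DGMod.barFilt N M).mem_Z.1 f.2).1 (HyperExt.DGMod.homD_mem_of_mem_Z_two f.2),
        ⟨_, ψ.comp_mem_cocycles M.H (HyperExt.DGMod.symbol_mem_cocycles f.2)⟩, rfl, ?_⟩⟩
    rw [LinearEquiv.trans_apply, LinearEquiv.trans_apply, LinearEquiv.apply_symm_apply, he, he']
  · obtain ⟨φ, hφ, hφ'⟩ := hπ.exists_hom_bar
    exact ⟨φ, hφ, fun n => ⟨LinearEquiv.ofBijective _ (hφ' M n), rfl,
      HyperExt.DGMod.barFilt_convergesStrongly hA hM hN n _⟩⟩
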